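/- Let $N\ge 2$ be an integer, let $s\in(0,1)$ and $p\in(1,\infty)$, let $\mathbb{R}^N_+=\mathbb{R}^{N-1}\times(0,\infty)$, and identify $\partial\mathbb{R}^N_+$ with $\mathbb{R}^{N-1}$. Let $u\colon\mathbb{R}^N_+\to\mathbb{R}$ be weakly differentiable (that is, $u$ and its weak gradient $\mathrm{D}u$ are locally integrable in $\mathbb{R}^N_+$) and satisfy $$\int_{\mathbb{R}^N_+}\frac{|\mathrm{D}u(z)|^p}{z_N^{1-(1-s)p}}\,\mathrm{d}z<\infty .$$ Then $u$ has a trace $v\colon\partial\mathbb{R}^N_+\to\mathbb{R}$, that is, there is a locally integrable function $v$ such that for every $R>0$ $$\lim_{\varepsilon\to0^+}\frac1\varepsilon\int_0^\varepsilon\int_{\{x'\in\mathbb{R}^{N-1}:\,|x'|<R\}}|u(x',t)-v(x')|\,\mathrm{d}x'\,\mathrm{d}t=0 ,$$ and every such $v$ satisfies $$\int_{\partial\mathbb{R}^N_+}\biggl(\int_{\mathbb{R}^N_+}\frac{|v(x)-u(y)|^p}{|x-y|^{N+sp}}\,\mathrm{d}y\biggr)\mathrm{d}x\le\frac{\pi^{\frac{N-1}{2}}\,\Gamma\bigl(\frac{sp+1}{2}\bigr)}{\Gamma\bigl(\frac{N+sp}{2}\bigr)}\Bigl(\frac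 Ns\Bigr)^p\int_{\mathbb{R}^N_+}\frac{|\mathrm{D}u(z)|^p}{z_N^{1-(1-s)p}}\,\mathrm{d}z .$$ -/

import Mathlib

open MeasureTheory Set Filter Topology
open scoped ContDiff ENNReal

/-- The open half-space `ℝ^{n+1}_+ = ℝ^n × (0, ∞)`; the last coordinate is the normal one. -/
def upperHalf (n : ℕ) : Set (EuclideanSpace ℝ (Fin (n + 1))) :=
  {z | 0 < z (Fin.last n)}

/-- The point `(x, t) ∈ ℝ^{n+1}` with tangential part `x ∈ ℝ^n` and last coordinate `t`.
The boundary of the half-space is identified with `ℝ^n` through `x ↦ (x, 0)`. -/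
noncomputable def pointAt {n : ℕ} (x : EuclideanSpace ℝ (Fin n)) (t : ℝ) :
    EuclideanSpace ℝ (Fin (n + 1)) :=
  WithLp.toLp 2 (Fin.snoc (α := fun _ => ℝ) (fun i => x i) t)

/-- `u` is weakly differentiable on the half-space with weak gradient `Du`: both are locally
integrable in the open half-space, and
`∫ u ∂ᵢφ = - ∫ (Du)ᵢ φ` for all smooth `φ` with compact support in the open half-space. -/
structure IsWeakGradient {n : ℕ} (u : EuclideanSpace ℝ (Fin (n + 1)) → ℝ)
    (Du : EuclideanSpace ℝ (Fin (n + 1)) → EuclideanSpace ℝ (Fin (n + 1))) : Prop where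
  locallyIntegrable : LocallyIntegrableOn u (upperHalf n) volume
  locallyIntegrable_grad : LocallyIntegrableOn Du (upperHalf n) volume
  integral_eq : ∀ φ : EuclideanSpace ℝ (Fin (n + 1)) → ℝ,
    ContDiff ℝ ∞ φ → HasCompactSupport φ → tsupport φ ⊆ upperHalf n →
    ∀ i : Fin (n + 1),
      ∫ z in upperHalf n, u z * fderiv ℝ φ z (EuclideanSpace.single i 1) =
        - ∫ z in upperHalf n, Du z i * φ z

/-- `v` is the trace of `u` on the boundary of the half-space: `v` is locally integrable, and it is
the boundary value of `u` in the `L¹_loc` sense, that is, for every `R > 0`,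
`(1/ε) ∫_0^ε ∫_{|x| < R} |u (x, t) - v x| dx dt → 0` as `ε → 0⁺`.
This depends only on the almost everywhere classes of `u` and `v`, and determines `v` almost
everywhere. -/
structure IsTrace {n : ℕ} (u : EuclideanSpace ℝ (Fin (n + 1)) → ℝ)
    (v : EuclideanSpace ℝ (Fin n) → ℝ) : Prop where
  locallyIntegrable : LocallyIntegrable v volume
  tendsto_mean : ∀ R : ℝ, 0 < R →
    Tendsto (fun ε : ℝ => (ENNReal.ofReal ε)⁻¹ *
        ∫⁻ t in Ioo 0 ε, ∫⁻ x in Metric.ball (0 : EuclideanSpace ℝ (Fin n)) R,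
          ENNReal.ofReal |u (pointAt x t) - v x|)
      (𝓝[>] 0) (𝓝 0)

/-- The weighted energy `∫ |Du(z)|^p / z_N^{1 - (1 - s) p} dz` over the half-space. -/
noncomputable def weightedEnergy {n : ℕ} (s p : ℝ)
    (Du : EuclideanSpace ℝ (Fin (n + 1)) → EuclideanSpace ℝ (Fin (n + 1))) : ℝ≥0∞ :=
  ∫⁻ z in upperHalf n, ENNReal.ofReal (‖Du z‖ ^ p / z (Fin.last n) ^ (1 - (1 - s) * p))

/-- The trace conjunction integral `∫ (∫ |v(x) - u(y)|^p / |x - y|^{N + s p} dy) dx`, with `x` in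
the boundary, `y` in the half-space, and `N = n + 1`. -/
noncomputable def conjunctionIntegral {n : ℕ} (s p : ℝ)
    (u : EuclideanSpace ℝ (Fin (n + 1)) → ℝ) (v : EuclideanSpace ℝ (Fin n) → ℝ) : ℝ≥0∞ :=
  ∫⁻ x : EuclideanSpace ℝ (Fin n), ∫⁻ y in upperHalf n,
    ENNReal.ofReal (|v x - u y| ^ p / ‖pointAt x 0 - y‖ ^ (((n + 1 : ℕ) : ℝ) + s * p))

/-! Write `N = n + 1`. In the coordinates `y = (x + t η, t)` of the cone with vertex `(x, 0)`, the
kernel `|x - y| ^ (-(N + s p)) dy` becomes `cosAt η ^ (N + s p) * t ^ (-1 - s p) dt dη`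
(`conjunctionIntegral_eq`). It is thus enough to bound, for each slope `η`, the integral over `(x,
t)` of `t ^ (-1 - s p) * |u (x + t η, t) - v x| ^ p`, and then to integrate in `η`.

Fix a curve `Γ` from `0` to `(η, 1)` inside the half-space. For almost every `(x, t)` the difference
`|u (x + t η, t) - v x|` is at most the integral of `|Du|` along the dilated and translated curve
`(x, 0) + t Γ(r)`. At fixed `r`, the map `(x, t) ↦ (x, 0) + t Γ(r)` is a linear bijection of the
half-space with Jacobian `Γ_N(r)`. Since the weight of the energy is homogeneous, Jensen's
inequality for the measure `Γ_N ^ (s - 1) * |Γ'| dr` gives the bound `L ^ p * weightedEnergy`, where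
`L` is the length of `Γ` for the density `z_N ^ (s - 1)` (`lintegral_rpow_sub_trace_le`).

The curve chosen is the arc of a circle centred on the boundary, hence leaving the boundary
orthogonally. Bernoulli's inequality provides an explicit primitive that bounds its length: `L ≤
cosAt η ^ (-s) * arcBound s (cosAt η ^ 2) / s`. The powers of `cosAt` combine to `cosAt ^ N`, and
what remains is the moment inequality `∫ cosAt ^ N * arcBound ^ p ≤ N ^ p * ∫ cosAt ^ (N + s p)`
(`lintegral_arcBound_le`). Its last integral is the Gamma quotient of the theorem (`cosMoment`). For
`N ≥ 3` the bound `arcBound ≤ 2 - cosAt`, convexity and the first two moments of `cosAt` suffice.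
For `N = 2` the inversion of the half-line and a single-crossing argument
(`exists_mul_sub_le_rpow_sub`) reduce every `p` to `p = 1`.

The trace exists because the finite energy makes `|Du|` integrable on almost every vertical segment
down to the boundary (`IsWeakGradient.exists_isTrace`). The curve estimate is obtained by local
mollification on arcs that avoid the boundary, and it reaches the boundary because `L¹` translations
are continuous and `v` is attained in mean (`IsTrace.ae_enorm_sub_le`). -/

/-! ### Gamma integrals -/

/-- The Gamma integral, as a lower integral. -/
theorem lintegral_rpow_mul_exp_neg_mul {a r : ℝ} (ha : 0 < a) (hr : 0 < r) :
    ∫⁻ t in Ioi (0 : ℝ), ENNReal.ofReal (t ^ (a - 1) * Real.exp (-(r * t))) =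
      ENNReal.ofReal ((1 / r) ^ a * Real.Gamma a) := by
  rw [← Real.integral_rpow_mul_exp_neg_mul_Ioi ha hr, ofReal_integral_eq_lintegral_ofReal]
  · have := (Real.integral_rpow_mul_exp_neg_mul_Ioi ha hr)
    -- The Bochner integral of a non-integrable function is `0`, so the positive value forces
    -- integrability.
    by_contra h
    rw [integral_undef h] at this
    have h2 : 0 < (1 / r) ^ a * Real.Gamma a :=
      mul_pos (Real.rpow_pos_of_pos (by positivity) _) (Real.Gamma_pos_of_pos ha)
    linarith
  · refine (ae_restrict_iff' measurableSet_Ioi).2 (Eventually.of_forall fun t ht => ?_)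
    have : (0 : ℝ) < t := ht
    simp only [Pi.zero_apply]
    positivity

/-- `Γ(q) (1 + ‖x‖ ^ 2) ^ (-q)` is the integral over `t > 0` of `t ^ (q - 1) * exp (-(1 + ‖x‖ ^ 2)
t)`. By Tonelli the integral in `x` becomes a Gaussian one, which leaves a Gamma integral with `q`
lowered by `n / 2`. -/
theorem lintegral_one_add_norm_sq_rpow {n : ℕ} {q : ℝ} (hq : (n : ℝ) / 2 < q) :
    ∫⁻ x : EuclideanSpace ℝ (Fin n), ENNReal.ofReal ((1 + ‖x‖ ^ 2) ^ (-q)) =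
      ENNReal.ofReal (Real.pi ^ ((n : ℝ) / 2) * Real.Gamma (q - n / 2) / Real.Gamma q) := by
  have hn : (0 : ℝ) ≤ (n : ℝ) / 2 := by positivity
  have hq0 : 0 < q := lt_of_le_of_lt hn hq
  have hG := Real.Gamma_pos_of_pos hq0
  have gauss : ∀ t : ℝ, 0 < t → ∫⁻ x : EuclideanSpace ℝ (Fin n),
      ENNReal.ofReal (Real.exp (-t * ‖x‖ ^ 2)) = ENNReal.ofReal ((Real.pi / t) ^ ((n : ℝ) / 2)) := by
    intro t ht
    have h := GaussianFourier.integral_rexp_neg_mul_sq_norm (V := EuclideanSpace ℝ (Fin n)) ht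
    simp only [finrank_euclideanSpace, Fintype.card_fin] at h
    rw [← h, ofReal_integral_eq_lintegral_ofReal]
    · by_contra h'
      rw [integral_undef h'] at h
      have : 0 < (Real.pi / t) ^ ((n : ℝ) / 2) :=
        Real.rpow_pos_of_pos (div_pos Real.pi_pos ht) _
      linarith
    · exact Eventually.of_forall fun x => (Real.exp_pos _).le
  have key : ENNReal.ofReal (Real.Gamma q) *
      ∫⁻ x : EuclideanSpace ℝ (Fin n), ENNReal.ofReal ((1 + ‖x‖ ^ 2) ^ (-q)) =
      ENNReal.ofReal (Real.pi ^ ((n : ℝ) / 2) * Real.Gamma (q - n / 2)) := by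
    calc _ = ∫⁻ x : EuclideanSpace ℝ (Fin n), ∫⁻ t in Ioi (0 : ℝ),
          ENNReal.ofReal (t ^ (q - 1) * Real.exp (-((1 + ‖x‖ ^ 2) * t))) := by
          rw [← lintegral_const_mul' _ _ ENNReal.ofReal_ne_top]
          refine lintegral_congr fun x => ?_
          rw [lintegral_rpow_mul_exp_neg_mul hq0 (by positivity), mul_comm (_ ^ q),
            ENNReal.ofReal_mul hG.le, one_div, Real.inv_rpow (by positivity),
            Real.rpow_neg (by positivity)]
      _ = ∫⁻ t in Ioi (0 : ℝ), ∫⁻ x : EuclideanSpace ℝ (Fin n),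
          ENNReal.ofReal (t ^ (q - 1) * Real.exp (-((1 + ‖x‖ ^ 2) * t))) := by
          refine lintegral_lintegral_swap (Measurable.aemeasurable ?_)
          refine ENNReal.measurable_ofReal.comp (.mul ?_ ?_)
          · exact measurable_snd.pow_const _
          · fun_prop
      _ = ∫⁻ t in Ioi (0 : ℝ), ENNReal.ofReal (Real.pi ^ ((n : ℝ) / 2)) *
            ENNReal.ofReal (t ^ (q - n / 2 - 1) * Real.exp (-(1 * t))) := by
          refine setLIntegral_congr_fun measurableSet_Ioi fun t ht => ?_
          have ht : (0 : ℝ) < t := ht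
          have : ∀ x : EuclideanSpace ℝ (Fin n),
              ENNReal.ofReal (t ^ (q - 1) * Real.exp (-((1 + ‖x‖ ^ 2) * t))) =
              ENNReal.ofReal (t ^ (q - 1) * Real.exp (-(1 * t))) *
                ENNReal.ofReal (Real.exp (-t * ‖x‖ ^ 2)) := by
            intro x
            rw [← ENNReal.ofReal_mul (by positivity), mul_assoc, ← Real.exp_add]
            congr 3
            ring
          simp only [this]
          rw [lintegral_const_mul' _ _ ENNReal.ofReal_ne_top, gauss t ht,
            ← ENNReal.ofReal_mul (by positivity), ← ENNReal.ofReal_mul (by positivity)]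
          congr 1
          rw [Real.div_rpow Real.pi_pos.le ht.le,
            show q - n / 2 - 1 = (q - 1) - n / 2 by ring, Real.rpow_sub ht (q - 1)]
          ring
      _ = _ := by
          rw [lintegral_const_mul' _ _ ENNReal.ofReal_ne_top,
            lintegral_rpow_mul_exp_neg_mul (by linarith) one_pos,
            ← ENNReal.ofReal_mul (by positivity)]
          simp
  rw [ENNReal.ofReal_div_of_pos hG, ← key, mul_comm, ENNReal.mul_div_cancel_right]
  · simpa using hG
  · exact ENNReal.ofReal_ne_top

/-- The cosine of the angle between `(x, 1)` and the vertical direction. -/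
noncomputable def cosAt {n : ℕ} (x : EuclideanSpace ℝ (Fin n)) : ℝ :=
  (1 + ‖x‖ ^ 2) ^ (-(1 / 2) : ℝ)

/-! ### Moments of the cosine of the slope -/

section cosAt
variable {n : ℕ}

theorem cosAt_pos (x : EuclideanSpace ℝ (Fin n)) : 0 < cosAt x :=
  Real.rpow_pos_of_pos (by positivity) _

theorem cosAt_le_one (x : EuclideanSpace ℝ (Fin n)) : cosAt x ≤ 1 :=
  Real.rpow_le_one_of_one_le_of_nonpos (by nlinarith [sq_nonneg ‖x‖]) (by norm_num)

theorem cosAt_rpow (x : EuclideanSpace ℝ (Fin n)) (b : ℝ) :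
    cosAt x ^ b = (1 + ‖x‖ ^ 2) ^ (-(b / 2)) := by
  rw [cosAt, ← Real.rpow_mul (by positivity)]
  congr 1
  ring

theorem cosAt_sq (x : EuclideanSpace ℝ (Fin n)) : cosAt x ^ 2 = (1 + ‖x‖ ^ 2)⁻¹ := by
  rw [← Real.rpow_natCast, cosAt_rpow, ← Real.rpow_neg_one]
  norm_num

theorem continuous_cosAt : Continuous (cosAt : EuclideanSpace ℝ (Fin n) → ℝ) := by
  unfold cosAt
  refine Continuous.rpow_const (by fun_prop) fun x => Or.inl ?_
  positivity

theorem measurable_cosAt : Measurable (cosAt : EuclideanSpace ℝ (Fin n) → ℝ) :=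
  continuous_cosAt.measurable

theorem integrable_cosAt_rpow {b : ℝ} (hb : (n : ℝ) < b) :
    Integrable fun x : EuclideanSpace ℝ (Fin n) => cosAt x ^ b := by
  have := integrable_rpow_neg_one_add_norm_sq (E := EuclideanSpace ℝ (Fin n)) (μ := volume)
    (r := b) (by simpa using hb)
  refine this.congr (Eventually.of_forall fun x => ?_)
  simp only [cosAt_rpow, neg_div]

theorem lintegral_cosAt_rpow {b : ℝ} (hb : (n : ℝ) < b) :
    ∫⁻ x : EuclideanSpace ℝ (Fin n), ENNReal.ofReal (cosAt x ^ b) =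
      ENNReal.ofReal (Real.pi ^ ((n : ℝ) / 2) * Real.Gamma ((b - n) / 2) / Real.Gamma (b / 2)) := by
  simp only [cosAt_rpow]
  rw [lintegral_one_add_norm_sq_rpow (by linarith)]
  congr 4
  ring

theorem integral_cosAt_rpow {b : ℝ} (hb : (n : ℝ) < b) :
    ∫ x : EuclideanSpace ℝ (Fin n), cosAt x ^ b =
      Real.pi ^ ((n : ℝ) / 2) * Real.Gamma ((b - n) / 2) / Real.Gamma (b / 2) := by
  have hn : (0 : ℝ) ≤ n := n.cast_nonneg
  have h0 : ∀ x : EuclideanSpace ℝ (Fin n), 0 ≤ cosAt x ^ b :=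
    fun x => Real.rpow_nonneg (cosAt_pos x).le _
  rw [integral_eq_lintegral_of_nonneg_ae (Eventually.of_forall h0)
    (integrable_cosAt_rpow hb).aestronglyMeasurable, lintegral_cosAt_rpow hb,
    ENNReal.toReal_ofReal]
  have := Real.Gamma_pos_of_pos (show 0 < (b - n) / 2 by linarith)
  have := Real.Gamma_pos_of_pos (show 0 < b / 2 by linarith)
  positivity

/-- The integral of `cosAt ^ (n + 1 + a)` is the moment of order `a` of `cosAt` with respect to the
finite measure of density `cosAt ^ (n + 1)`. -/
noncomputable def cosMoment (n : ℕ) (a : ℝ) : ℝ :=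
  Real.pi ^ ((n : ℝ) / 2) * Real.Gamma ((1 + a) / 2) / Real.Gamma ((n + 1 + a) / 2)

theorem integrable_cosAt_mul_rpow {a : ℝ} (ha : -1 < a) :
    Integrable fun x : EuclideanSpace ℝ (Fin n) => cosAt x ^ (n + 1 : ℕ) * cosAt x ^ a := by
  have : (n : ℝ) < (n + 1 : ℕ) + a := by push_cast; linarith
  refine (integrable_cosAt_rpow this).congr (Eventually.of_forall fun x => ?_)
  simp only
  rw [Real.rpow_add (cosAt_pos x), Real.rpow_natCast]

theorem integral_cosAt_mul_rpow {a : ℝ} (ha : -1 < a) :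
    ∫ x : EuclideanSpace ℝ (Fin n), cosAt x ^ (n + 1 : ℕ) * cosAt x ^ a = cosMoment n a := by
  have : (n : ℝ) < (n + 1 : ℕ) + a := by push_cast; linarith
  rw [cosMoment, show (n : ℝ) + 1 + a = (n + 1 : ℕ) + a by push_cast; ring,
    show 1 + a = (n + 1 : ℕ) + a - n by push_cast; ring, ← integral_cosAt_rpow this]
  refine integral_congr_ae (Eventually.of_forall fun x => ?_)
  simp only
  rw [Real.rpow_add (cosAt_pos x), Real.rpow_natCast]

theorem integrable_cosAt_pow : Integrable fun x : EuclideanSpace ℝ (Fin n) =>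
    cosAt x ^ (n + 1 : ℕ) := by
  simpa using integrable_cosAt_mul_rpow (n := n) (a := 0) (by norm_num)

theorem integral_cosAt_pow :
    ∫ x : EuclideanSpace ℝ (Fin n), cosAt x ^ (n + 1 : ℕ) = cosMoment n 0 := by
  simpa using integral_cosAt_mul_rpow (n := n) (a := 0) (by norm_num)

theorem integrable_cosAt_mul {f : EuclideanSpace ℝ (Fin n) → ℝ} (hf : Measurable f) {M : ℝ}
    (hM : ∀ x, |f x| ≤ M) : Integrable fun x => cosAt x ^ (n + 1 : ℕ) * f x :=
  integrable_cosAt_pow.mul_bdd hf.aestronglyMeasurable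
    (Eventually.of_forall fun x => by simpa using hM x)

theorem cosMoment_pos {a : ℝ} (ha : -1 < a) : 0 < cosMoment n a := by
  have hn : (0 : ℝ) ≤ n := n.cast_nonneg
  have := Real.Gamma_pos_of_pos (show 0 < (1 + a) / 2 by linarith)
  have := Real.Gamma_pos_of_pos (show 0 < (n + 1 + a) / 2 by linarith)
  unfold cosMoment
  positivity

theorem cosMoment_add_two {a : ℝ} (ha : -1 < a) :
    (n + 1 + a) * cosMoment n (a + 2) = (1 + a) * cosMoment n a := by
  have hn : (0 : ℝ) ≤ n := n.cast_nonneg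
  have h1 : (0 : ℝ) < (1 + a) / 2 := by linarith
  have h2 : (0 : ℝ) < (n + 1 + a) / 2 := by linarith
  have := Real.Gamma_pos_of_pos h2
  have h3 : (n : ℝ) + 1 + a ≠ 0 := (by linarith : (0 : ℝ) < n + 1 + a).ne'
  unfold cosMoment
  rw [show (1 + (a + 2)) / 2 = (1 + a) / 2 + 1 by ring, Real.Gamma_add_one h1.ne',
    show (n + 1 + (a + 2)) / 2 = (n + 1 + a) / 2 + 1 by ring, Real.Gamma_add_one h2.ne']
  field_simp

/-- The density `cosAt ^ (n + 1)` is the surface measure of the unit half-sphere of `ℝ^{n+1}` under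
central projection, and `cosAt` is the height there. The squares of the coordinates have equal means
summing to `1`. -/
theorem cosMoment_two : (n + 1) * cosMoment n 2 = cosMoment n 0 := by
  simpa using cosMoment_add_two (n := n) (a := 0) (by norm_num)

/-- A lower bound for the mean of `cosAt`, from the log-convexity of the Gamma function. -/
theorem cosMoment_one_sq_ge :
    2 * cosMoment n 0 ^ 2 ≤ Real.pi * (n + 1) * cosMoment n 1 ^ 2 := by
  have hn : (0 : ℝ) ≤ n := n.cast_nonneg
  have hpi := Real.pi_pos
  set G := Real.Gamma (((n : ℝ) + 1) / 2) with hG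
  set G' := Real.Gamma (((n : ℝ) + 1 + 1) / 2) with hG'
  have h1 : 0 < G := Real.Gamma_pos_of_pos (by linarith)
  have h2 : 0 < G' := Real.Gamma_pos_of_pos (by linarith)
  -- `(n + 2) / 2` is the midpoint of `(n + 1) / 2` and `(n + 1) / 2 + 1`.
  have key : G' ^ 2 ≤ G ^ 2 * ((n + 1) / 2) := by
    have h := Real.Gamma_mul_add_mul_le_rpow_Gamma_mul_rpow_Gamma
      (s := ((n : ℝ) + 1) / 2) (t := ((n : ℝ) + 1) / 2 + 1) (a := 1 / 2) (b := 1 / 2)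
      (by linarith) (by linarith) (by norm_num) (by norm_num) (by norm_num)
    rw [Real.Gamma_add_one (by positivity), show (1 / 2 : ℝ) * (((n : ℝ) + 1) / 2) +
      1 / 2 * (((n : ℝ) + 1) / 2 + 1) = ((n : ℝ) + 1 + 1) / 2 by ring, ← hG, ← hG',
      ← Real.sqrt_eq_rpow, ← Real.sqrt_eq_rpow, ← Real.sqrt_mul h1.le] at h
    have := (Real.le_sqrt h2.le (by positivity)).1 h
    linarith
  have e0 : cosMoment n 0 = Real.pi ^ ((n : ℝ) / 2) * √Real.pi / G := by
    simp [cosMoment, hG, Real.Gamma_one_half_eq, -one_div]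
  have e1 : cosMoment n 1 = Real.pi ^ ((n : ℝ) / 2) / G' := by
    simp [cosMoment, hG', show (1 + 1 : ℝ) / 2 = 1 by norm_num]
  rw [e0, e1]
  simp only [div_pow, mul_pow, Real.sq_sqrt hpi.le]
  have hA : (0 : ℝ) < (Real.pi ^ ((n : ℝ) / 2)) ^ 2 := by positivity
  rw [← mul_div_assoc, ← mul_div_assoc, div_le_div_iff₀ (by positivity) (by positivity)]
  nlinarith [mul_le_mul_of_nonneg_left key (mul_pos hA hpi).le]

theorem cosMoment_one_zero : cosMoment 1 0 = Real.pi := by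
  have : √Real.pi * √Real.pi = Real.pi := Real.mul_self_sqrt Real.pi_pos.le
  simp [cosMoment, ← Real.sqrt_eq_rpow, Real.Gamma_one_half_eq, -one_div, this,
    show (1 + 1 : ℝ) / 2 = 1 by norm_num]

theorem cosMoment_one_one : cosMoment 1 1 = 2 := by
  have h : Real.Gamma (3 / 2) = 1 / 2 * √Real.pi := by
    rw [show (3 / 2 : ℝ) = 1 / 2 + 1 by norm_num, Real.Gamma_add_one (by norm_num),
      Real.Gamma_one_half_eq]
  have : √Real.pi ≠ 0 := (Real.sqrt_pos.2 Real.pi_pos).ne'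
  simp only [cosMoment, Nat.cast_one, ← Real.sqrt_eq_rpow,
    show (1 + 1 : ℝ) / 2 = 1 by norm_num, show (1 + 1 + 1 : ℝ) / 2 = 3 / 2 by norm_num, h,
    Real.Gamma_one]
  field_simp

/-- Archimedes: on the half-sphere of `ℝ^3` the height is uniformly distributed on `[0, 1]`, so its
moment of order `a` is a fraction `1 / (1 + a)` of the mass. -/
theorem cosMoment_two_ratio {a : ℝ} (ha : -1 < a) :
    (1 + a) * cosMoment 2 a = cosMoment 2 0 := by
  have h : ∀ b : ℝ, -1 < b → (1 + b) * cosMoment 2 b = 2 * Real.pi := by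
    intro b hb
    have h1 : (0 : ℝ) < (1 + b) / 2 := by linarith
    have := Real.Gamma_pos_of_pos h1
    have h2 : 1 + b ≠ 0 := (by linarith : (0 : ℝ) < 1 + b).ne'
    simp only [cosMoment, Nat.cast_ofNat]
    rw [show (2 + 1 + b) / 2 = (1 + b) / 2 + 1 by ring, Real.Gamma_add_one h1.ne']
    simp
    field_simp
  rw [h a ha]
  simpa using (h 0 (by norm_num)).symm

/-- The exact mean `4 / (3π)` is needed for `N = 4`, where the bound of `cosMoment_one_sq_ge` is too
weak for `four_add_inv_le`. -/
theorem cosMoment_three_one : 3 * Real.pi * cosMoment 3 1 = 4 * cosMoment 3 0 := by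
  have h : Real.Gamma (5 / 2) = 3 / 2 * (1 / 2 * √Real.pi) := by
    rw [show (5 / 2 : ℝ) = 1 / 2 + 1 + 1 by norm_num, Real.Gamma_add_one (by norm_num),
      Real.Gamma_add_one (by norm_num), Real.Gamma_one_half_eq]
    norm_num
  have h0 : 0 < √Real.pi := Real.sqrt_pos.2 Real.pi_pos
  simp only [cosMoment, Nat.cast_ofNat, show (1 + 1 : ℝ) / 2 = 1 by norm_num,
    show (3 + 1 + 1 : ℝ) / 2 = 5 / 2 by norm_num, h, Real.Gamma_one, add_zero,
    show (3 + 1 : ℝ) / 2 = 2 by norm_num, Real.Gamma_one_half_eq]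
  have h3 : √Real.pi * √Real.pi = Real.pi := Real.mul_self_sqrt Real.pi_pos.le
  have h4 : Real.Gamma 2 = 1 := by
    rw [show (2 : ℝ) = 1 + 1 by norm_num, Real.Gamma_add_one (by norm_num), Real.Gamma_one]
    norm_num
  rw [h4]
  field_simp
  nlinarith [h3]

end cosAt

/-! ### Tangent lines of powers and Jensen's inequality -/

section tangent

/-- Bernoulli's inequality for `x / κ`, multiplied by `κ ^ q`. -/
theorem tangent_le_rpow {q κ x : ℝ} (hq : 1 ≤ q) (hκ : 0 < κ) (hx : 0 ≤ x) :
    κ ^ q + q * κ ^ (q - 1) * (x - κ) ≤ x ^ q := by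
  have h := one_add_mul_self_le_rpow_one_add (s := x / κ - 1) (by
    have := div_nonneg hx hκ.le
    linarith) hq
  rw [show 1 + (x / κ - 1) = x / κ by ring, Real.div_rpow hx hκ.le] at h
  have hp := Real.rpow_pos_of_pos hκ q
  rw [le_div_iff₀ hp] at h
  rw [Real.rpow_sub_one hκ.ne']
  refine le_trans (le_of_eq ?_) h
  field_simp

theorem rpow_le_tangent {q κ x : ℝ} (hq0 : 0 ≤ q) (hq : q ≤ 1) (hκ : 0 < κ) (hx : 0 ≤ x) :
    x ^ q ≤ κ ^ q + q * κ ^ (q - 1) * (x - κ) := by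
  have h := rpow_one_add_le_one_add_mul_self (s := x / κ - 1) (by
    have := div_nonneg hx hκ.le
    linarith) hq0 hq
  rw [show 1 + (x / κ - 1) = x / κ by ring, Real.div_rpow hx hκ.le] at h
  have hp := Real.rpow_pos_of_pos hκ q
  rw [div_le_iff₀ hp] at h
  rw [Real.rpow_sub_one hκ.ne']
  refine le_trans h (le_of_eq ?_)
  field_simp

variable {α : Type*} [MeasurableSpace α] {μ : Measure α} {w f : α → ℝ}

/-- Jensen's inequality for the power `q ≥ 1` and the finite measure of density `w`. -/
theorem mul_rpow_le_integral_mul_rpow {q κ : ℝ} (hq : 1 ≤ q) (hκ : 0 < κ) (hw : ∀ x, 0 ≤ w x)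
    (hf : ∀ x, 0 ≤ f x) (iw : Integrable w μ) (iwf : Integrable (fun x => w x * f x) μ)
    (iwq : Integrable (fun x => w x * f x ^ q) μ)
    (hmean : ∫ x, w x * f x ∂μ = κ * ∫ x, w x ∂μ) :
    κ ^ q * ∫ x, w x ∂μ ≤ ∫ x, w x * f x ^ q ∂μ := by
  -- The tangent is taken at the mean `κ`, so that its linear part integrates to zero.
  have h : ∫ x, ((κ ^ q - q * κ ^ (q - 1) * κ) * w x + q * κ ^ (q - 1) * (w x * f x)) ∂μ ≤
      ∫ x, w x * f x ^ q ∂μ := by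
    refine integral_mono ((iw.const_mul _).add (iwf.const_mul _)) iwq fun x => ?_
    have := mul_le_mul_of_nonneg_left (tangent_le_rpow hq hκ (hf x)) (hw x)
    simp only
    linarith
  rw [integral_add (iw.const_mul _) (iwf.const_mul _), integral_const_mul, integral_const_mul,
    hmean] at h
  linarith

/-- Jensen's inequality for the power `q ≤ 1` and the finite measure of density `w`. -/
theorem integral_mul_rpow_le_mul_rpow {q κ : ℝ} (hq0 : 0 ≤ q) (hq : q ≤ 1) (hκ : 0 < κ)
    (hw : ∀ x, 0 ≤ w x)
    (hf : ∀ x, 0 ≤ f x) (iw : Integrable w μ) (iwf : Integrable (fun x => w x * f x) μ)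
    (iwq : Integrable (fun x => w x * f x ^ q) μ)
    (hmean : ∫ x, w x * f x ∂μ = κ * ∫ x, w x ∂μ) :
    ∫ x, w x * f x ^ q ∂μ ≤ κ ^ q * ∫ x, w x ∂μ := by
  have h : ∫ x, w x * f x ^ q ∂μ ≤
      ∫ x, ((κ ^ q - q * κ ^ (q - 1) * κ) * w x + q * κ ^ (q - 1) * (w x * f x)) ∂μ := by
    refine integral_mono iwq ((iw.const_mul _).add (iwf.const_mul _)) fun x => ?_
    have := mul_le_mul_of_nonneg_left (rpow_le_tangent hq0 hq hκ (hf x)) (hw x)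
    simp only
    linarith
  rw [integral_add (iw.const_mul _) (iwf.const_mul _), integral_const_mul, integral_const_mul,
    hmean] at h
  linarith

end tangent

/-! ### The moment inequality for `2 - cosAt`, `N ≥ 3` -/

section twoSub
variable {n : ℕ}

theorem integrable_cosAt_mul_two_sub_rpow {p : ℝ} (hp : 0 ≤ p) :
    Integrable fun x : EuclideanSpace ℝ (Fin n) => cosAt x ^ (n + 1 : ℕ) * (2 - cosAt x) ^ p := by
  refine integrable_cosAt_mul ((measurable_const.sub measurable_cosAt).pow_const p)
    (M := 2 ^ p) fun x => ?_
  have h1 := cosAt_pos x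
  have h2 := cosAt_le_one x
  rw [abs_of_nonneg (Real.rpow_nonneg (by linarith) _)]
  exact Real.rpow_le_rpow (by linarith) (by linarith) hp

theorem integrable_cosAt_mul_self : Integrable fun x : EuclideanSpace ℝ (Fin n) =>
    cosAt x ^ (n + 1 : ℕ) * cosAt x := by
  simpa using integrable_cosAt_mul_rpow (n := n) (a := 1) (by norm_num)

theorem integral_cosAt_mul_self :
    ∫ x : EuclideanSpace ℝ (Fin n), cosAt x ^ (n + 1 : ℕ) * cosAt x = cosMoment n 1 := by
  simpa using integral_cosAt_mul_rpow (n := n) (a := 1) (by norm_num)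

theorem integrable_cosAt_mul_sq : Integrable fun x : EuclideanSpace ℝ (Fin n) =>
    cosAt x ^ (n + 1 : ℕ) * cosAt x ^ 2 := by
  simpa using integrable_cosAt_mul_rpow (n := n) (a := 2) (by norm_num)

theorem integral_cosAt_mul_sq :
    ∫ x : EuclideanSpace ℝ (Fin n), cosAt x ^ (n + 1 : ℕ) * cosAt x ^ 2 = cosMoment n 2 := by
  simpa using integral_cosAt_mul_rpow (n := n) (a := 2) (by norm_num)

theorem cosMoment_one_rpow_le {p : ℝ} (hp : 1 ≤ p) :
    (cosMoment n 1 / cosMoment n 0) ^ p * cosMoment n 0 ≤ cosMoment n p := by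
  have h0 : 0 < cosMoment n 0 := cosMoment_pos (by norm_num)
  have h1 : 0 < cosMoment n 1 := cosMoment_pos (by norm_num)
  have h := mul_rpow_le_integral_mul_rpow (μ := (volume : Measure (EuclideanSpace ℝ (Fin n))))
    (w := fun x => cosAt x ^ (n + 1 : ℕ)) (f := cosAt) hp (div_pos h1 h0)
    (fun x => pow_nonneg (cosAt_pos x).le _) (fun x => (cosAt_pos x).le) integrable_cosAt_pow
    integrable_cosAt_mul_self (integrable_cosAt_mul_rpow (by linarith)) (by
      rw [integral_cosAt_mul_self, integral_cosAt_pow]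
      field_simp)
  rwa [integral_cosAt_pow, integral_cosAt_mul_rpow (by linarith)] at h

theorem cosMoment_two_rpow_le {p : ℝ} (hp : 2 ≤ p) :
    (1 / (n + 1 : ℝ)) ^ (p / 2) * cosMoment n 0 ≤ cosMoment n p := by
  have h0 : 0 < cosMoment n 0 := cosMoment_pos (by norm_num)
  have e : ∀ x : EuclideanSpace ℝ (Fin n), (cosAt x ^ 2) ^ (p / 2) = cosAt x ^ p := fun x => by
    rw [← Real.rpow_natCast, ← Real.rpow_mul (cosAt_pos x).le]
    congr 1
    push_cast
    ring
  have h := mul_rpow_le_integral_mul_rpow (μ := (volume : Measure (EuclideanSpace ℝ (Fin n))))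
    (w := fun x => cosAt x ^ (n + 1 : ℕ)) (f := fun x => cosAt x ^ 2) (q := p / 2)
    (κ := 1 / (n + 1 : ℝ)) (by linarith) (by positivity)
    (fun x => pow_nonneg (cosAt_pos x).le _) (fun x => sq_nonneg _) integrable_cosAt_pow
    integrable_cosAt_mul_sq (by
      simp only [e]
      exact integrable_cosAt_mul_rpow (by linarith)) (by
      rw [integral_cosAt_mul_sq, integral_cosAt_pow, ← cosMoment_two (n := n)]
      field_simp)
  simp only [e] at h
  rwa [integral_cosAt_pow, integral_cosAt_mul_rpow (by linarith)] at h

/-- The moment inequality on the boundary of a half-space of dimension at least four,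
for exponents at least two. -/
theorem integral_two_sub_cosAt_rpow_le_of_two_le (hn : 3 ≤ n) {p : ℝ} (hp : 2 ≤ p) :
    ∫ x : EuclideanSpace ℝ (Fin n), cosAt x ^ (n + 1 : ℕ) * (2 - cosAt x) ^ p ≤
      (n + 1 : ℝ) ^ p * cosMoment n p := by
  have h0 : 0 < cosMoment n 0 := cosMoment_pos (by norm_num)
  have hn' : (3 : ℝ) ≤ n := by exact_mod_cast hn
  calc _ ≤ ∫ x : EuclideanSpace ℝ (Fin n), cosAt x ^ (n + 1 : ℕ) * 2 ^ p := by
        refine integral_mono (integrable_cosAt_mul_two_sub_rpow (by linarith))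
          (integrable_cosAt_pow.mul_const _) fun x => ?_
        have h1 := cosAt_pos x
        have h2 := cosAt_le_one x
        exact mul_le_mul_of_nonneg_left
          (Real.rpow_le_rpow (by linarith) (by linarith) (by linarith)) (by positivity)
    _ = 2 ^ p * cosMoment n 0 := by rw [integral_mul_const, integral_cosAt_pow, mul_comm]
    -- The powers of `n + 1` combine to `(n + 1) ^ (p / 2)`, so the claim is `4 ≤ n + 1`. The Jensen
    -- bound used next comes from the mean `1 / (n + 1)` of `cosAt ^ 2`.
    _ ≤ (n + 1 : ℝ) ^ p * ((1 / (n + 1 : ℝ)) ^ (p / 2) * cosMoment n 0) := by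
        rw [← mul_assoc]
        refine mul_le_mul_of_nonneg_right ?_ h0.le
        have e1 : (2 : ℝ) ^ p = 4 ^ (p / 2) := by
          rw [show (4 : ℝ) = 2 ^ (2 : ℝ) by norm_num, ← Real.rpow_mul (by norm_num)]
          congr 1
          ring
        have e2 : (n + 1 : ℝ) ^ p * (1 / (n + 1 : ℝ)) ^ (p / 2) = (n + 1 : ℝ) ^ (p / 2) := by
          rw [one_div, Real.inv_rpow (by positivity), ← Real.rpow_neg (by positivity),
            ← Real.rpow_add (by positivity)]
          congr 1
          ring
        rw [e1, e2]
        exact Real.rpow_le_rpow (by norm_num) (by linarith) (by linarith)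
    _ ≤ _ := by
        gcongr
        exact cosMoment_two_rpow_le hp

/-- With `e` the mean of `cosAt`, this compares the mean `4 - 4 e + 1 / N` of `(2 - cosAt) ^ 2` with
`(N e) ^ 2`, which is the moment inequality for `p = 2` with the second moment of `cosAt` replaced
by `e ^ 2`. -/
theorem four_add_inv_le (hn : 3 ≤ n) {e : ℝ} (he : 0 < e) (h1 : 2 ≤ Real.pi * (n + 1) * e ^ 2)
    (h3 : n = 3 → 3 * Real.pi * e = 4) : 4 + 1 / (n + 1 : ℝ) ≤ (n + 1 : ℝ) ^ 2 * e ^ 2 + 4 * e := by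
  have hpi := Real.pi_lt_d2
  have hpi0 := Real.pi_pos
  have hn' : (3 : ℝ) ≤ n := by exact_mod_cast hn
  -- `2 / π > 2 / 3.15 > 0.634`. From `n = 6` on, `N ^ 2 e ^ 2 ≥ 7 * 0.634` is enough by itself;
  -- smaller `n` also need the term `4 e`, and `n = 3` the exact mean.
  have key : 0.634 ≤ (n + 1) * e ^ 2 := by
    have : 0 < (n + 1) * e ^ 2 := by positivity
    nlinarith
  rcases (show n = 3 ∨ n = 4 ∨ n = 5 ∨ 6 ≤ n by omega) with h | h | h | h
  · have h4 := h3 h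
    subst h
    have : 0.423 ≤ e := by nlinarith
    norm_num at *
    nlinarith
  · subst h
    norm_num at *
    have : 0.35 ≤ e := by nlinarith
    nlinarith
  · subst h
    norm_num at *
    have : 0.32 ≤ e := by nlinarith
    nlinarith
  · have h6 : (6 : ℝ) ≤ n := by exact_mod_cast h
    have : 1 / (n + 1 : ℝ) ≤ 1 / 7 := by
      apply one_div_le_one_div_of_le <;> linarith
    nlinarith

/-- The moment inequality on the boundary of a half-space of dimension at least four,
for exponents at most two. -/
theorem integral_two_sub_cosAt_rpow_le_of_le_two (hn : 3 ≤ n) {p : ℝ} (hp1 : 1 ≤ p) (hp : p ≤ 2) :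
    ∫ x : EuclideanSpace ℝ (Fin n), cosAt x ^ (n + 1 : ℕ) * (2 - cosAt x) ^ p ≤
      (n + 1 : ℝ) ^ p * cosMoment n p := by
  have h0 : 0 < cosMoment n 0 := cosMoment_pos (by norm_num)
  have h1 : 0 < cosMoment n 1 := cosMoment_pos (by norm_num)
  have hn' : (3 : ℝ) ≤ n := by exact_mod_cast hn
  set e := cosMoment n 1 / cosMoment n 0 with he
  have he0 : 0 < e := div_pos h1 h0
  have hm1 : cosMoment n 1 = e * cosMoment n 0 := by rw [he]; field_simp
  have hm2 : cosMoment n 2 = 1 / (n + 1) * cosMoment n 0 := by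
    rw [← cosMoment_two]
    field_simp
  have hge : 4 + 1 / (n + 1 : ℝ) ≤ (n + 1 : ℝ) ^ 2 * e ^ 2 + 4 * e := by
    refine four_add_inv_le hn he0 ?_ fun h => ?_
    · have := cosMoment_one_sq_ge (n := n)
      rw [hm1] at this
      have h2 : 0 < cosMoment n 0 ^ 2 := by positivity
      nlinarith
    · subst h
      have := cosMoment_three_one
      rw [hm1] at this
      nlinarith
  -- The mean of `(2 - cosAt) ^ 2`. The final chain applies Jensen twice, with the concave power `p
  -- / 2` at this mean and the convex power `p` at the mean `e`; between the two stands `V ≤ (N e) ^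
  -- 2`.
  set V := 4 - 4 * e + 1 / (n + 1 : ℝ) with hV
  have sq : ∀ x : EuclideanSpace ℝ (Fin n), cosAt x ^ (n + 1 : ℕ) * (2 - cosAt x) ^ 2 =
      4 * cosAt x ^ (n + 1 : ℕ) - 4 * (cosAt x ^ (n + 1 : ℕ) * cosAt x) +
        cosAt x ^ (n + 1 : ℕ) * cosAt x ^ 2 := fun x => by ring
  have isq : Integrable fun x : EuclideanSpace ℝ (Fin n) =>
      cosAt x ^ (n + 1 : ℕ) * (2 - cosAt x) ^ 2 := by
    simpa using integrable_cosAt_mul_two_sub_rpow (n := n) (p := 2) (by norm_num)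
  have mean : ∫ x : EuclideanSpace ℝ (Fin n), cosAt x ^ (n + 1 : ℕ) * (2 - cosAt x) ^ 2 =
      V * ∫ x : EuclideanSpace ℝ (Fin n), cosAt x ^ (n + 1 : ℕ) := by
    simp only [sq]
    have i1 : Integrable fun x : EuclideanSpace ℝ (Fin n) =>
        4 * cosAt x ^ (n + 1 : ℕ) - 4 * (cosAt x ^ (n + 1 : ℕ) * cosAt x) :=
      (integrable_cosAt_pow.const_mul _).sub (integrable_cosAt_mul_self.const_mul _)
    rw [integral_add i1 integrable_cosAt_mul_sq, integral_sub (integrable_cosAt_pow.const_mul _)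
      (integrable_cosAt_mul_self.const_mul _), integral_const_mul, integral_const_mul,
      integral_cosAt_mul_self, integral_cosAt_mul_sq, integral_cosAt_pow, hm1, hm2, hV]
    ring
  have ee : ∀ x : EuclideanSpace ℝ (Fin n), ((2 - cosAt x) ^ 2) ^ (p / 2) = (2 - cosAt x) ^ p :=
    fun x => by
      have h2 := cosAt_le_one x
      rw [← Real.rpow_natCast, ← Real.rpow_mul (by linarith)]
      congr 1
      push_cast
      ring
  have hVpos : 0 < V := by
    by_contra h
    have h2 : 0 < ∫ x : EuclideanSpace ℝ (Fin n), cosAt x ^ (n + 1 : ℕ) * (2 - cosAt x) ^ 2 := by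
      refine lt_of_lt_of_le ((integral_cosAt_pow (n := n)).symm ▸ h0)
        (integral_mono integrable_cosAt_pow isq fun x => ?_)
      have h1 := cosAt_pos x
      have h2 := cosAt_le_one x
      have : 1 ≤ (2 - cosAt x) ^ 2 := by nlinarith
      exact le_mul_of_one_le_right (by positivity) this
    rw [mean, integral_cosAt_pow] at h2
    nlinarith
  calc _ ≤ V ^ (p / 2) * cosMoment n 0 := by
        have h := integral_mul_rpow_le_mul_rpow
          (μ := (volume : Measure (EuclideanSpace ℝ (Fin n))))
          (w := fun x => cosAt x ^ (n + 1 : ℕ)) (f := fun x => (2 - cosAt x) ^ 2) (q := p / 2)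
          (by linarith) (by linarith) hVpos
          (fun x => pow_nonneg (cosAt_pos x).le _) (fun x => sq_nonneg _) integrable_cosAt_pow
          isq (by
            simp only [ee]
            exact integrable_cosAt_mul_two_sub_rpow (by linarith)) mean
        simpa only [ee, integral_cosAt_pow] using h
    _ ≤ ((n + 1 : ℝ) ^ p * e ^ p) * cosMoment n 0 := by
        refine mul_le_mul_of_nonneg_right ?_ h0.le
        rw [← Real.mul_rpow (by positivity) he0.le,
          show ((n + 1 : ℝ) * e) ^ p = (((n + 1 : ℝ) * e) ^ (2 : ℝ)) ^ (p / 2) by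
            rw [← Real.rpow_mul (by positivity)]
            congr 1
            ring]
        refine Real.rpow_le_rpow hVpos.le ?_ (by linarith)
        rw [Real.rpow_two, hV]
        linarith
    _ ≤ _ := by
        rw [mul_assoc]
        gcongr
        exact cosMoment_one_rpow_le hp1

/-- The chord of the convex power over `[1, 2]` gives `(2 - c) ^ p ≤ 2 ^ p - (2 ^ p - 1) c`. As `c`
is uniform on `[0, 1]`, the claim becomes `(2 ^ p + 1) (1 + p) / 2 ≤ 3 ^ p`, which follows from `2 ^
p ≥ 1 + p` and `(3 / 2) ^ p ≥ 1 + p / 2`. -/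
theorem integral_two_sub_cosAt_rpow_le_dim_two {p : ℝ} (hp : 1 ≤ p) :
    ∫ x : EuclideanSpace ℝ (Fin 2), cosAt x ^ (2 + 1 : ℕ) * (2 - cosAt x) ^ p ≤
      3 ^ p * cosMoment 2 p := by
  have h0 : 0 < cosMoment 2 0 := cosMoment_pos (by norm_num)
  have hm1 : 2 * cosMoment 2 1 = cosMoment 2 0 := by
    have := cosMoment_two_ratio (a := 1) (by norm_num)
    norm_num at this
    exact this
  have hmp := cosMoment_two_ratio (a := p) (by linarith)
  calc _ ≤ ∫ x : EuclideanSpace ℝ (Fin 2), (2 ^ p * cosAt x ^ (2 + 1 : ℕ) -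
        (2 ^ p - 1) * (cosAt x ^ (2 + 1 : ℕ) * cosAt x)) := by
        refine integral_mono (integrable_cosAt_mul_two_sub_rpow (by linarith))
          ((integrable_cosAt_pow.const_mul _).sub (integrable_cosAt_mul_self.const_mul _))
          fun x => ?_
        have h1 := cosAt_pos x
        have h2 := cosAt_le_one x
        have h := (convexOn_rpow hp).2 (show (2 : ℝ) ∈ Ici 0 by simp)
          (show (1 : ℝ) ∈ Ici 0 by simp) (show 0 ≤ 1 - cosAt x by linarith) h1.le
          (by ring)
        simp only [smul_eq_mul, mul_one, Real.one_rpow,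
          show (1 - cosAt x) * 2 + cosAt x = 2 - cosAt x by ring] at h
        have := mul_le_mul_of_nonneg_left h (show 0 ≤ cosAt x ^ (2 + 1 : ℕ) by positivity)
        simp only
        linarith
    _ = (2 ^ p + 1) / 2 * cosMoment 2 0 := by
        rw [integral_sub (integrable_cosAt_pow.const_mul _)
          (integrable_cosAt_mul_self.const_mul _), integral_const_mul, integral_const_mul,
          integral_cosAt_mul_self, integral_cosAt_pow, ← hm1]
        ring
    _ ≤ 3 ^ p * cosMoment 2 p := by
        have hp0 : 0 < cosMoment 2 p := cosMoment_pos (by linarith)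
        rw [← hmp, ← mul_assoc]
        refine mul_le_mul_of_nonneg_right ?_ hp0.le
        have b1 := one_add_mul_self_le_rpow_one_add (s := (1 : ℝ)) (by norm_num) hp
        have b2 := one_add_mul_self_le_rpow_one_add (s := (1 / 2 : ℝ)) (by norm_num) hp
        have e : (3 : ℝ) ^ p = 2 ^ p * (1 + 1 / 2) ^ p := by
          rw [← Real.mul_rpow (by norm_num) (by norm_num)]
          norm_num
        rw [e]
        norm_num at b1 b2 ⊢
        have : (0 : ℝ) < 2 ^ p := by positivity
        nlinarith

end twoSub

/-- Two functions on `[0, 1]`, the second decreasing, whose difference is concave and nonnegative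
at `0`: the difference of their `p`-th powers is bounded below by a multiple of their difference. -/
theorem exists_mul_sub_le_rpow_sub {f g : ℝ → ℝ} {p : ℝ} (hp : 1 ≤ p)
    (hf : ∀ x ∈ Icc (0 : ℝ) 1, 0 < f x) (hg : ∀ x ∈ Icc (0 : ℝ) 1, 0 ≤ g x)
    (hanti : AntitoneOn f (Icc 0 1)) (hconc : ConcaveOn ℝ (Icc 0 1) fun x => g x - f x)
    (h0 : 0 ≤ g 0 - f 0) :
    ∃ K : ℝ, 0 ≤ K ∧ ∀ x ∈ Icc (0 : ℝ) 1, K * (g x - f x) ≤ g x ^ p - f x ^ p := by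
  -- By concavity this set is an interval starting at `0`, so `g - f` changes sign at most once, at
  -- the supremum `z`.
  set A : Set ℝ := {x ∈ Icc (0 : ℝ) 1 | 0 ≤ g x - f x} with hA
  have hA0 : (0 : ℝ) ∈ A := ⟨by simp, h0⟩
  have hbdd : BddAbove A := ⟨1, fun x hx => hx.1.2⟩
  set z := sSup A with hz
  have hz0 : 0 ≤ z := le_csSup hbdd hA0
  have hz1 : z ≤ 1 := csSup_le ⟨0, hA0⟩ fun x hx => hx.1.2
  have hzm : z ∈ Icc (0 : ℝ) 1 := ⟨hz0, hz1⟩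
  have hκ := hf z hzm
  have tangent : ∀ x ∈ Icc (0 : ℝ) 1,
      p * f x ^ (p - 1) * (g x - f x) ≤ g x ^ p - f x ^ p := fun x hx => by
    have := tangent_le_rpow hp (hf x hx) (hg x hx)
    linarith
  -- The tangent slope `p * f x ^ (p - 1)` decreases in `x`: it is at least its value at `z` where
  -- `g - f ≥ 0` and at most that value where `g - f ≤ 0`.
  refine ⟨p * f z ^ (p - 1), by positivity, fun x hx => ?_⟩
  refine le_trans ?_ (tangent x hx)
  rcases lt_trichotomy x z with h | h | h
  · obtain ⟨y, hy, hxy⟩ := exists_lt_of_lt_csSup ⟨0, hA0⟩ h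
    have hpos : 0 ≤ g x - f x := by
      have := hconc.1.ordConnected
      have hconv := hconc.convex_ge 0
      exact (hconv.ordConnected.out ⟨by simp, h0⟩ ⟨hy.1, hy.2⟩ ⟨hx.1, hxy.le⟩).2
    have hle : f z ≤ f x := hanti hx hzm h.le
    gcongr
  · rw [h]
  · have hneg : g x - f x ≤ 0 := by
      by_contra hc
      exact absurd (le_csSup hbdd (show x ∈ A from ⟨hx, by linarith⟩)) (not_le.2 h)
    have hle : f x ≤ f z := hanti hzm hx h.le
    refine mul_le_mul_of_nonpos_right ?_ hneg
    have := hf x hx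
    gcongr

/-- The inversion `r ↦ 1 / r` exchanges the cosine and the sine of the angle. -/
theorem integral_cosAt_sq_comp_one_sub (h : ℝ → ℝ) :
    ∫ x : EuclideanSpace ℝ (Fin 1), cosAt x ^ 2 * h (1 - cosAt x ^ 2) =
      ∫ x : EuclideanSpace ℝ (Fin 1), cosAt x ^ 2 * h (cosAt x ^ 2) := by
  simp only [cosAt_sq]
  have e1 := integral_fun_norm_addHaar (volume : Measure (EuclideanSpace ℝ (Fin 1)))
    (fun r => (1 + r ^ 2)⁻¹ * h (1 - (1 + r ^ 2)⁻¹))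
  have e2 := integral_fun_norm_addHaar (volume : Measure (EuclideanSpace ℝ (Fin 1)))
    (fun r => (1 + r ^ 2)⁻¹ * h ((1 + r ^ 2)⁻¹))
  rw [e1, e2]
  congr 2
  simp only [finrank_euclideanSpace, Fintype.card_fin, tsub_self, pow_zero, one_smul]
  -- The measure `dr / (1 + r ^ 2)` is invariant under `r ↦ 1 / r`. This is special to `n = 1`,
  -- where the radial density is constant.
  rw [← integral_comp_rpow_Ioi (fun r : ℝ => (1 + r ^ 2)⁻¹ * h ((1 + r ^ 2)⁻¹))
    (p := -1) (by norm_num)]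
  refine setIntegral_congr_fun measurableSet_Ioi fun r hr => ?_
  have hr : (0 : ℝ) < r := hr
  have a1 : r ^ (-1 - 1 : ℝ) = (r ^ 2)⁻¹ := by
    rw [show (-1 - 1 : ℝ) = -(2 : ℕ) by norm_num, Real.rpow_neg hr.le, Real.rpow_natCast]
  have a2 : 1 - (1 + r ^ 2)⁻¹ = (1 + (r⁻¹) ^ 2)⁻¹ := by
    field_simp
    ring
  simp only [a1, Real.rpow_neg_one, smul_eq_mul, abs_neg, abs_one, one_mul, a2]
  rw [← mul_assoc]
  congr 1
  field_simp
  ring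

/-- The bound, as a function of the squared cosine of the angle, for the length of circular arcs
orthogonal to the boundary of the half-space. -/
noncomputable def arcBound (s x : ℝ) : ℝ :=
  2 - x ^ (s / 2) - s ^ 2 / (s + 2) * (1 - x)

/-! ### The length bound as a function of the squared cosine -/

section arcBound
variable {s : ℝ}

theorem arcBound_coeff_le (hs0 : 0 < s) (hs1 : s ≤ 1) : s ^ 2 / (s + 2) ≤ s / 2 := by
  rw [div_le_div_iff₀ (by linarith) (by norm_num)]
  nlinarith

/-- On `(0, 1]` the term `-x ^ (s / 2)` has slope at most `-s / 2`, which outweighs the slope `s ^ 2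
/ (s + 2)` of the affine term. -/
theorem arcBound_antitoneOn (hs0 : 0 < s) (hs1 : s ≤ 1) : AntitoneOn (arcBound s) (Icc 0 1) := by
  intro x hx y hy hxy
  -- The tangent is taken at the larger point `y`, which must be positive; `y = 0` forces `x = y`.
  rcases eq_or_lt_of_le hy.1 with h | h
  · have : x = y := le_antisymm hxy (h ▸ hx.1)
    rw [this]
  have h1 := rpow_le_tangent (q := s / 2) (by linarith) (by linarith) h hx.1
  have h2 : 1 ≤ y ^ (s / 2 - 1) := Real.one_le_rpow_of_pos_of_le_one_of_nonpos h hy.2 (by linarith)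
  have h3 := arcBound_coeff_le hs0 hs1
  have h4 : s / 2 * (y - x) ≤ s / 2 * y ^ (s / 2 - 1) * (y - x) := by
    have : s / 2 ≤ s / 2 * y ^ (s / 2 - 1) := le_mul_of_one_le_right (by linarith) h2
    exact mul_le_mul_of_nonneg_right this (by linarith)
  have h5 : s ^ 2 / (s + 2) * (y - x) ≤ s / 2 * (y - x) :=
    mul_le_mul_of_nonneg_right h3 (by linarith)
  simp only [arcBound]
  linarith

theorem one_le_arcBound (hs0 : 0 < s) (hs1 : s ≤ 1) {x : ℝ} (hx : x ∈ Icc (0 : ℝ) 1) :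
    1 ≤ arcBound s x := by
  have := arcBound_antitoneOn hs0 hs1 hx (right_mem_Icc.2 zero_le_one) hx.2
  simpa [arcBound, show (2 : ℝ) - 1 = 1 by norm_num] using this

theorem arcBound_le (hs0 : 0 < s) {x : ℝ} (hx : x ∈ Icc (0 : ℝ) 1) :
    arcBound s x ≤ 2 - x ^ (s / 2) := by
  have : 0 ≤ s ^ 2 / (s + 2) * (1 - x) := mul_nonneg (by positivity) (by linarith [hx.2])
  simp only [arcBound]
  linarith

theorem arcBound_le_two (hs0 : 0 < s) {x : ℝ} (hx : x ∈ Icc (0 : ℝ) 1) : arcBound s x ≤ 2 := by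
  have := Real.rpow_nonneg hx.1 (s / 2)
  linarith [arcBound_le hs0 hx]

theorem measurable_arcBound : Measurable (arcBound s) := by
  unfold arcBound
  have : Measurable fun x : ℝ => x ^ (s / 2) := measurable_id.pow_const _
  fun_prop

theorem concaveOn_two_mul_sub_arcBound (hs0 : 0 < s) (hs1 : s ≤ 1) :
    ConcaveOn ℝ (Icc 0 1) fun x => 2 * (1 - x) ^ (s / 2) - arcBound s x := by
  have hc := Real.concaveOn_rpow (p := s / 2) (by linarith) (by linarith)
  have c1 : ConcaveOn ℝ (Icc (0 : ℝ) 1) fun x => x ^ (s / 2) :=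
    hc.subset (fun x hx => hx.1) (convex_Icc 0 1)
  have c2 : ConcaveOn ℝ (Icc (0 : ℝ) 1) fun x => (1 - x) ^ (s / 2) := by
    refine ⟨convex_Icc 0 1, fun x hx y hy a b ha hb hab => ?_⟩
    have := hc.2 (show 1 - x ∈ Ici (0 : ℝ) by simpa using hx.2)
      (show 1 - y ∈ Ici (0 : ℝ) by simpa using hy.2) ha hb hab
    have e : 1 - (a • x + b • y) = a • (1 - x) + b • (1 - y) := by
      simp only [smul_eq_mul]
      linear_combination -hab
    simpa only [e] using this
  refine ⟨convex_Icc 0 1, fun x hx y hy a b ha hb hab => ?_⟩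
  have h1 := c1.2 hx hy ha hb hab
  have h2 := c2.2 hx hy ha hb hab
  simp only [smul_eq_mul, arcBound] at *
  have hb' : b = 1 - a := by linarith
  subst hb'
  nlinarith

end arcBound

/-! ### The moment inequality for the length bound -/

section cosAt
variable {n : ℕ}

theorem cosAt_sq_mem (x : EuclideanSpace ℝ (Fin n)) : cosAt x ^ 2 ∈ Icc (0 : ℝ) 1 :=
  ⟨sq_nonneg _, pow_le_one₀ (cosAt_pos x).le (cosAt_le_one x)⟩

theorem cosAt_sq_rpow (x : EuclideanSpace ℝ (Fin n)) (s : ℝ) :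
    (cosAt x ^ 2) ^ (s / 2) = cosAt x ^ s := by
  rw [← Real.rpow_natCast, ← Real.rpow_mul (cosAt_pos x).le]
  congr 1
  push_cast
  ring

theorem integrable_arcBound_comp {s p : ℝ} (hs0 : 0 < s) (hs1 : s ≤ 1) (hp : 0 ≤ p)
    {f : EuclideanSpace ℝ (Fin n) → ℝ} (hf : Measurable f) (hf' : ∀ x, f x ∈ Icc (0 : ℝ) 1) :
    Integrable fun x => cosAt x ^ (n + 1 : ℕ) * arcBound s (f x) ^ p := by
  refine integrable_cosAt_mul ((measurable_arcBound.comp hf).pow_const p) (M := 2 ^ p)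
    fun x => ?_
  have h1 := one_le_arcBound hs0 hs1 (hf' x)
  have h2 := arcBound_le_two hs0 (hf' x)
  rw [abs_of_nonneg (Real.rpow_nonneg (by linarith) _)]
  exact Real.rpow_le_rpow (by linarith) h2 hp

/-- With `a = (1 - s) (1 - c)`, Bernoulli gives `c ^ (1 - s) ≤ 1 - a`, hence `c ^ s ≥ (1 + a) c = (2
- s) c - (1 - s) c ^ 2`. The moments of orders `1` and `2` on the half-circle are `2` and `π / 2`.
-/
theorem cosMoment_one_ge {s : ℝ} (hs0 : 0 < s) (hs1 : s ≤ 1) :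
    2 * (2 - s) - (1 - s) * (Real.pi / 2) ≤ cosMoment 1 s := by
  have m2 : cosMoment 1 2 = Real.pi / 2 := by
    have := cosMoment_two (n := 1)
    rw [cosMoment_one_zero] at this
    push_cast at this
    linarith
  have h : ∫ x : EuclideanSpace ℝ (Fin 1), ((2 - s) * (cosAt x ^ (1 + 1 : ℕ) * cosAt x) -
      (1 - s) * (cosAt x ^ (1 + 1 : ℕ) * cosAt x ^ 2)) ≤
      ∫ x : EuclideanSpace ℝ (Fin 1), cosAt x ^ (1 + 1 : ℕ) * cosAt x ^ s := by
    refine integral_mono ((integrable_cosAt_mul_self.const_mul _).sub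
      (integrable_cosAt_mul_sq.const_mul _)) (integrable_cosAt_mul_rpow (by linarith)) fun x => ?_
    have h1 := cosAt_pos x
    have h2 := cosAt_le_one x
    have h3 : (2 - s) * cosAt x - (1 - s) * cosAt x ^ 2 ≤ cosAt x ^ s := by
      have hb := rpow_one_add_le_one_add_mul_self (s := cosAt x - 1) (by linarith)
        (p := 1 - s) (by linarith) (by linarith)
      rw [show 1 + (cosAt x - 1) = cosAt x by ring, Real.rpow_sub h1, Real.rpow_one,
        div_le_iff₀ (Real.rpow_pos_of_pos h1 _)] at hb
      have hw := Real.rpow_pos_of_pos h1 s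
      have h4 : 0 ≤ 1 - (1 - s) * (1 - cosAt x) := by nlinarith
      have h5 : (1 + (1 - s) * (1 - cosAt x)) * cosAt x ≤
          (1 + (1 - s) * (1 - cosAt x)) * ((1 - (1 - s) * (1 - cosAt x)) * cosAt x ^ s) := by
        refine mul_le_mul_of_nonneg_left ?_ (by nlinarith)
        linarith
      nlinarith [mul_nonneg (sq_nonneg ((1 - s) * (1 - cosAt x))) hw.le]
    have := mul_le_mul_of_nonneg_left h3 (show 0 ≤ cosAt x ^ (1 + 1 : ℕ) by positivity)
    simp only
    linarith
  rw [integral_sub (integrable_cosAt_mul_self.const_mul _)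
      (integrable_cosAt_mul_sq.const_mul _), integral_const_mul, integral_const_mul,
      integral_cosAt_mul_self, integral_cosAt_mul_sq, integral_cosAt_mul_rpow (by linarith), m2,
      cosMoment_one_one] at h
  linarith

/-- The case `N = 2`, `p = 1`. The correction `s ^ 2 / (s + 2) * (1 - x)` in `arcBound` is
indispensable here: without it the left side at `s = 1` would be `2π - 2 > 4`. -/
theorem integral_arcBound_dim_one_linear {s : ℝ} (hs0 : 0 < s) (hs1 : s ≤ 1) :
    ∫ x : EuclideanSpace ℝ (Fin 1), cosAt x ^ (1 + 1 : ℕ) * arcBound s (cosAt x ^ 2) ≤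
      2 * cosMoment 1 s := by
  have m2 : cosMoment 1 2 = Real.pi / 2 := by
    have := cosMoment_two (n := 1)
    rw [cosMoment_one_zero] at this
    push_cast at this
    linarith
  set θ := s ^ 2 / (s + 2) with hθ
  have e : ∀ x : EuclideanSpace ℝ (Fin 1), cosAt x ^ (1 + 1 : ℕ) * arcBound s (cosAt x ^ 2) =
      (2 - θ) * cosAt x ^ (1 + 1 : ℕ) - cosAt x ^ (1 + 1 : ℕ) * cosAt x ^ s +
        θ * (cosAt x ^ (1 + 1 : ℕ) * cosAt x ^ 2) := fun x => by
    rw [arcBound, cosAt_sq_rpow]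
    ring
  have i1 : Integrable fun x : EuclideanSpace ℝ (Fin 1) => (2 - θ) * cosAt x ^ (1 + 1 : ℕ) :=
    integrable_cosAt_pow.const_mul _
  have i2 : Integrable fun x : EuclideanSpace ℝ (Fin 1) => cosAt x ^ (1 + 1 : ℕ) * cosAt x ^ s :=
    integrable_cosAt_mul_rpow (by linarith)
  have i3 : Integrable fun x : EuclideanSpace ℝ (Fin 1) =>
      (2 - θ) * cosAt x ^ (1 + 1 : ℕ) - cosAt x ^ (1 + 1 : ℕ) * cosAt x ^ s := i1.sub i2
  simp only [e]
  rw [integral_add i3 (integrable_cosAt_mul_sq.const_mul _), integral_sub i1 i2,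
    integral_const_mul, integral_const_mul, integral_cosAt_pow, integral_cosAt_mul_sq,
    integral_cosAt_mul_rpow (by linarith), m2, cosMoment_one_zero]
  have h := cosMoment_one_ge hs0 hs1
  have h1 : s ^ 2 / 3 ≤ θ := by
    rw [hθ]
    gcongr
    linarith
  have hpi := Real.pi_lt_d2
  have hpi0 := Real.pi_pos
  -- What the claim becomes once `cosMoment 1 s` is replaced by its lower bound. With `π < 3.15` and
  -- `θ ≥ s ^ 2 / 3` it reduces to a quadratic in `s` that is positive with its minimum near `1.2`.
  have h2 : Real.pi * (7 / 2 - 3 / 2 * s - θ / 2) ≤ 12 - 6 * s := by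
    have h3 : 7 / 2 - 3 / 2 * s - θ / 2 ≤ 7 / 2 - 3 / 2 * s - s ^ 2 / 6 := by linarith
    have h4 : 0 ≤ 7 / 2 - 3 / 2 * s - s ^ 2 / 6 := by nlinarith
    have h5 := mul_le_mul_of_nonneg_left h3 hpi0.le
    have h6 := mul_le_mul_of_nonneg_right hpi.le h4
    nlinarith [sq_nonneg (s - 1.2)]
  nlinarith

/-- In the variable `cosAt ^ 2`, `arcBound` decreases while `2 cosAt ^ s` increases, so the crossing
argument would point the wrong way. Evaluating `arcBound` at `1 - cosAt ^ 2` instead leaves its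
integrals unchanged and makes both functions decrease in the same variable; the pointwise inequality
with constant `K` then reduces the claim to `p = 1`. -/
theorem integral_arcBound_dim_one {s p : ℝ} (hs0 : 0 < s) (hs1 : s ≤ 1) (hp : 1 ≤ p) :
    ∫ x : EuclideanSpace ℝ (Fin 1), cosAt x ^ (1 + 1 : ℕ) * arcBound s (cosAt x ^ 2) ^ p ≤
      2 ^ p * cosMoment 1 (s * p) := by
  obtain ⟨K, hK0, hK⟩ := exists_mul_sub_le_rpow_sub (f := arcBound s)
    (g := fun x => 2 * (1 - x) ^ (s / 2)) hp
    (fun x hx => by linarith [one_le_arcBound hs0 hs1 hx])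
    (fun x hx => mul_nonneg (by norm_num) (Real.rpow_nonneg (by linarith [hx.2]) _))
    (arcBound_antitoneOn hs0 hs1) (concaveOn_two_mul_sub_arcBound hs0 hs1) (by
      have : (0 : ℝ) ^ (s / 2) = 0 := Real.zero_rpow (by linarith)
      simp only [arcBound, this, sub_zero, Real.one_rpow]
      have : 0 ≤ s ^ 2 / (s + 2) := by positivity
      linarith)
  have hm : ∀ x : EuclideanSpace ℝ (Fin 1), 1 - cosAt x ^ 2 ∈ Icc (0 : ℝ) 1 := fun x => by
    have := cosAt_sq_mem x
    exact ⟨by linarith [this.2], by linarith [this.1]⟩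
  have mc : Measurable fun x : EuclideanSpace ℝ (Fin 1) => 1 - cosAt x ^ 2 :=
    measurable_const.sub (measurable_cosAt.pow_const 2)
  have i1 := integrable_arcBound_comp (p := 1) hs0 hs1 (by norm_num) mc hm
  simp only [Real.rpow_one] at i1
  have ip := integrable_arcBound_comp (p := p) hs0 hs1 (by linarith) mc hm
  have j1 : Integrable fun x : EuclideanSpace ℝ (Fin 1) => cosAt x ^ (1 + 1 : ℕ) * cosAt x ^ s :=
    integrable_cosAt_mul_rpow (by linarith)
  have jp : Integrable fun x : EuclideanSpace ℝ (Fin 1) =>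
      cosAt x ^ (1 + 1 : ℕ) * cosAt x ^ (s * p) :=
    integrable_cosAt_mul_rpow (by nlinarith)
  have hint : ∫ x : EuclideanSpace ℝ (Fin 1), K * (2 * (cosAt x ^ (1 + 1 : ℕ) * cosAt x ^ s) -
      cosAt x ^ (1 + 1 : ℕ) * arcBound s (1 - cosAt x ^ 2)) ≤
      ∫ x : EuclideanSpace ℝ (Fin 1), (2 ^ p * (cosAt x ^ (1 + 1 : ℕ) * cosAt x ^ (s * p)) -
      cosAt x ^ (1 + 1 : ℕ) * arcBound s (1 - cosAt x ^ 2) ^ p) := by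
    refine integral_mono (((j1.const_mul _).sub i1).const_mul _) ((jp.const_mul _).sub ip)
      fun x => ?_
    have h := hK _ (hm x)
    simp only [sub_sub_cancel, cosAt_sq_rpow] at h
    rw [Real.mul_rpow (by norm_num) (Real.rpow_nonneg (cosAt_pos x).le _),
      ← Real.rpow_mul (cosAt_pos x).le] at h
    have := mul_le_mul_of_nonneg_left h (show 0 ≤ cosAt x ^ (1 + 1 : ℕ) by
      have := cosAt_pos x
      positivity)
    simp only
    linarith
  rw [integral_const_mul, integral_sub (j1.const_mul _) i1, integral_sub (jp.const_mul _) ip,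
    integral_const_mul, integral_const_mul, integral_cosAt_mul_rpow (by linarith),
    integral_cosAt_mul_rpow (by nlinarith), integral_cosAt_sq_comp_one_sub (arcBound s),
    integral_cosAt_sq_comp_one_sub fun y => arcBound s y ^ p] at hint
  have hl := integral_arcBound_dim_one_linear hs0 hs1
  have : 0 ≤ K * (2 * cosMoment 1 s - ∫ x : EuclideanSpace ℝ (Fin 1),
      cosAt x ^ 2 * arcBound s (cosAt x ^ 2)) := mul_nonneg hK0 (by simpa using hl)
  simp only [Nat.reduceAdd]
  linarith

/-- Since `0 < cosAt ≤ 1` and `s ≤ 1`, replacing `s` by `1` enlarges `2 - cosAt ^ s` on the left and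
lowers the moment on the right. -/
theorem integral_arcBound_of_two_le (hn : 2 ≤ n) {s p : ℝ} (hs0 : 0 < s) (hs1 : s ≤ 1)
    (hp : 1 ≤ p) :
    ∫ x : EuclideanSpace ℝ (Fin n), cosAt x ^ (n + 1 : ℕ) * arcBound s (cosAt x ^ 2) ^ p ≤
      (n + 1 : ℝ) ^ p * cosMoment n (s * p) := by
  have hc : Measurable fun x : EuclideanSpace ℝ (Fin n) => cosAt x ^ 2 :=
    measurable_cosAt.pow_const 2
  have hle : ∀ x : EuclideanSpace ℝ (Fin n), cosAt x ≤ cosAt x ^ s := fun x => by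
    simpa using Real.rpow_le_rpow_of_exponent_ge (cosAt_pos x) (cosAt_le_one x) hs1
  calc _ ≤ ∫ x : EuclideanSpace ℝ (Fin n), cosAt x ^ (n + 1 : ℕ) * (2 - cosAt x) ^ p := by
        refine integral_mono (integrable_arcBound_comp hs0 hs1 (by linarith) hc cosAt_sq_mem)
          (integrable_cosAt_mul_two_sub_rpow (by linarith)) fun x => ?_
        have h1 := one_le_arcBound hs0 hs1 (cosAt_sq_mem x)
        have h2 := arcBound_le hs0 (cosAt_sq_mem x)
        rw [cosAt_sq_rpow] at h2
        have h3 := hle x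
        exact mul_le_mul_of_nonneg_left (Real.rpow_le_rpow (by linarith) (by linarith)
          (by linarith)) (pow_nonneg (cosAt_pos x).le _)
    _ ≤ (n + 1 : ℝ) ^ p * cosMoment n p := by
        rcases eq_or_lt_of_le hn with h | h
        · subst h
          have := integral_two_sub_cosAt_rpow_le_dim_two hp
          norm_num at this ⊢
          exact this
        · rcases le_total 2 p with h2 | h2
          · exact integral_two_sub_cosAt_rpow_le_of_two_le h h2
          · exact integral_two_sub_cosAt_rpow_le_of_le_two h hp h2
    _ ≤ _ := by
        refine mul_le_mul_of_nonneg_left ?_ (by positivity)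
        rw [← integral_cosAt_mul_rpow (by linarith), ← integral_cosAt_mul_rpow (by nlinarith)]
        refine integral_mono (integrable_cosAt_mul_rpow (by linarith))
          (integrable_cosAt_mul_rpow (by nlinarith)) fun x => ?_
        refine mul_le_mul_of_nonneg_left ?_ (pow_nonneg (cosAt_pos x).le _)
        exact Real.rpow_le_rpow_of_exponent_ge (cosAt_pos x) (cosAt_le_one x) (by nlinarith)

/-- The mean over the boundary of the powers of the length bound. -/
theorem lintegral_arcBound_le (hn : 1 ≤ n) {s p : ℝ} (hs0 : 0 < s) (hs1 : s ≤ 1) (hp : 1 ≤ p) :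
    ∫⁻ x : EuclideanSpace ℝ (Fin n),
        ENNReal.ofReal (cosAt x ^ (n + 1 : ℕ) * arcBound s (cosAt x ^ 2) ^ p) ≤
      ENNReal.ofReal ((n + 1 : ℝ) ^ p * cosMoment n (s * p)) := by
  have hc : Measurable fun x : EuclideanSpace ℝ (Fin n) => cosAt x ^ 2 :=
    measurable_cosAt.pow_const 2
  rw [← ofReal_integral_eq_lintegral_ofReal
    (integrable_arcBound_comp hs0 hs1 (by linarith) hc cosAt_sq_mem)]
  · refine ENNReal.ofReal_le_ofReal ?_
    rcases eq_or_lt_of_le hn with h | h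
    · subst h
      have := integral_arcBound_dim_one hs0 hs1 hp
      norm_num at this ⊢
      exact this
    · exact integral_arcBound_of_two_le h hs0 hs1 hp
  · refine Eventually.of_forall fun x => ?_
    have h1 := one_le_arcBound hs0 hs1 (cosAt_sq_mem x)
    have h2 := cosAt_pos x
    simp only [Pi.zero_apply]
    positivity

end cosAt

/-! ### Weighted length of circular arcs -/

section arcLength

theorem hasDerivAt_rpow_mul_one_add_sq_rpow {a b r : ℝ} (hr : 0 < r) :
    HasDerivAt (fun r : ℝ => r ^ a * (1 + r ^ 2) ^ b)
      (a * r ^ (a - 1) * (1 + r ^ 2) ^ b + r ^ a * (b * (1 + r ^ 2) ^ (b - 1) * (2 * r))) r := by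
  have h1 := Real.hasDerivAt_rpow_const (x := r) (p := a) (Or.inl hr.ne')
  have h2 : HasDerivAt (fun r : ℝ => 1 + r ^ 2) (2 * r) r := by
    simpa using (hasDerivAt_pow 2 r).const_add 1
  have h3 := h2.rpow_const (p := b) (Or.inl (by positivity))
  refine (h1.mul h3).congr_deriv ?_
  ring

/-- A primitive bounding from above the length of a circular arc for the metric with density
`z_N ^ (s - 1)`. -/
noncomputable def arcPrimitive (s r : ℝ) : ℝ :=
  (2 * (r ^ s * (1 + r ^ 2) ^ (-(s / 2))) - r ^ s * (1 + r ^ 2) ^ (-s) -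
    s ^ 2 / (s + 2) * (r ^ (s + 2) * (1 + r ^ 2) ^ (-(s / 2) - 1))) / s

theorem continuousOn_arcPrimitive {s : ℝ} (hs : 0 < s) : Continuous (arcPrimitive s) := by
  have h : ∀ a b : ℝ, 0 < a → Continuous fun r : ℝ => r ^ a * (1 + r ^ 2) ^ b := by
    intro a b ha
    refine (Real.continuous_rpow_const ha.le).mul (Continuous.rpow_const (by fun_prop) ?_)
    intro x
    left
    positivity
  unfold arcPrimitive
  exact ((((h s _ hs).const_mul _).sub (h s _ hs)).sub
    ((h (s + 2) _ (by linarith)).const_mul _)).div_const _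

/-- Let `A = 1 + r ^ 2`. Then `r ^ (s - 1) A ^ (-s)` equals `2 r ^ (s - 1) A ^ (-s - 1)` minus the
derivative of `r ^ s A ^ (-s) / s`. In the first term, Bernoulli bounds a factor `A ^ (-s / 2)` by
`1 - (s / 2) r ^ 2 / A`. The result has an elementary primitive, because the derivatives of `r ^ s A
^ (-s / 2)` and `r ^ (s + 2) A ^ (-s / 2 - 1)` are single monomials in `r` and `A`. -/
theorem exists_hasDerivAt_arcPrimitive {s r : ℝ} (hs0 : 0 < s) (hs1 : s ≤ 1) (hr : 0 < r) :
    ∃ d, HasDerivAt (arcPrimitive s) d r ∧ r ^ (s - 1) * (1 + r ^ 2) ^ (-s) ≤ d := by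
  have hA : (0 : ℝ) < 1 + r ^ 2 := by positivity
  have h1 := hasDerivAt_rpow_mul_one_add_sq_rpow (a := s) (b := -(s / 2)) hr
  have h2 := hasDerivAt_rpow_mul_one_add_sq_rpow (a := s) (b := -s) hr
  have h3 := hasDerivAt_rpow_mul_one_add_sq_rpow (a := s + 2) (b := -(s / 2) - 1) hr
  refine ⟨_, (((h1.const_mul 2).sub h2).sub (h3.const_mul (s ^ 2 / (s + 2)))).div_const s, ?_⟩
  set A := 1 + r ^ 2 with hAdef
  set B := A ^ (s / 2) with hB
  have hB0 : 0 < B := Real.rpow_pos_of_pos hA _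
  have bern : A ≤ B * (A - s / 2 * r ^ 2) := by
    have hb := rpow_one_add_le_one_add_mul_self (s := A⁻¹ - 1) (by
      have := inv_pos.2 hA
      linarith) (p := s / 2) (by linarith) (by linarith)
    rw [show 1 + (A⁻¹ - 1) = A⁻¹ by ring, Real.inv_rpow hA.le, ← hB] at hb
    rw [inv_le_iff_one_le_mul₀ hB0] at hb
    have e : (1 + s / 2 * (A⁻¹ - 1)) * B * A = B * (A - s / 2 * r ^ 2) := by
      have : A⁻¹ * A = 1 := inv_mul_cancel₀ hA.ne'
      have e2 : r ^ 2 = A - 1 := by rw [hAdef]; ring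
      rw [e2]
      linear_combination s / 2 * B * this
    nlinarith
  have e1 : r ^ (s - 1) = r ^ s / r := Real.rpow_sub_one hr.ne' s
  have e2 : r ^ (s + 2 - 1) = r ^ s * r := by
    rw [show s + 2 - 1 = s + 1 by ring, Real.rpow_add_one hr.ne']
  have e3 : r ^ (s + 2) = r ^ s * r ^ 2 := by rw [Real.rpow_add hr, Real.rpow_two]
  have f1 : A ^ (-(s / 2)) = B⁻¹ := Real.rpow_neg hA.le _
  have f2 : A ^ (-(s / 2) - 1) = B⁻¹ / A := by rw [Real.rpow_sub_one hA.ne', f1]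
  have f3 : A ^ (-(s / 2) - 1 - 1) = B⁻¹ / A / A := by rw [Real.rpow_sub_one hA.ne', f2]
  have f4 : A ^ (-s) = B⁻¹ * B⁻¹ := by
    rw [show -s = -(s / 2) + -(s / 2) by ring, Real.rpow_add hA, f1]
  have f5 : A ^ (-s - 1) = B⁻¹ * B⁻¹ / A := by rw [Real.rpow_sub_one hA.ne', f4]
  rw [e1, e2, e3, f3, f2, f1, f4, f5]
  have hrs : 0 < r ^ s := Real.rpow_pos_of_pos hr _
  set w := r ^ s with hw
  have hs2 : s + 2 ≠ 0 := by positivity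
  rw [← sub_nonneg]
  have key : 0 ≤ 2 * w * (B * (A - s / 2 * r ^ 2) - A) / (r * B ^ 2 * A ^ 2) :=
    div_nonneg (mul_nonneg (by positivity) (by linarith)) (by positivity)
  convert key using 1
  have e4 : A = 1 + r ^ 2 := hAdef
  field_simp
  rw [e4]
  ring

theorem lintegral_arc_le {s R : ℝ} (hs0 : 0 < s) (hs1 : s ≤ 1) (hR : 0 < R) :
    ∫⁻ r in Ioc 0 R, ENNReal.ofReal (r ^ (s - 1) * (1 + r ^ 2) ^ (-s)) ≤
      ENNReal.ofReal (arcPrimitive s R) := by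
  choose! d hd hle using fun r hr => exists_hasDerivAt_arcPrimitive (r := r) hs0 hs1 hr
  have hnn : ∀ r ∈ Ioo 0 R, 0 ≤ d r := fun r hr => by
    refine le_trans ?_ (hle r hr.1)
    have := hr.1
    positivity
  -- The sign of the derivative and the continuity of the primitive give integrability up to the
  -- singular endpoint `0`.
  have hint := intervalIntegral.integrableOn_deriv_of_nonneg
    (continuousOn_arcPrimitive hs0).continuousOn (fun r hr => hd r hr.1) hnn
  have heq : ∫ r in Ioc 0 R, d r = arcPrimitive s R := by
    have := intervalIntegral.integral_eq_sub_of_hasDerivAt_of_le hR.le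
      (continuousOn_arcPrimitive hs0).continuousOn (fun r hr => hd r hr.1)
      ((intervalIntegrable_iff_integrableOn_Ioc_of_le hR.le).2 hint)
    rw [intervalIntegral.integral_of_le hR.le] at this
    rw [this]
    have h0 : arcPrimitive s 0 = 0 := by
      simp [arcPrimitive, Real.zero_rpow hs0.ne', Real.zero_rpow (show s + 2 ≠ 0 by positivity)]
    rw [h0, sub_zero]
  rw [← heq, ofReal_integral_eq_lintegral_ofReal hint]
  · refine setLIntegral_mono_ae' measurableSet_Ioc (Eventually.of_forall fun r hr => ?_)
    exact ENNReal.ofReal_le_ofReal (hle r hr.1)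
  · refine (ae_restrict_iff' measurableSet_Ioc).2 (Eventually.of_forall fun r hr => ?_)
    exact (by have := hr.1; positivity : (0 : ℝ) ≤ _).trans (hle r hr.1)

/-- `(1 + R ^ 2) / R` is the diameter of the circle centred on the boundary that passes through the
origin and through the point at height `1` and horizontal distance `R`; its power `s` is the scaling
factor of the weighted length. -/
theorem arcPrimitive_eq {s R : ℝ} (hs0 : 0 < s) (hR : 0 < R) :
    ((1 + R ^ 2) / R) ^ s * arcPrimitive s R =
      (1 + R ^ 2) ^ (s / 2) * arcBound s (1 + R ^ 2)⁻¹ / s := by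
  have hA : (0 : ℝ) < 1 + R ^ 2 := by positivity
  rw [arcPrimitive, arcBound, Real.div_rpow hA.le hR.le, Real.rpow_add hR, Real.rpow_two,
    Real.rpow_sub_one hA.ne', Real.rpow_neg hA.le, Real.rpow_neg hA.le, Real.inv_rpow hA.le]
  have e : (1 + R ^ 2) ^ s = (1 + R ^ 2) ^ (s / 2) * (1 + R ^ 2) ^ (s / 2) := by
    rw [← Real.rpow_add hA]
    ring_nf
  rw [e]
  have : 0 < (1 + R ^ 2) ^ (s / 2) := by positivity
  have : 0 < R ^ s := by positivity
  have hs2 : s + 2 ≠ 0 := by positivity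
  field_simp
  ring

end arcLength

/-! ### Coordinates on the half-space -/

section pointAt
variable {n : ℕ}

@[simp] theorem pointAt_last (x : EuclideanSpace ℝ (Fin n)) (t : ℝ) :
    pointAt x t (Fin.last n) = t := by
  simp [pointAt]

@[simp] theorem pointAt_castSucc (x : EuclideanSpace ℝ (Fin n)) (t : ℝ) (i : Fin n) :
    pointAt x t i.castSucc = x i := by
  simp [pointAt]

theorem pointAt_add (x y : EuclideanSpace ℝ (Fin n)) (t r : ℝ) :
    pointAt (x + y) (t + r) = pointAt x t + pointAt y r := by
  ext i
  refine Fin.lastCases ?_ (fun j => ?_) i <;> simp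

theorem pointAt_sub (x y : EuclideanSpace ℝ (Fin n)) (t r : ℝ) :
    pointAt (x - y) (t - r) = pointAt x t - pointAt y r := by
  ext i
  refine Fin.lastCases ?_ (fun j => ?_) i <;> simp

theorem pointAt_smul (c : ℝ) (x : EuclideanSpace ℝ (Fin n)) (t : ℝ) :
    pointAt (c • x) (c * t) = c • pointAt x t := by
  ext i
  refine Fin.lastCases ?_ (fun j => ?_) i <;> simp

theorem norm_pointAt_sq (x : EuclideanSpace ℝ (Fin n)) (t : ℝ) :
    ‖pointAt x t‖ ^ 2 = ‖x‖ ^ 2 + t ^ 2 := by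
  simp [EuclideanSpace.norm_sq_eq, Fin.sum_univ_castSucc]

/-- The identification of `ℝ^n × ℝ` with `ℝ^{n+1}`, as a linear map. -/
noncomputable def pointAtL (n : ℕ) :
    (EuclideanSpace ℝ (Fin n) × ℝ) →L[ℝ] EuclideanSpace ℝ (Fin (n + 1)) :=
  LinearMap.toContinuousLinearMap
    { toFun := fun q => pointAt q.1 q.2
      map_add' := fun p q => pointAt_add p.1 q.1 p.2 q.2
      map_smul' := fun c q => pointAt_smul c q.1 q.2 }

theorem continuous_pointAt :
    Continuous fun q : EuclideanSpace ℝ (Fin n) × ℝ => pointAt q.1 q.2 :=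
  (pointAtL n).continuous

theorem measurePreserving_pointAt :
    MeasurePreserving (fun q : EuclideanSpace ℝ (Fin n) × ℝ => pointAt q.1 q.2) := by
  have h1 : MeasurePreserving (Prod.map (WithLp.ofLp (p := 2) (V := Fin n → ℝ)) (id : ℝ → ℝ))
      (volume.prod volume) (volume.prod volume) :=
    (PiLp.volume_preserving_ofLp (Fin n)).prod (MeasurePreserving.id volume)
  have h2 : MeasurePreserving (Prod.swap : (Fin n → ℝ) × ℝ → ℝ × (Fin n → ℝ))
      (volume.prod volume) (volume.prod volume) := Measure.measurePreserving_swap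
  have h3 := (volume_preserving_piFinSuccAbove (fun _ : Fin (n + 1) => ℝ) (Fin.last n)).symm
  have h4 := PiLp.volume_preserving_toLp (Fin (n + 1))
  have h := h4.comp (h3.comp (h2.comp h1))
  have e : (fun q : EuclideanSpace ℝ (Fin n) × ℝ => pointAt q.1 q.2) =
      WithLp.toLp 2 ∘ (MeasurableEquiv.piFinSuccAbove (fun _ => ℝ) (Fin.last n)).symm ∘
        Prod.swap ∘ Prod.map WithLp.ofLp id := by
    funext q
    ext i
    refine Fin.lastCases ?_ (fun j => ?_) i <;>
      simp [pointAt, MeasurableEquiv.piFinSuccAbove, Fin.insertNthEquiv]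
  rw [e]
  exact h

theorem injective_pointAt :
    Function.Injective fun q : EuclideanSpace ℝ (Fin n) × ℝ => pointAt q.1 q.2 := by
  rintro ⟨x, t⟩ ⟨y, r⟩ h
  simp only at h
  refine Prod.ext (PiLp.ext fun i => ?_) ?_
  · simpa using congrArg (fun z : EuclideanSpace ℝ (Fin (n + 1)) => z i.castSucc) h
  · simpa using congrArg (fun z : EuclideanSpace ℝ (Fin (n + 1)) => z (Fin.last n)) h

theorem measurableEmbedding_pointAt :
    MeasurableEmbedding fun q : EuclideanSpace ℝ (Fin n) × ℝ => pointAt q.1 q.2 :=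
  continuous_pointAt.measurableEmbedding injective_pointAt

theorem measurableSet_upperHalf : MeasurableSet (upperHalf n) :=
  (isOpen_lt continuous_const (by fun_prop)).measurableSet

theorem isOpen_upperHalf : IsOpen (upperHalf n) :=
  isOpen_lt continuous_const (by fun_prop)

theorem pointAt_mem_upperHalf {x : EuclideanSpace ℝ (Fin n)} {t : ℝ} :
    pointAt x t ∈ upperHalf n ↔ 0 < t := by
  simp [upperHalf]

/-- Lower integrals over the half-space, in the coordinates `(x, t)`. -/
theorem setLIntegral_upperHalf (f : EuclideanSpace ℝ (Fin (n + 1)) → ℝ≥0∞) :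
    ∫⁻ z in upperHalf n, f z =
      ∫⁻ q : EuclideanSpace ℝ (Fin n) × ℝ in univ ×ˢ Ioi 0, f (pointAt q.1 q.2) := by
  rw [← measurePreserving_pointAt.setLIntegral_comp_preimage_emb measurableEmbedding_pointAt]
  congr 2
  ext q
  simp [pointAt_mem_upperHalf]

end pointAt

/-! ### Translations and mollification in `L¹` -/

section translation
variable {V F : Type*} [NormedAddCommGroup V] [MeasurableSpace V] [BorelSpace V]
  [NormedSpace ℝ V] [FiniteDimensional ℝ V] [NormedAddCommGroup F] [NormedSpace ℝ F]
  {μ : Measure V} [μ.IsAddHaarMeasure]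

/-- Translations are continuous in `L¹`. -/
theorem exists_lintegral_translate_sub_le {f : V → F} (hf : Integrable f μ) {ε : ℝ≥0∞}
    (hε : ε ≠ 0) : ∃ δ > 0, ∀ h : V, ‖h‖ < δ → ∫⁻ x, ‖f (x - h) - f x‖ₑ ∂μ ≤ ε := by
  have hε3 : ε / 3 ≠ 0 := by simp [hε]
  obtain ⟨g, hgc, hfg, gcont, gint⟩ := hf.exists_hasCompactSupport_lintegral_sub_le hε3
  -- Contains the support of every translate of `g` by a vector of norm at most `1`, so uniform
  -- closeness yields `L¹` closeness.
  set K := Metric.cthickening 1 (tsupport g) with hK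
  have hKc : IsCompact K := hgc.isCompact.cthickening
  obtain ⟨η, hη0, hη⟩ : ∃ η : ℝ, 0 < η ∧ ENNReal.ofReal η * μ K ≤ ε / 3 := by
    rcases eq_or_ne (ε / 3) ⊤ with h | h
    · exact ⟨1, one_pos, by simp [h]⟩
    · have hfin : μ K + 1 ≠ ⊤ := by simp [hKc.measure_lt_top.ne]
      refine ⟨((ε / 3) / (μ K + 1)).toReal, ENNReal.toReal_pos ?_ ?_, ?_⟩
      · exact (ENNReal.div_pos hε3 hfin).ne'
      · exact (ENNReal.div_lt_top h (by simp)).ne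
      · rw [ENNReal.ofReal_toReal (ENNReal.div_lt_top h (by simp)).ne]
        calc _ ≤ ε / 3 / (μ K + 1) * (μ K + 1) := by gcongr; simp
          _ ≤ ε / 3 := ENNReal.mul_le_of_le_div le_rfl
  obtain ⟨δ, hδ0, hδ⟩ := Metric.uniformContinuous_iff.1
    (hgc.uniformContinuous_of_continuous gcont) η hη0
  refine ⟨min δ 1, lt_min hδ0 one_pos, fun h hh => ?_⟩
  have mid : ∫⁻ x, ‖g (x - h) - g x‖ₑ ∂μ ≤ ε / 3 := by
    refine le_trans ?_ hη
    rw [← setLIntegral_const]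
    rw [← lintegral_indicator hKc.isClosed.measurableSet]
    refine lintegral_mono fun x => ?_
    by_cases hx : x ∈ K
    · rw [indicator_of_mem hx]
      have : dist (g (x - h)) (g x) < η := hδ (by
        rw [dist_eq_norm]
        simpa using lt_of_lt_of_le hh (min_le_left _ _))
      rw [← ofReal_norm, ← dist_eq_norm]
      exact ENNReal.ofReal_le_ofReal this.le
    · have h1 : g x = 0 := image_eq_zero_of_notMem_tsupport fun h' =>
        hx (Metric.self_subset_cthickening _ h')
      have h2 : g (x - h) = 0 := image_eq_zero_of_notMem_tsupport fun h' => hx (by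
        refine Metric.mem_cthickening_of_dist_le x (x - h) 1 _ h' ?_
        rw [dist_eq_norm]
        simpa using (lt_of_lt_of_le hh (min_le_right _ _)).le)
      simp [h1, h2]
  have left : ∫⁻ x, ‖f (x - h) - g (x - h)‖ₑ ∂μ ≤ ε / 3 := by
    rwa [lintegral_sub_right_eq_self (fun x => ‖f x - g x‖ₑ) h]
  have hsm : AEMeasurable (fun x => ‖f x - g x‖ₑ) μ :=
    (hf.aestronglyMeasurable.sub gint.aestronglyMeasurable).enorm
  calc ∫⁻ x, ‖f (x - h) - f x‖ₑ ∂μ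
      ≤ ∫⁻ x, (‖f (x - h) - g (x - h)‖ₑ + ‖g (x - h) - g x‖ₑ) + ‖f x - g x‖ₑ ∂μ := by
        refine lintegral_mono fun x => ?_
        have e : f (x - h) - f x =
          ((f (x - h) - g (x - h)) + (g (x - h) - g x)) - (f x - g x) := by abel
        rw [e]
        exact (enorm_sub_le).trans (by gcongr; exact enorm_add_le _ _)
    _ = (∫⁻ x, ‖f (x - h) - g (x - h)‖ₑ ∂μ + ∫⁻ x, ‖g (x - h) - g x‖ₑ ∂μ) +
          ∫⁻ x, ‖f x - g x‖ₑ ∂μ := by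
        rw [lintegral_add_right' _ hsm, lintegral_add_right]
        exact ((gcont.comp (continuous_id.sub continuous_const)).sub gcont).enorm.measurable
    _ ≤ ε / 3 + ε / 3 + ε / 3 := by gcongr
    _ = ε := ENNReal.add_thirds ε

end translation

section mollify
variable {V F : Type*} [NormedAddCommGroup V] [MeasurableSpace V] [BorelSpace V]
  [InnerProductSpace ℝ V] [FiniteDimensional ℝ V] [NormedAddCommGroup F] [NormedSpace ℝ F]
  [CompleteSpace F] {μ : Measure V} [μ.IsAddHaarMeasure]

/-- The kernel has integral `1`, so by Tonelli the `L¹` error is at most an average of translation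
errors over the support of the kernel. -/
theorem lintegral_mollify_sub_le {f : V → F} (hfm : StronglyMeasurable f) (hf : Integrable f μ)
    {ε : ℝ≥0∞} {δ : ℝ} (hδ : ∀ h : V, ‖h‖ < δ → ∫⁻ x, ‖f (x - h) - f x‖ₑ ∂μ ≤ ε)
    (φ : ContDiffBump (0 : V)) (hφ : φ.rOut ≤ δ) :
    ∫⁻ x, ‖(∫ t, φ.normed μ t • f (x - t) ∂μ) - f x‖ₑ ∂μ ≤ ε := by
  have hint : ∫⁻ t, ENNReal.ofReal (φ.normed μ t) ∂μ = 1 := by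
    rw [← ofReal_integral_eq_lintegral_ofReal φ.integrable_normed
      (Eventually.of_forall φ.nonneg_normed), φ.integral_normed, ENNReal.ofReal_one]
  have ptw : ∀ x, ‖(∫ t, φ.normed μ t • f (x - t) ∂μ) - f x‖ₑ ≤
      ∫⁻ t, ENNReal.ofReal (φ.normed μ t) * ‖f (x - t) - f x‖ₑ ∂μ := by
    intro x
    have hli : Integrable (fun t => φ.normed μ t • f (x - t)) μ := by
      have h1 : Integrable (fun t => f (x - t)) μ := hf.comp_sub_left x
      obtain ⟨C, hC⟩ := (φ.hasCompactSupport_normed (μ := μ)).exists_bound_of_continuous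
        (φ.continuous_normed (μ := μ))
      exact h1.bdd_smul C φ.continuous_normed.aestronglyMeasurable (Eventually.of_forall hC)
    have e : (∫ t, φ.normed μ t • f (x - t) ∂μ) - f x =
        ∫ t, φ.normed μ t • (f (x - t) - f x) ∂μ := by
      simp only [smul_sub]
      rw [integral_sub hli (φ.integrable_normed.smul_const _), integral_smul_const,
        φ.integral_normed, one_smul]
    rw [e]
    refine (enorm_integral_le_lintegral_enorm _).trans (lintegral_mono fun t => ?_)
    rw [enorm_smul, Real.enorm_of_nonneg (φ.nonneg_normed t)]
  calc _ ≤ ∫⁻ x, ∫⁻ t, ENNReal.ofReal (φ.normed μ t) * ‖f (x - t) - f x‖ₑ ∂μ ∂μ :=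
        lintegral_mono ptw
    _ = ∫⁻ t, ∫⁻ x, ENNReal.ofReal (φ.normed μ t) * ‖f (x - t) - f x‖ₑ ∂μ ∂μ := by
        refine lintegral_lintegral_swap (Measurable.aemeasurable ?_)
        refine Measurable.mul (f := fun q : V × V => ENNReal.ofReal (φ.normed μ q.2))
          (g := fun q : V × V => ‖f (q.1 - q.2) - f q.1‖ₑ) ?_ ?_
        · exact ENNReal.measurable_ofReal.comp
            (φ.continuous_normed.measurable.comp measurable_snd)
        · exact ((hfm.comp_measurable (measurable_fst.sub measurable_snd)).sub
            (hfm.comp_measurable measurable_fst)).enorm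
    _ ≤ ∫⁻ t, ENNReal.ofReal (φ.normed μ t) * ε ∂μ := by
        refine lintegral_mono fun t => ?_
        rw [lintegral_const_mul' _ _ ENNReal.ofReal_ne_top]
        by_cases ht : ‖t‖ < δ
        · gcongr
          exact hδ t ht
        · have : φ.normed μ t = 0 := by
            by_contra h
            have h2 : t ∈ Function.support (φ.normed μ) := h
            rw [φ.support_normed_eq, mem_ball_zero_iff] at h2
            exact ht (h2.trans_le hφ)
          simp [this]
    _ = ε := by
        rw [lintegral_mul_const, hint, one_mul]
        exact ENNReal.measurable_ofReal.comp φ.continuous_normed.measurable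

end mollify

/-! ### Local smooth approximation of weakly differentiable functions -/

section approx
variable {n : ℕ}

local notation "E" => EuclideanSpace ℝ (Fin (n + 1))

theorem fderiv_comp_const_sub (φ : E → ℝ) (hφ : Differentiable ℝ φ) (z t w : E) :
    fderiv ℝ (fun t => φ (z - t)) t w = - fderiv ℝ φ (z - t) w := by
  have h : HasFDerivAt (fun t => φ (z - t)) ((fderiv ℝ φ (z - t)).comp
      (-(ContinuousLinearMap.id ℝ E))) t :=
    (hφ (z - t)).hasFDerivAt.comp t ((hasFDerivAt_id t).const_sub z)
  rw [h.fderiv]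
  simp

/-- The gradient of a mollified weakly differentiable function, at points at a distance from the
complement of a compact set `K`. -/
theorem IsWeakGradient.integral_fderiv_bump {u : E → ℝ} {Du : E → E} (hu : IsWeakGradient u Du)
    {K : Set E} (hK : IsCompact K) (hKH : K ⊆ upperHalf n) (φ : E → ℝ) (hφ : ContDiff ℝ ∞ φ)
    (z : E) (hz : ∀ t ∉ K, z - t ∉ tsupport φ) (i : Fin (n + 1)) :
    ∫ t, K.indicator u t * fderiv ℝ φ (z - t) (EuclideanSpace.single i 1) =
      ∫ t, K.indicator Du t i * φ (z - t) := by
  have hcont : Continuous fun t : E => z - t := continuous_const.sub continuous_id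
  have hts : tsupport (fun t => φ (z - t)) ⊆ K := by
    intro t ht
    by_contra h
    exact hz t h (by
      have := tsupport_comp_subset_preimage φ hcont ht
      exact this)
  have hcs : HasCompactSupport fun t => φ (z - t) := hK.of_isClosed_subset isClosed_closure hts
  have hψ : ContDiff ℝ ∞ fun t => φ (z - t) := hφ.comp (contDiff_const.sub contDiff_id)
  have h := hu.integral_eq _ hψ hcs (hts.trans hKH) i
  have hzero : ∀ t ∉ K, φ (z - t) = 0 := fun t ht => image_eq_zero_of_notMem_tsupport (hz t ht)
  have hzero' : ∀ t ∉ K, fderiv ℝ φ (z - t) = 0 := fun t ht => by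
    by_contra hne
    exact hz t ht (support_fderiv_subset ℝ hne)
  -- The sign from differentiating `t ↦ φ (z - t)` cancels the one in the definition of the weak
  -- gradient.
  have e1 : ∀ t, K.indicator u t * fderiv ℝ φ (z - t) (EuclideanSpace.single i 1) =
      (upperHalf n).indicator
        (fun t => -(u t * fderiv ℝ (fun t => φ (z - t)) t (EuclideanSpace.single i 1))) t := by
    intro t
    simp only [fderiv_comp_const_sub φ (hφ.differentiable (by simp))]
    by_cases ht : t ∈ K
    · rw [indicator_of_mem ht, indicator_of_mem (hKH ht)]
      ring
    · simp [indicator, ht, hzero' t ht]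
  have e2 : ∀ t, K.indicator Du t i * φ (z - t) =
      (upperHalf n).indicator (fun t => Du t i * φ (z - t)) t := by
    intro t
    by_cases ht : t ∈ K
    · rw [indicator_of_mem ht, indicator_of_mem (hKH ht)]
    · simp [indicator, ht, hzero t ht]
  simp only [e1, e2]
  rw [integral_indicator measurableSet_upperHalf, integral_indicator measurableSet_upperHalf,
    integral_neg, h, neg_neg]

/-- Local approximation in `W^{1,1}` of a weakly differentiable function by smooth functions. -/
theorem IsWeakGradient.exists_approx {u : E → ℝ} {Du : E → E} (hu : IsWeakGradient u Du)
    (hum : StronglyMeasurable u) (hDum : StronglyMeasurable Du) {K : Set E} (hK : IsCompact K)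
    (hKH : K ⊆ upperHalf n) {ε : ℝ≥0∞} (hε : ε ≠ 0) :
    ∃ (g : E → ℝ) (G : E → E), ContDiff ℝ 1 g ∧ Measurable G ∧
      (∀ z ∈ K, ∀ w, fderiv ℝ g z w = inner ℝ (G z) w) ∧
      ∫⁻ z in K, ‖u z - g z‖ₑ ≤ ε ∧ ∫⁻ z in K, ‖G z - Du z‖ₑ ≤ ε := by
  -- Room for the mollification: truncating to `K'` is not seen at points of `K` by kernels of
  -- radius at most `δ₀`.
  obtain ⟨δ₀, hδ₀, hsub⟩ := hK.exists_cthickening_subset_open isOpen_upperHalf hKH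
  set K' := Metric.cthickening δ₀ K with hK'
  have hK'c : IsCompact K' := hK.cthickening
  have hK'm : MeasurableSet K' := hK'c.isClosed.measurableSet
  have hKK' : K ⊆ K' := Metric.self_subset_cthickening K
  have iu : Integrable (K'.indicator u) :=
    (integrable_indicator_iff hK'm).2 (hu.locallyIntegrable.integrableOn_compact_subset hsub hK'c)
  have iDu : Integrable (K'.indicator Du) :=
    (integrable_indicator_iff hK'm).2
      (hu.locallyIntegrable_grad.integrableOn_compact_subset hsub hK'c)
  have mu : StronglyMeasurable (K'.indicator u) := hum.indicator hK'm
  have mDu : StronglyMeasurable (K'.indicator Du) := hDum.indicator hK'm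
  obtain ⟨δ₁, hδ₁, h1⟩ := exists_lintegral_translate_sub_le iu hε
  obtain ⟨δ₂, hδ₂, h2⟩ := exists_lintegral_translate_sub_le iDu hε
  set δ := min δ₀ (min δ₁ δ₂) with hδ
  have hδpos : 0 < δ := lt_min hδ₀ (lt_min hδ₁ hδ₂)
  let φ : ContDiffBump (0 : E) := ⟨δ / 2, δ, by linarith, by linarith⟩
  have hout : φ.rOut = δ := rfl
  have hφs : ContDiff ℝ ∞ (φ.normed (volume : Measure E)) := φ.contDiff_normed
  have hφc : HasCompactSupport (φ.normed (volume : Measure E)) := φ.hasCompactSupport_normed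
  refine ⟨convolution (K'.indicator u) (φ.normed volume) (ContinuousLinearMap.lsmul ℝ ℝ) volume,
    convolution (φ.normed volume) (K'.indicator Du) (ContinuousLinearMap.lsmul ℝ ℝ) volume,
    ?_, ?_, ?_, ?_, ?_⟩
  · exact hφc.contDiff_convolution_right _ iu.locallyIntegrable (hφs.of_le (by simp))
  · refine Continuous.measurable ?_
    exact hφc.continuous_convolution_left _ φ.continuous_normed iDu.locallyIntegrable
  · intro z hz w
    have hder := hφc.hasFDerivAt_convolution_right (ContinuousLinearMap.lsmul ℝ ℝ)
      (μ := (volume : Measure E)) iu.locallyIntegrable (hφs.of_le (by simp)) z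
    have hzz : ∀ t ∉ K', z - t ∉ tsupport (φ.normed (volume : Measure E)) := by
      intro t ht hts
      rw [φ.tsupport_normed_eq, mem_closedBall_zero_iff, hout] at hts
      refine ht (Metric.mem_cthickening_of_dist_le t z δ₀ K hz ?_)
      rw [dist_comm, dist_eq_norm]
      exact hts.trans (min_le_left _ _)
    have hbasis : ∀ i, fderiv ℝ (convolution (K'.indicator u) (φ.normed volume)
        (ContinuousLinearMap.lsmul ℝ ℝ) volume) z (EuclideanSpace.single i 1) =
        (convolution (φ.normed volume) (K'.indicator Du) (ContinuousLinearMap.lsmul ℝ ℝ)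
          volume z) i := by
      intro i
      rw [hder.fderiv, convolution_precompR_apply _ iu.locallyIntegrable
        (hφc.fderiv ℝ) (hφs.continuous_fderiv (by simp)), convolution_def, convolution_eq_swap]
      simp only [ContinuousLinearMap.lsmul_apply, smul_eq_mul]
      rw [hu.integral_fderiv_bump hK'c hsub _ hφs z hzz i]
      have hint : Integrable fun t => φ.normed volume (z - t) • K'.indicator Du t := by
        obtain ⟨C, hC⟩ := hφc.exists_bound_of_continuous φ.continuous_normed
        refine iDu.bdd_smul C ?_ (Eventually.of_forall fun t => hC _)
        exact (φ.continuous_normed.comp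
          (continuous_const.sub continuous_id)).aestronglyMeasurable
      have := (EuclideanSpace.proj i : E →L[ℝ] ℝ).integral_comp_comm hint
      refine Eq.trans ?_ this
      refine integral_congr_ae (Eventually.of_forall fun t => ?_)
      simp [mul_comm]
    have hw : w = ∑ i, w i • EuclideanSpace.single i (1 : ℝ) := by
      ext j
      simp [Finset.sum_apply, Pi.single_apply]
    rw [PiLp.inner_apply]
    conv_lhs => rw [hw]
    rw [map_sum]
    refine Finset.sum_congr rfl fun i _ => ?_
    rw [map_smul, hbasis i]
    simp
  · refine le_trans ?_ (lintegral_mollify_sub_le mu iu h1 φ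
      ((min_le_right _ _).trans (min_le_left _ _)))
    rw [← lintegral_indicator hK.isClosed.measurableSet]
    refine lintegral_mono fun z => ?_
    by_cases hz : z ∈ K
    · rw [indicator_of_mem hz, convolution_eq_swap, indicator_of_mem (hKK' hz), enorm_sub_rev]
      simp [mul_comm]
    · rw [indicator_of_notMem hz]
      exact zero_le
  · refine le_trans ?_ (lintegral_mollify_sub_le mDu iDu h2 φ
      ((min_le_right _ _).trans (min_le_right _ _)))
    rw [← lintegral_indicator hK.isClosed.measurableSet]
    refine lintegral_mono fun z => ?_
    by_cases hz : z ∈ K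
    · rw [indicator_of_mem hz, convolution_def, indicator_of_mem (hKK' hz)]
      simp
    · rw [indicator_of_notMem hz]
      exact zero_le

end approx

/-- The Lebesgue measure on the half-space, in the coordinates `(x, t)`. -/
noncomputable def halfMeasure (n : ℕ) : Measure (EuclideanSpace ℝ (Fin n) × ℝ) :=
  (volume : Measure (EuclideanSpace ℝ (Fin n))).prod (volume.restrict (Ioi (0 : ℝ)))

instance (n : ℕ) : SFinite (halfMeasure n) := by
  unfold halfMeasure
  infer_instance

/-! ### Rays from the boundary as a change of variables -/

section halfMeasure
variable {n : ℕ}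

theorem halfMeasure_eq : halfMeasure n =
    (volume : Measure (EuclideanSpace ℝ (Fin n) × ℝ)).restrict (univ ×ˢ Ioi 0) := by
  rw [halfMeasure, Measure.volume_eq_prod, ← Measure.prod_restrict, Measure.restrict_univ]

theorem lintegral_upperHalf_eq (f : EuclideanSpace ℝ (Fin (n + 1)) → ℝ≥0∞) :
    ∫⁻ z in upperHalf n, f z = ∫⁻ q, f (pointAt q.1 q.2) ∂halfMeasure n := by
  rw [setLIntegral_upperHalf, halfMeasure_eq]

theorem ae_halfMeasure_pos : ∀ᵐ q ∂halfMeasure n, 0 < q.2 := by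
  rw [halfMeasure_eq]
  filter_upwards [ae_restrict_mem (MeasurableSet.univ.prod measurableSet_Ioi)] with q hq
  exact hq.2

theorem setLIntegral_Ioi_comp_mul_right (f : ℝ → ℝ≥0∞) {b : ℝ} (hb : 0 < b) :
    ∫⁻ t in Ioi (0 : ℝ), f (t * b) = ENNReal.ofReal b⁻¹ * ∫⁻ t in Ioi (0 : ℝ), f t := by
  have himg : (fun t : ℝ => t * b) '' Ioi 0 = Ioi 0 := by
    ext y
    constructor
    · rintro ⟨t, ht, rfl⟩
      exact mul_pos ht hb
    · intro hy
      exact ⟨y / b, div_pos hy hb, by field_simp⟩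
  have h := lintegral_image_eq_lintegral_abs_deriv_mul (s := Ioi (0 : ℝ))
    (f := fun t => t * b) (f' := fun _ => b) measurableSet_Ioi
    (fun t _ => by simpa using ((hasDerivAt_id t).mul_const b).hasDerivWithinAt)
    (fun x _ y _ h => mul_right_cancel₀ hb.ne' h) f
  rw [himg] at h
  rw [h, lintegral_const_mul' _ _ ENNReal.ofReal_ne_top, ← mul_assoc, abs_of_pos hb,
    ← ENNReal.ofReal_mul (by positivity), inv_mul_cancel₀ hb.ne', ENNReal.ofReal_one, one_mul]

/-- The map is a horizontal shear, which preserves measure at each height, followed by a dilation of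
the height by `b`. -/
theorem lintegral_halfMeasure_comp {f : EuclideanSpace ℝ (Fin n) × ℝ → ℝ≥0∞} (hf : Measurable f)
    (a : EuclideanSpace ℝ (Fin n)) {b : ℝ} (hb : 0 < b) :
    ∫⁻ q, f (q.1 + q.2 • a, q.2 * b) ∂halfMeasure n =
      ENNReal.ofReal b⁻¹ * ∫⁻ q, f q ∂halfMeasure n := by
  have hm : Measurable fun q : EuclideanSpace ℝ (Fin n) × ℝ => f (q.1 + q.2 • a, q.2 * b) :=
    hf.comp (by fun_prop)
  rw [halfMeasure, lintegral_prod_symm' _ hm, lintegral_prod_symm' _ hf,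
    ← setLIntegral_Ioi_comp_mul_right (fun t => ∫⁻ x, f (x, t)) hb]
  refine lintegral_congr fun t => ?_
  exact lintegral_add_right_eq_self (fun x => f (x, t * b)) (t • a)

theorem exists_pointAt (γ : EuclideanSpace ℝ (Fin (n + 1))) :
    ∃ a, γ = pointAt a (γ (Fin.last n)) := by
  refine ⟨WithLp.toLp 2 fun i => γ i.castSucc, ?_⟩
  ext i
  refine Fin.lastCases ?_ (fun j => ?_) i <;> simp

theorem pointAt_zero_add_smul (x a : EuclideanSpace ℝ (Fin n)) (t b : ℝ) :
    pointAt x 0 + t • pointAt a b = pointAt (x + t • a) (t * b) := by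
  rw [← pointAt_smul, ← pointAt_add, zero_add]

theorem lintegral_halfMeasure_ray {h : EuclideanSpace ℝ (Fin (n + 1)) → ℝ≥0∞} (hh : Measurable h)
    {γ : EuclideanSpace ℝ (Fin (n + 1))} (hγ : 0 < γ (Fin.last n)) :
    ∫⁻ q, h (pointAt q.1 0 + q.2 • γ) ∂halfMeasure n =
      ENNReal.ofReal (γ (Fin.last n))⁻¹ * ∫⁻ z in upperHalf n, h z := by
  obtain ⟨a, ha⟩ := exists_pointAt γ
  rw [lintegral_upperHalf_eq, ← lintegral_halfMeasure_comp
    (f := fun q => h (pointAt q.1 q.2)) (hh.comp continuous_pointAt.measurable) a hγ]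
  refine lintegral_congr fun q => ?_
  simp only
  rw [← pointAt_zero_add_smul, ← ha]

end halfMeasure

/-! ### Integration of the gradient along dilated curves -/

section path
variable {n : ℕ}

local notation "E" => EuclideanSpace ℝ (Fin (n + 1))

theorem enorm_sub_le_lintegral_of_contDiff {g : E → ℝ} (hg : ContDiff ℝ 1 g) {P P' : ℝ → E}
    (hP : ∀ r, HasDerivAt P (P' r) r) (hP' : Continuous P') {r₀ r₁ : ℝ} (h01 : r₀ ≤ r₁) :
    ‖g (P r₁) - g (P r₀)‖ₑ ≤ ∫⁻ r in Ioc r₀ r₁, ‖fderiv ℝ g (P r) (P' r)‖ₑ := by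
  have hPc : Continuous P := continuous_iff_continuousAt.2 fun r => (hP r).continuousAt
  have hd : ∀ r, HasDerivAt (fun r => g (P r)) (fderiv ℝ g (P r) (P' r)) r := fun r =>
    ((hg.differentiable (by simp)) (P r)).hasFDerivAt.comp_hasDerivAt r (hP r)
  have hc : Continuous fun r => fderiv ℝ g (P r) (P' r) :=
    ((hg.continuous_fderiv (by simp)).comp hPc).clm_apply hP'
  rw [← intervalIntegral.integral_eq_sub_of_hasDerivAt (fun r _ => hd r)
    (hc.intervalIntegrable _ _), intervalIntegral.integral_of_le h01]
  exact enorm_integral_le_lintegral_enorm _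

/-- For a smooth approximation this is the fundamental theorem of calculus. At each `r`, the map
`(x, t) ↦ (x, 0) + t Γ(r)` has Jacobian `Γ_N(r)`, bounded below on the compact range of `r`. The
errors integrated over a box of `(x, t)` are therefore controlled by `L¹` errors on a compact subset
of the half-space. -/
theorem IsWeakGradient.ae_enorm_sub_le {u : E → ℝ} {Du : E → E} (hu : IsWeakGradient u Du)
    (hum : StronglyMeasurable u) (hDum : StronglyMeasurable Du) {Γ Γ' : ℝ → E}
    (hΓ : ∀ r, HasDerivAt Γ (Γ' r) r) (hΓ' : Continuous Γ') {r₀ r₁ : ℝ} (h01 : r₀ ≤ r₁)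
    (hpos : ∀ r ∈ Icc r₀ r₁, 0 < Γ r (Fin.last n)) :
    ∀ᵐ q ∂halfMeasure n,
      ‖u (pointAt q.1 0 + q.2 • Γ r₁) - u (pointAt q.1 0 + q.2 • Γ r₀)‖ₑ ≤
        ∫⁻ r in Ioc r₀ r₁, ‖Du (pointAt q.1 0 + q.2 • Γ r)‖ₑ *
          ENNReal.ofReal (q.2 * ‖Γ' r‖) := by
  have hΓc : Continuous Γ := continuous_iff_continuousAt.2 fun r => (hΓ r).continuousAt
  let P : (EuclideanSpace ℝ (Fin n) × ℝ) × ℝ → E := fun y => pointAt y.1.1 0 + y.1.2 • Γ y.2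
  have hPc : Continuous P := by
    have : Continuous fun y : (EuclideanSpace ℝ (Fin n) × ℝ) × ℝ => pointAt y.1.1 0 :=
      continuous_pointAt.comp (by fun_prop : Continuous fun y :
        (EuclideanSpace ℝ (Fin n) × ℝ) × ℝ => (y.1.1, (0 : ℝ)))
    fun_prop
  have hPlast : ∀ y, P y (Fin.last n) = y.1.2 * Γ y.2 (Fin.last n) := fun y => by simp [P]
  have hPr : ∀ r, Continuous fun q : EuclideanSpace ℝ (Fin n) × ℝ => P (q, r) := fun r => by
    fun_prop
  set A : EuclideanSpace ℝ (Fin n) × ℝ → ℝ≥0∞ := fun q => ‖u (P (q, r₁)) - u (P (q, r₀))‖ₑ with hA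
  set B : EuclideanSpace ℝ (Fin n) × ℝ → ℝ≥0∞ := fun q =>
    ∫⁻ r in Ioc r₀ r₁, ‖Du (P (q, r))‖ₑ * ENNReal.ofReal (q.2 * ‖Γ' r‖) with hB
  have mspeed : Measurable fun y : (EuclideanSpace ℝ (Fin n) × ℝ) × ℝ =>
      ENNReal.ofReal (y.1.2 * ‖Γ' y.2‖) := by
    refine ENNReal.measurable_ofReal.comp (Continuous.measurable ?_)
    fun_prop
  have mA : Measurable A := ((hum.comp_measurable (hPr r₁).measurable).sub
    (hum.comp_measurable (hPr r₀).measurable)).enorm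
  have mB : Measurable B := by
    refine Measurable.lintegral_prod_right' (f := fun y : (EuclideanSpace ℝ (Fin n) × ℝ) × ℝ =>
      ‖Du (P y)‖ₑ * ENNReal.ofReal (y.1.2 * ‖Γ' y.2‖)) (Measurable.mul ?_ mspeed)
    exact (hDum.comp_measurable hPc.measurable).enorm
  have box : ∀ m : ℕ, ∀ᵐ q ∂halfMeasure n,
      q ∈ Metric.closedBall (0 : EuclideanSpace ℝ (Fin n)) m ×ˢ Icc (1 / (m + 1 : ℝ)) m →
        A q ≤ B q := by
    intro m
    set Z : Set (EuclideanSpace ℝ (Fin n) × ℝ) :=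
      Metric.closedBall (0 : EuclideanSpace ℝ (Fin n)) m ×ˢ Icc (1 / (m + 1 : ℝ)) m with hZ
    have hZc : IsCompact Z := (isCompact_closedBall _ _).prod isCompact_Icc
    have hZm : MeasurableSet Z := hZc.isClosed.measurableSet
    set K := P '' (Z ×ˢ Icc r₀ r₁) with hK
    have hKc : IsCompact K := (hZc.prod isCompact_Icc).image hPc
    have hKm : MeasurableSet K := hKc.isClosed.measurableSet
    have hKH : K ⊆ upperHalf n := by
      rintro _ ⟨y, ⟨hy1, hy2⟩, rfl⟩
      have h1 : 0 < y.1.2 := lt_of_lt_of_le (by positivity) hy1.2.1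
      change 0 < P y (Fin.last n)
      rw [hPlast]
      exact mul_pos h1 (hpos _ hy2)
    have hmem : ∀ q ∈ Z, ∀ r ∈ Icc r₀ r₁, P (q, r) ∈ K := fun q hq r hr =>
      ⟨(q, r), ⟨hq, hr⟩, rfl⟩
    obtain ⟨b₀, hb₀, hb⟩ : ∃ b₀ : ℝ, 0 < b₀ ∧ ∀ r ∈ Icc r₀ r₁, b₀ ≤ Γ r (Fin.last n) := by
      have hcl : Continuous fun r => Γ r (Fin.last n) := by fun_prop
      obtain ⟨r, hr, hmin⟩ := isCompact_Icc.exists_isMinOn (nonempty_Icc.2 h01) hcl.continuousOn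
      exact ⟨_, hpos r hr, fun r' hr' => hmin hr'⟩
    obtain ⟨M, hM⟩ := isCompact_Icc.exists_bound_of_continuousOn (s := Icc r₀ r₁)
      hΓ'.continuousOn
    have hray : ∀ (h : E → ℝ≥0∞), Measurable h → ∀ r ∈ Icc r₀ r₁,
        ∫⁻ q in Z, h (P (q, r)) ∂halfMeasure n ≤ ENNReal.ofReal b₀⁻¹ * ∫⁻ z in K, h z := by
      intro h hh r hr
      calc ∫⁻ q in Z, h (P (q, r)) ∂halfMeasure n
          ≤ ∫⁻ q, K.indicator h (P (q, r)) ∂halfMeasure n := by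
            rw [← lintegral_indicator hZm]
            refine lintegral_mono fun q => ?_
            by_cases hq : q ∈ Z
            · rw [indicator_of_mem hq, indicator_of_mem (hmem q hq r hr)]
            · rw [indicator_of_notMem hq]
              exact zero_le
        _ = ENNReal.ofReal (Γ r (Fin.last n))⁻¹ * ∫⁻ z in upperHalf n, K.indicator h z :=
            lintegral_halfMeasure_ray (hh.indicator hKm) (hpos r hr)
        _ ≤ _ := by
            refine mul_le_mul' (ENNReal.ofReal_le_ofReal ?_) ?_
            · exact inv_anti₀ hb₀ (hb r hr)
            · rw [lintegral_indicator hKm, Measure.restrict_restrict hKm]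
              exact lintegral_mono' (Measure.restrict_mono inter_subset_left le_rfl) le_rfl
    -- Two errors at the endpoints, and the gradient error over `r₀ < r ≤ r₁` with speed `t * ‖Γ' r‖
    -- ≤ m * M`.
    set C : ℝ≥0∞ := ENNReal.ofReal b₀⁻¹ + ENNReal.ofReal b₀⁻¹ +
      ENNReal.ofReal (m * M) * (ENNReal.ofReal b₀⁻¹ * ENNReal.ofReal (r₁ - r₀)) with hC
    have hCfin : C ≠ ⊤ := by
      rw [hC]
      finiteness
    -- The truncated difference `A - B` is the excess over the bound. It does not depend on the
    -- approximation, so it vanishes as `ε` tends to `0`.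
    have est : ∀ ε : ℝ≥0∞, ε ≠ 0 → ∫⁻ q in Z, (A q - B q) ∂halfMeasure n ≤ C * ε := by
      intro ε hε
      obtain ⟨g, G, hg, hGm, hgG, hug, hGD⟩ := hu.exists_approx hum hDum hKc hKH hε
      have mug : Measurable fun z => ‖u z - g z‖ₑ :=
        (hum.sub hg.continuous.stronglyMeasurable).enorm
      have mGD : Measurable fun z => ‖G z - Du z‖ₑ :=
        (hGm.sub hDum.measurable).enorm
      have ptw : ∀ q ∈ Z, A q - B q ≤ ‖u (P (q, r₁)) - g (P (q, r₁))‖ₑ +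
          ‖u (P (q, r₀)) - g (P (q, r₀))‖ₑ + ENNReal.ofReal (m * M) *
            ∫⁻ r in Ioc r₀ r₁, ‖G (P (q, r)) - Du (P (q, r))‖ₑ := by
        intro q hq
        have hq0 : 0 < q.2 := lt_of_lt_of_le (by positivity) hq.2.1
        have hder : ∀ r, HasDerivAt (fun r => P (q, r)) (q.2 • Γ' r) r := fun r =>
          HasDerivAt.const_add (pointAt q.1 0) ((hΓ r).const_smul q.2 :
            HasDerivAt (fun r => q.2 • Γ r) _ r)
        have hs : ‖g (P (q, r₁)) - g (P (q, r₀))‖ₑ ≤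
            ENNReal.ofReal (m * M) * (∫⁻ r in Ioc r₀ r₁, ‖G (P (q, r)) - Du (P (q, r))‖ₑ) + B q := by
          refine (enorm_sub_le_lintegral_of_contDiff hg hder (by fun_prop) h01).trans ?_
          rw [hB, ← lintegral_const_mul' _ _ ENNReal.ofReal_ne_top, ← lintegral_add_left]
          swap
          · exact (mGD.comp ((hPc.comp (by fun_prop : Continuous fun r : ℝ =>
              (q, r))).measurable)).const_mul _
          refine setLIntegral_mono' measurableSet_Ioc fun r hr => ?_
          have hr' : r ∈ Icc r₀ r₁ := Ioc_subset_Icc_self hr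
          rw [hgG _ (hmem q hq r hr')]
          have h1 : ‖inner ℝ (G (P (q, r))) (q.2 • Γ' r)‖ₑ ≤
              ‖G (P (q, r))‖ₑ * ENNReal.ofReal (q.2 * ‖Γ' r‖) := by
            rw [← ofReal_norm, ← ofReal_norm, ← ENNReal.ofReal_mul (norm_nonneg _)]
            refine ENNReal.ofReal_le_ofReal ((norm_inner_le_norm _ _).trans (le_of_eq ?_))
            rw [norm_smul, Real.norm_of_nonneg hq0.le]
          refine h1.trans ?_
          have h2 : ‖G (P (q, r))‖ₑ ≤ ‖G (P (q, r)) - Du (P (q, r))‖ₑ + ‖Du (P (q, r))‖ₑ := by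
            simpa using enorm_add_le (G (P (q, r)) - Du (P (q, r))) (Du (P (q, r)))
          refine (mul_le_mul_left h2 _).trans ?_
          rw [add_mul, mul_comm (ENNReal.ofReal (m * M))]
          gcongr
          · exact hq.2.2
          · exact hM r hr'
        rw [tsub_le_iff_right]
        have e : u (P (q, r₁)) - u (P (q, r₀)) = (u (P (q, r₁)) - g (P (q, r₁)) -
            (u (P (q, r₀)) - g (P (q, r₀)))) + (g (P (q, r₁)) - g (P (q, r₀))) := by ring
        calc A q ≤ ‖u (P (q, r₁)) - g (P (q, r₁)) - (u (P (q, r₀)) - g (P (q, r₀)))‖ₑ +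
              ‖g (P (q, r₁)) - g (P (q, r₀))‖ₑ := by
              rw [hA]
              simp only
              rw [e]
              exact enorm_add_le _ _
          _ ≤ (‖u (P (q, r₁)) - g (P (q, r₁))‖ₑ + ‖u (P (q, r₀)) - g (P (q, r₀))‖ₑ) +
              (ENNReal.ofReal (m * M) *
                (∫⁻ r in Ioc r₀ r₁, ‖G (P (q, r)) - Du (P (q, r))‖ₑ) + B q) :=
              add_le_add enorm_sub_le hs
          _ = _ := by rw [add_assoc, add_assoc, add_assoc]
      calc ∫⁻ q in Z, (A q - B q) ∂halfMeasure n
          ≤ ∫⁻ q in Z, (‖u (P (q, r₁)) - g (P (q, r₁))‖ₑ + ‖u (P (q, r₀)) - g (P (q, r₀))‖ₑ +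
            ENNReal.ofReal (m * M) *
              ∫⁻ r in Ioc r₀ r₁, ‖G (P (q, r)) - Du (P (q, r))‖ₑ) ∂halfMeasure n :=
            setLIntegral_mono' hZm ptw
        _ = (∫⁻ q in Z, ‖u (P (q, r₁)) - g (P (q, r₁))‖ₑ ∂halfMeasure n +
            ∫⁻ q in Z, ‖u (P (q, r₀)) - g (P (q, r₀))‖ₑ ∂halfMeasure n) +
            ENNReal.ofReal (m * M) * ∫⁻ r in Ioc r₀ r₁,
              ∫⁻ q in Z, ‖G (P (q, r)) - Du (P (q, r))‖ₑ ∂halfMeasure n := by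
            rw [lintegral_add_left, lintegral_add_left, lintegral_const_mul' _ _
              ENNReal.ofReal_ne_top, lintegral_lintegral_swap]
            · exact (mGD.comp hPc.measurable).aemeasurable
            · exact mug.comp (hPr r₁).measurable
            · exact (mug.comp (hPr r₁).measurable).add (mug.comp (hPr r₀).measurable)
        _ ≤ (ENNReal.ofReal b₀⁻¹ * ε + ENNReal.ofReal b₀⁻¹ * ε) +
            ENNReal.ofReal (m * M) * ∫⁻ r in Ioc r₀ r₁, ENNReal.ofReal b₀⁻¹ * ε := by
            gcongr ?_ + ?_ + _ * ?_
            · exact (hray _ mug r₁ ⟨h01, le_rfl⟩).trans (by gcongr)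
            · exact (hray _ mug r₀ ⟨le_rfl, h01⟩).trans (by gcongr)
            · refine setLIntegral_mono' measurableSet_Ioc fun r hr => ?_
              exact (hray _ mGD r (Ioc_subset_Icc_self hr)).trans (by gcongr)
        _ = C * ε := by
            rw [setLIntegral_const, Real.volume_Ioc, hC]
            ring
    have hzero : ∫⁻ q in Z, (A q - B q) ∂halfMeasure n = 0 := by
      by_contra hne
      set I := ∫⁻ q in Z, (A q - B q) ∂halfMeasure n with hI
      have h1 := est 1 one_ne_zero
      have hIfin : I ≠ ⊤ := ne_top_of_le_ne_top (by simpa using hCfin) h1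
      have hC0 : C ≠ 0 := fun h => hne (by simpa [h] using h1)
      -- This choice of `ε` yields `I ≤ I / 2` with `0 < I < ⊤`.
      have h2 := est (I / (2 * C)) (ENNReal.div_pos hne (by finiteness)).ne'
      have h3 : C * (I / (2 * C)) = I / 2 := by
        rw [ENNReal.div_eq_inv_mul, ENNReal.mul_inv (by simp) (by simp), ENNReal.div_eq_inv_mul]
        calc C * (2⁻¹ * C⁻¹ * I) = (C * C⁻¹) * (2⁻¹ * I) := by ring
          _ = _ := by rw [ENNReal.mul_inv_cancel hC0 hCfin, one_mul]
      rw [h3] at h2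
      exact absurd h2 (not_le.2 (ENNReal.half_lt_self hne hIfin))
    rw [lintegral_eq_zero_iff (f := fun q => A q - B q) (mA.sub mB)] at hzero
    rw [Filter.EventuallyEq, ae_restrict_iff' hZm] at hzero
    filter_upwards [hzero] with q hq hqZ
    exact tsub_eq_zero_iff_le.1 (hq hqZ)
  filter_upwards [ae_all_iff.2 box, ae_halfMeasure_pos] with q hq hq0
  obtain ⟨m, hm⟩ := exists_nat_ge (max ‖q.1‖ (max q.2 (1 / q.2)))
  refine hq m ⟨?_, ?_, ?_⟩
  · simpa using (le_max_left _ _).trans hm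
  · have h1 : 1 / q.2 ≤ m := ((le_max_right _ _).trans (le_max_right _ _)).trans hm
    rw [div_le_iff₀ (by positivity)]
    rw [div_le_iff₀ hq0] at h1
    nlinarith
  · exact ((le_max_left _ _).trans (le_max_right _ _)).trans hm

end path

/-! ### Limits along vertical segments -/

section vertical

theorem ae_restrict_Ioo_of_ae_mul {P : ℝ → Prop} {t : ℝ} (ht : 0 < t)
    (h : ∀ᵐ r ∂volume.restrict (Ioo (0 : ℝ) 1), P (r * t)) :
    ∀ᵐ r ∂volume.restrict (Ioo (0 : ℝ) t), P r := by
  rw [ae_restrict_iff' measurableSet_Ioo, ae_iff] at h ⊢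
  have e : {r | ¬(r ∈ Ioo (0 : ℝ) 1 → P (r * t))} =
      (fun r => r * t) ⁻¹' {r | ¬(r ∈ Ioo 0 t → P r)} := by
    ext r
    have h1 : 0 < r * t ↔ 0 < r := mul_pos_iff_of_pos_right ht
    have h2 : r * t < t ↔ r < 1 := by
      constructor
      · intro h
        by_contra! h'
        nlinarith
      · intro h
        nlinarith
    simp [h1, h2]
  rw [e, Real.volume_preimage_mul_right ht.ne', mul_eq_zero] at h
  refine h.resolve_left ?_
  simp [ht.ne']

/-- Two good heights `a` and `b` share an admissible `r` below both, so `f a` and `f b` differ by at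
most `G a + G b`. The values at `t k` are therefore Cauchy, and letting `k` tend to infinity removes
the second term. -/
theorem exists_tendsto_of_ae_enorm_sub_le {f : ℝ → ℝ} {G : ℝ → ℝ≥0∞} {t : ℕ → ℝ}
    (ht : ∀ k, 0 < t k) (hG : Tendsto (fun k => G (t k)) atTop (𝓝 0))
    (good : ∀ k, ∀ᵐ r ∂volume.restrict (Ioo 0 (t k)), ‖f (t k) - f r‖ₑ ≤ G (t k)) :
    ∃ c, Tendsto (fun k => f (t k)) atTop (𝓝 c) ∧ ∀ τ, 0 < τ →
      (∀ᵐ r ∂volume.restrict (Ioo 0 τ), ‖f τ - f r‖ₑ ≤ G τ) → ‖f τ - c‖ₑ ≤ G τ := by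
  have two : ∀ a b, 0 < a → 0 < b →
      (∀ᵐ r ∂volume.restrict (Ioo 0 a), ‖f a - f r‖ₑ ≤ G a) →
      (∀ᵐ r ∂volume.restrict (Ioo 0 b), ‖f b - f r‖ₑ ≤ G b) → ‖f a - f b‖ₑ ≤ G a + G b := by
    intro a b ha hb h1 h2
    have h1' := ae_restrict_of_ae_restrict_of_subset
      (Ioo_subset_Ioo_right (min_le_left a b) : Ioo 0 (min a b) ⊆ Ioo 0 a) h1
    have h2' := ae_restrict_of_ae_restrict_of_subset
      (Ioo_subset_Ioo_right (min_le_right a b) : Ioo 0 (min a b) ⊆ Ioo 0 b) h2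
    have : (ae (volume.restrict (Ioo 0 (min a b)))).NeBot := by
      rw [ae_neBot, Ne, Measure.restrict_eq_zero, Real.volume_Ioo]
      simp [ha, hb]
    obtain ⟨r, hr1, hr2⟩ := (h1'.and h2').exists
    have e : f a - f b = (f a - f r) - (f b - f r) := by ring
    rw [e]
    exact enorm_sub_le.trans (add_le_add hr1 hr2)
  have hc : CauchySeq fun k => f (t k) := by
    rw [EMetric.cauchySeq_iff]
    intro ε hε
    obtain ⟨m, hm⟩ := ((ENNReal.tendsto_nhds_zero.1 hG) (ε / 3)
      (ENNReal.div_pos hε.ne' (by simp))).exists_forall_of_atTop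
    refine ⟨m, fun j hj k hk => ?_⟩
    rw [edist_eq_enorm_sub]
    by_cases hεt : ε = ⊤
    · rw [hεt]
      exact enorm_lt_top
    calc ‖f (t j) - f (t k)‖ₑ ≤ ε / 3 + ε / 3 :=
          (two _ _ (ht j) (ht k) (good j) (good k)).trans (add_le_add (hm j hj) (hm k hk))
      _ < ε / 3 + ε / 3 + ε / 3 :=
          ENNReal.lt_add_right (by finiteness) (ENNReal.div_pos hε.ne' (by simp)).ne'
      _ = ε := ENNReal.add_thirds ε
  obtain ⟨c, hc⟩ := cauchySeq_tendsto_of_complete hc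
  refine ⟨c, hc, fun τ hτ h => ?_⟩
  have l1 : Tendsto (fun k => ‖f τ - f (t k)‖ₑ) atTop (𝓝 ‖f τ - c‖ₑ) :=
    (continuous_enorm.tendsto _).comp (tendsto_const_nhds.sub hc)
  have l2 : Tendsto (fun k => G τ + G (t k)) atTop (𝓝 (G τ + 0)) := tendsto_const_nhds.add hG
  rw [add_zero] at l2
  exact le_of_tendsto_of_tendsto' l1 l2 fun k => two _ _ hτ (ht k) h (good k)

variable {n : ℕ}

/-- The variation of a function with gradient `Du` on the segment from `(x, 0)` to `(x, t)`. -/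
noncomputable def verticalVariation
    (Du : EuclideanSpace ℝ (Fin (n + 1)) → EuclideanSpace ℝ (Fin (n + 1)))
    (x : EuclideanSpace ℝ (Fin n)) (t : ℝ) : ℝ≥0∞ :=
  ∫⁻ τ in Ioc 0 t, ‖Du (pointAt x τ)‖ₑ

variable {u : EuclideanSpace ℝ (Fin (n + 1)) → ℝ}
  {Du : EuclideanSpace ℝ (Fin (n + 1)) → EuclideanSpace ℝ (Fin (n + 1))}

theorem verticalVariation_mono {x : EuclideanSpace ℝ (Fin n)} {t t' : ℝ} (h : t ≤ t') :
    verticalVariation Du x t ≤ verticalVariation Du x t' :=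
  lintegral_mono_set (Ioc_subset_Ioc_right h)

theorem measurable_verticalVariation (hDum : StronglyMeasurable Du) :
    Measurable fun q : EuclideanSpace ℝ (Fin n) × ℝ => verticalVariation Du q.1 q.2 := by
  have h : (fun q : EuclideanSpace ℝ (Fin n) × ℝ => verticalVariation Du q.1 q.2) = fun q =>
      ∫⁻ τ, ({y : (EuclideanSpace ℝ (Fin n) × ℝ) × ℝ | 0 < y.2 ∧ y.2 ≤ y.1.2}.indicator
        (fun y => ‖Du (pointAt y.1.1 y.2)‖ₑ)) (q, τ) := by
    funext q
    rw [verticalVariation, ← lintegral_indicator measurableSet_Ioc]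
    rfl
  rw [h]
  refine Measurable.lintegral_prod_right' (Measurable.indicator ?_ ?_)
  · exact (hDum.comp_measurable (continuous_pointAt.measurable.comp (by fun_prop :
      Measurable fun y : (EuclideanSpace ℝ (Fin n) × ℝ) × ℝ => (y.1.1, y.2)))).enorm
  · exact (measurableSet_lt measurable_const measurable_snd).inter
      (measurableSet_le measurable_snd (measurable_snd.comp measurable_fst))

theorem tendsto_verticalVariation {x : EuclideanSpace ℝ (Fin n)}
    (h : verticalVariation Du x 1 ≠ ⊤) :
    Tendsto (verticalVariation Du x) (𝓝[>] 0) (𝓝 0) := by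
  have h1 : Tendsto (volume.restrict (Ioc (0 : ℝ) 1) ∘ fun t => Ioc 0 t) (𝓝[>] 0) (𝓝 0) := by
    refine tendsto_of_tendsto_of_tendsto_of_le_of_le tendsto_const_nhds
      (h := fun t => ENNReal.ofReal t) ?_ (fun _ => zero_le) fun t => ?_
    · have : Tendsto (fun t : ℝ => ENNReal.ofReal t) (𝓝 0) (𝓝 (ENNReal.ofReal 0)) :=
        ENNReal.continuous_ofReal.tendsto 0
      rw [ENNReal.ofReal_zero] at this
      exact this.mono_left nhdsWithin_le_nhds
    · refine (Measure.restrict_apply_le _ _).trans ?_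
      simp
  refine (tendsto_setLIntegral_zero h h1).congr' ?_
  have : Ioo (0 : ℝ) 1 ∈ 𝓝[>] (0 : ℝ) := Ioo_mem_nhdsGT one_pos
  filter_upwards [this] with t ht
  rw [Measure.restrict_restrict measurableSet_Ioc,
    inter_eq_left.2 (Ioc_subset_Ioc_right ht.2.le), verticalVariation]

/-- The curve estimate for the vertical segment from `l * t` to `t` holds for each `l`, almost
everywhere in `(x, t)`. Fubini exchanges the quantifiers, and `r = l * t` rescales `(0, 1)` to `(0,
t)`. -/
theorem IsWeakGradient.ae_ae_enorm_sub_le (hu : IsWeakGradient u Du) (hum : StronglyMeasurable u)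
    (hDum : StronglyMeasurable Du) :
    ∀ᵐ q ∂halfMeasure n, ∀ᵐ r ∂volume.restrict (Ioo 0 q.2),
      ‖u (pointAt q.1 q.2) - u (pointAt q.1 r)‖ₑ ≤ verticalVariation Du q.1 q.2 := by
  have one : ∀ l ∈ Ioo (0 : ℝ) 1, ∀ᵐ q ∂halfMeasure n,
      ‖u (pointAt q.1 q.2) - u (pointAt q.1 (l * q.2))‖ₑ ≤ verticalVariation Du q.1 q.2 := by
    intro l hl
    have h := hu.ae_enorm_sub_le hum hDum (Γ := fun r => r • pointAt 0 1)
      (Γ' := fun _ => pointAt 0 1) (r₀ := l) (r₁ := 1)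
      (fun r => by simpa using (hasDerivAt_id r).smul_const (pointAt (n := n) 0 1))
      continuous_const hl.2.le (fun r hr => by simpa using hl.1.trans_le hr.1)
    filter_upwards [h, ae_halfMeasure_pos] with q hq hq0
    have hP : ∀ r : ℝ, pointAt q.1 0 + q.2 • r • pointAt 0 1 = pointAt q.1 (r * q.2) := by
      intro r
      rw [← pointAt_smul, ← pointAt_smul, ← pointAt_add]
      simp [mul_comm]
    simp only [hP, one_mul] at hq
    refine hq.trans ?_
    have hn1 : ‖pointAt (0 : EuclideanSpace ℝ (Fin n)) 1‖ = 1 := by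
      have := norm_pointAt_sq (0 : EuclideanSpace ℝ (Fin n)) 1
      rw [← Real.sqrt_sq (norm_nonneg (pointAt _ _)), this]
      simp
    have h2 := setLIntegral_Ioi_comp_mul_right
      ((Ioc 0 q.2).indicator fun τ => ‖Du (pointAt q.1 τ)‖ₑ * ENNReal.ofReal q.2) hq0
    have h3 : ∫⁻ t in Ioi (0 : ℝ), (Ioc 0 q.2).indicator
        (fun τ => ‖Du (pointAt q.1 τ)‖ₑ * ENNReal.ofReal q.2) t =
        verticalVariation Du q.1 q.2 * ENNReal.ofReal q.2 := by
      rw [lintegral_indicator measurableSet_Ioc, Measure.restrict_restrict measurableSet_Ioc,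
        inter_eq_left.2 Ioc_subset_Ioi_self, lintegral_mul_const' _ _ ENNReal.ofReal_ne_top,
        verticalVariation]
    rw [h3, mul_comm (verticalVariation _ _ _), ← mul_assoc,
      ← ENNReal.ofReal_mul (by positivity), inv_mul_cancel₀ hq0.ne', ENNReal.ofReal_one,
      one_mul] at h2
    rw [← h2, hn1, mul_one, ← lintegral_indicator measurableSet_Ioc,
      ← lintegral_indicator measurableSet_Ioi]
    refine lintegral_mono fun r => ?_
    by_cases hr : r ∈ Ioc l 1
    · have hr0 : 0 < r := hl.1.trans hr.1
      rw [indicator_of_mem hr, indicator_of_mem (mem_Ioi.2 hr0), indicator_of_mem]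
      exact ⟨by positivity, by nlinarith [hr.2]⟩
    · rw [indicator_of_notMem hr]
      exact zero_le
  have hm : MeasurableSet {y : ℝ × (EuclideanSpace ℝ (Fin n) × ℝ) |
      ‖u (pointAt y.2.1 y.2.2) - u (pointAt y.2.1 (y.1 * y.2.2))‖ₑ ≤
        verticalVariation Du y.2.1 y.2.2} := by
    refine measurableSet_le (StronglyMeasurable.enorm (StronglyMeasurable.sub ?_ ?_))
      ((measurable_verticalVariation hDum).comp measurable_snd)
    · exact hum.comp_measurable (continuous_pointAt.measurable.comp measurable_snd)
    · exact hum.comp_measurable (continuous_pointAt.measurable.comp (by fun_prop :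
        Measurable fun y : ℝ × (EuclideanSpace ℝ (Fin n) × ℝ) => (y.2.1, y.1 * y.2.2)))
  have h := (Measure.ae_ae_comm (μ := volume.restrict (Ioo (0 : ℝ) 1)) (ν := halfMeasure n) hm).1
    ((ae_restrict_iff' measurableSet_Ioo).2 (Eventually.of_forall one))
  filter_upwards [h, ae_halfMeasure_pos] with q hq hq0
  exact ae_restrict_Ioo_of_ae_mul hq0 hq

theorem IsWeakGradient.exists_vertical_limit (hu : IsWeakGradient u Du)
    (hum : StronglyMeasurable u) (hDum : StronglyMeasurable Du)
    (hfin : ∀ᵐ x, verticalVariation Du x 1 ≠ ⊤) :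
    ∃ v : EuclideanSpace ℝ (Fin n) → ℝ, Measurable v ∧
      ∀ᵐ q ∂halfMeasure n, ‖u (pointAt q.1 q.2) - v q.1‖ₑ ≤ verticalVariation Du q.1 q.2 := by
  have h := hu.ae_ae_enorm_sub_le hum hDum
  have hswap : ∀ᵐ t ∂volume.restrict (Ioi (0 : ℝ)), ∀ᵐ x : EuclideanSpace ℝ (Fin n),
      ∀ᵐ r ∂volume.restrict (Ioo 0 t),
        ‖u (pointAt x t) - u (pointAt x r)‖ₑ ≤ verticalVariation Du x t := by
    have := (Measure.measurePreserving_swap (μ := volume.restrict (Ioi (0 : ℝ)))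
      (ν := (volume : Measure (EuclideanSpace ℝ (Fin n))))).quasiMeasurePreserving.ae h
    exact Measure.ae_ae_of_ae_prod this
  -- Since `u` is only controlled almost everywhere, the limit is taken along heights tending to `0`
  -- that are good for almost every `x` at once.
  have hex : ∀ k : ℕ, ∃ t ∈ Ioo (0 : ℝ) (1 / (k + 1 : ℝ)), ∀ᵐ x : EuclideanSpace ℝ (Fin n),
      ∀ᵐ r ∂volume.restrict (Ioo 0 t),
        ‖u (pointAt x t) - u (pointAt x r)‖ₑ ≤ verticalVariation Du x t := by
    intro k
    have hk : (0 : ℝ) < 1 / (k + 1 : ℝ) := by positivity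
    have : (ae (volume.restrict (Ioo 0 (1 / (k + 1 : ℝ))))).NeBot := by
      rw [ae_neBot, Ne, Measure.restrict_eq_zero, Real.volume_Ioo]
      simpa using hk
    have h1 := ae_restrict_of_ae_restrict_of_subset
      (Ioo_subset_Ioi_self : Ioo 0 (1 / (k + 1 : ℝ)) ⊆ Ioi 0) hswap
    obtain ⟨t, ht, ht'⟩ := (h1.and (ae_restrict_mem measurableSet_Ioo)).exists
    exact ⟨t, ht', ht⟩
  choose t ht hgood using hex
  have ht0 : Tendsto t atTop (𝓝[>] 0) := by
    refine tendsto_nhdsWithin_iff.2 ⟨?_, Eventually.of_forall fun k => (ht k).1⟩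
    exact tendsto_of_tendsto_of_tendsto_of_le_of_le tendsto_const_nhds
      tendsto_one_div_add_atTop_nhds_zero_nat (fun k => (ht k).1.le) (fun k => (ht k).2.le)
  have hlim : ∀ᵐ x : EuclideanSpace ℝ (Fin n), ∃ c,
      Tendsto (fun k => u (pointAt x (t k))) atTop (𝓝 c) ∧ ∀ τ, 0 < τ →
      (∀ᵐ r ∂volume.restrict (Ioo 0 τ),
        ‖u (pointAt x τ) - u (pointAt x r)‖ₑ ≤ verticalVariation Du x τ) →
        ‖u (pointAt x τ) - c‖ₑ ≤ verticalVariation Du x τ := by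
    filter_upwards [hfin, ae_all_iff.2 hgood] with x hx hxg
    exact exists_tendsto_of_ae_enorm_sub_le (f := fun τ => u (pointAt x τ))
      (fun k => (ht k).1) ((tendsto_verticalVariation hx).comp ht0) hxg
  obtain ⟨v, hvm, hv⟩ := measurable_limit_of_tendsto_metrizable_ae
    (f := fun k x => u (pointAt x (t k))) (L := atTop)
    (fun k => (hum.measurable.comp (continuous_pointAt.measurable.comp
      (by fun_prop : Measurable fun x : EuclideanSpace ℝ (Fin n) => (x, t k)))).aemeasurable)
    (hlim.mono fun x ⟨c, hc, _⟩ => ⟨c, hc⟩)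
  refine ⟨v, hvm, ?_⟩
  have hA : ∀ᵐ q ∂halfMeasure n, ∀ τ, 0 < τ →
      (∀ᵐ r ∂volume.restrict (Ioo 0 τ),
        ‖u (pointAt q.1 τ) - u (pointAt q.1 r)‖ₑ ≤ verticalVariation Du q.1 τ) →
        ‖u (pointAt q.1 τ) - v q.1‖ₑ ≤ verticalVariation Du q.1 τ := by
    refine (Measure.quasiMeasurePreserving_fst (μ := (volume : Measure (EuclideanSpace ℝ (Fin n))))
      (ν := volume.restrict (Ioi (0 : ℝ)))).ae (p := fun x => ∀ τ, 0 < τ →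
      (∀ᵐ r ∂volume.restrict (Ioo 0 τ),
        ‖u (pointAt x τ) - u (pointAt x r)‖ₑ ≤ verticalVariation Du x τ) →
        ‖u (pointAt x τ) - v x‖ₑ ≤ verticalVariation Du x τ) ?_
    filter_upwards [hlim, hv] with x ⟨c, hc, hcl⟩ hx
    rwa [tendsto_nhds_unique hx hc]
  filter_upwards [hA, h, ae_halfMeasure_pos] with q hq1 hq2 hq0
  exact hq1 q.2 hq0 hq2

end vertical

/-! ### Existence of the trace -/

section trace
variable {n : ℕ} {u : EuclideanSpace ℝ (Fin (n + 1)) → ℝ}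
  {Du : EuclideanSpace ℝ (Fin (n + 1)) → EuclideanSpace ℝ (Fin (n + 1))}

/-- If `d` exceeds `W ^ (1 / (p - 1))`, then `W ≤ d ^ (p - 1)` and the first term alone is at least
`d`. Taking for `W` the weight of the energy bounds `‖Du‖` by the energy density plus a power of the
height. -/
theorem le_rpow_div_add_rpow {d W p : ℝ} (hd : 0 ≤ d) (hW : 0 < W) (hp : 1 < p) :
    d ≤ d ^ p / W + W ^ (1 / (p - 1)) := by
  have hp' : 0 < p - 1 := by linarith
  rcases le_or_gt d (W ^ (1 / (p - 1))) with h | h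
  · have : 0 ≤ d ^ p / W := by positivity
    linarith
  · have hd0 : 0 < d := lt_of_le_of_lt (by positivity) h
    have h1 : W ≤ d ^ (p - 1) := by
      have := Real.rpow_le_rpow (by positivity) h.le hp'.le
      rwa [← Real.rpow_mul hW.le, one_div_mul_cancel hp'.ne', Real.rpow_one] at this
    have h2 : d ≤ d ^ p / W := by
      rw [le_div_iff₀ hW]
      calc d * W ≤ d * d ^ (p - 1) := by gcongr
        _ = d ^ p := by rw [Real.rpow_sub_one hd0.ne', mul_div_cancel₀ _ hd0.ne']
    have : 0 ≤ W ^ (1 / (p - 1)) := by positivity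
    linarith

theorem lintegral_ball_verticalVariation_lt_top {s p : ℝ} (hs : 0 < s) (hp : 1 < p)
    (hDum : StronglyMeasurable Du) (hE : weightedEnergy s p Du < ⊤) (R : ℝ) :
    ∫⁻ x in Metric.ball (0 : EuclideanSpace ℝ (Fin n)) R, verticalVariation Du x 1 < ⊤ := by
  have hp' : 0 < p - 1 := by linarith
  have hmD : Measurable fun q : EuclideanSpace ℝ (Fin n) × ℝ => ‖Du (pointAt q.1 q.2)‖ :=
    (hDum.comp_measurable continuous_pointAt.measurable).norm.measurable
  have hm1 : Measurable fun q : EuclideanSpace ℝ (Fin n) × ℝ =>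
      ENNReal.ofReal (‖Du (pointAt q.1 q.2)‖ ^ p / q.2 ^ (1 - (1 - s) * p)) :=
    ((hmD.pow_const p).div (measurable_snd.pow_const _)).ennreal_ofReal
  have hE' : ∫⁻ x : EuclideanSpace ℝ (Fin n), ∫⁻ t in Ioi (0 : ℝ),
      ENNReal.ofReal (‖Du (pointAt x t)‖ ^ p / t ^ (1 - (1 - s) * p)) < ⊤ := by
    rw [weightedEnergy, lintegral_upperHalf_eq, halfMeasure] at hE
    simp only [pointAt_last] at hE
    rwa [lintegral_prod _ hm1.aemeasurable] at hE
  -- Equal to `-1 + s p / (p - 1)`, so `t ^ a` is integrable at `0` exactly because `s > 0`.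
  set a : ℝ := (1 - (1 - s) * p) * (1 / (p - 1)) with ha
  have ha1 : -1 < a := by
    have : a = -1 + s * p / (p - 1) := by
      rw [ha]
      field_simp
      ring
    have : 0 < s * p / (p - 1) := by positivity
    linarith
  have hI : ∫⁻ t in Ioc (0 : ℝ) 1, ENNReal.ofReal (t ^ a) < ⊤ := by
    have := (intervalIntegral.intervalIntegrable_rpow' (a := 0) (b := 1) ha1)
    rw [intervalIntegrable_iff_integrableOn_Ioc_of_le zero_le_one] at this
    exact this.lintegral_lt_top
  calc ∫⁻ x in Metric.ball (0 : EuclideanSpace ℝ (Fin n)) R, verticalVariation Du x 1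
      ≤ ∫⁻ x in Metric.ball (0 : EuclideanSpace ℝ (Fin n)) R,
        ((∫⁻ t in Ioi (0 : ℝ),
          ENNReal.ofReal (‖Du (pointAt x t)‖ ^ p / t ^ (1 - (1 - s) * p))) +
          ∫⁻ t in Ioc (0 : ℝ) 1, ENNReal.ofReal (t ^ a)) := by
        refine lintegral_mono fun x => ?_
        calc verticalVariation Du x 1 ≤ ∫⁻ t in Ioc (0 : ℝ) 1,
              (ENNReal.ofReal (‖Du (pointAt x t)‖ ^ p / t ^ (1 - (1 - s) * p)) +
                ENNReal.ofReal (t ^ a)) := by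
              refine setLIntegral_mono' measurableSet_Ioc fun t ht => ?_
              have ht0 : 0 < t := ht.1
              rw [← ofReal_norm, ← ENNReal.ofReal_add (by positivity) (by positivity), ha,
                Real.rpow_mul ht0.le]
              exact ENNReal.ofReal_le_ofReal
                (le_rpow_div_add_rpow (norm_nonneg _) (by positivity) hp)
          _ = (∫⁻ t in Ioc (0 : ℝ) 1,
              ENNReal.ofReal (‖Du (pointAt x t)‖ ^ p / t ^ (1 - (1 - s) * p))) +
                ∫⁻ t in Ioc (0 : ℝ) 1, ENNReal.ofReal (t ^ a) :=
              lintegral_add_left (hm1.comp measurable_prodMk_left) _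
          _ ≤ _ := by
              gcongr
              exact Ioc_subset_Ioi_self
    _ = (∫⁻ x in Metric.ball (0 : EuclideanSpace ℝ (Fin n)) R, ∫⁻ t in Ioi (0 : ℝ),
          ENNReal.ofReal (‖Du (pointAt x t)‖ ^ p / t ^ (1 - (1 - s) * p))) +
          (∫⁻ t in Ioc (0 : ℝ) 1, ENNReal.ofReal (t ^ a)) *
            volume (Metric.ball (0 : EuclideanSpace ℝ (Fin n)) R) := by
        rw [lintegral_add_left hm1.lintegral_prod_right', setLIntegral_const]
    _ < ⊤ := by
        refine ENNReal.add_lt_top.2 ⟨?_, ?_⟩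
        · exact lt_of_le_of_lt (setLIntegral_le_lintegral _ _) hE'
        · exact ENNReal.mul_lt_top hI measure_ball_lt_top

theorem IsWeakGradient.exists_isTrace {s p : ℝ} (hs : 0 < s) (hp : 1 < p)
    (hu : IsWeakGradient u Du) (hum : StronglyMeasurable u) (hDum : StronglyMeasurable Du)
    (hE : weightedEnergy s p Du < ⊤) : ∃ v : EuclideanSpace ℝ (Fin n) → ℝ, IsTrace u v := by
  have hG := lintegral_ball_verticalVariation_lt_top hs hp hDum hE
  have mG := measurable_verticalVariation hDum
  have mGt : ∀ t, Measurable fun x : EuclideanSpace ℝ (Fin n) => verticalVariation Du x t :=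
    fun t => mG.comp measurable_prodMk_right
  have hfinR : ∀ R : ℝ, ∀ᵐ x ∂volume.restrict (Metric.ball (0 : EuclideanSpace ℝ (Fin n)) R),
      verticalVariation Du x 1 ≠ ⊤ := fun R =>
    (ae_lt_top (mGt 1) (hG R).ne).mono fun x hx => hx.ne
  have hfin : ∀ᵐ x : EuclideanSpace ℝ (Fin n), verticalVariation Du x 1 ≠ ⊤ := by
    have := ae_all_iff.2 fun k : ℕ => (ae_restrict_iff' measurableSet_ball).1 (hfinR k)
    filter_upwards [this] with x hx
    obtain ⟨k, hk⟩ := exists_nat_gt ‖x‖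
    exact hx k (by simpa using hk)
  obtain ⟨v, hvm, hv⟩ := hu.exists_vertical_limit hum hDum hfin
  have hswap : ∀ᵐ t ∂volume.restrict (Ioi (0 : ℝ)), ∀ᵐ x : EuclideanSpace ℝ (Fin n),
      ‖u (pointAt x t) - v x‖ₑ ≤ verticalVariation Du x t := by
    have := (Measure.measurePreserving_swap (μ := volume.restrict (Ioi (0 : ℝ)))
      (ν := (volume : Measure (EuclideanSpace ℝ (Fin n))))).quasiMeasurePreserving.ae hv
    exact Measure.ae_ae_of_ae_prod this
  refine ⟨v, ?_, fun R _ => ?_⟩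
  -- `|v x|` is at most `|u (x, t)|` plus the vertical variation. Integrating over heights `1/2 < t
  -- < 1`, away from the boundary, uses the local integrability of `u`.
  · have key : ∀ R : ℝ, IntegrableOn v (Metric.ball 0 R) := by
      intro R
      refine ⟨hvm.aestronglyMeasurable, ?_⟩
      set B := Metric.ball (0 : EuclideanSpace ℝ (Fin n)) R with hB
      set K := (fun q : EuclideanSpace ℝ (Fin n) × ℝ => pointAt q.1 q.2) ''
        (Metric.closedBall 0 R ×ˢ Icc (1 / 2) 1) with hK
      have hKc : IsCompact K :=
        ((isCompact_closedBall _ _).prod isCompact_Icc).image continuous_pointAt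
      have hKH : K ⊆ upperHalf n := by
        rintro _ ⟨q, hq, rfl⟩
        exact pointAt_mem_upperHalf.2 (lt_of_lt_of_le (by norm_num) hq.2.1)
      have hui : ∫⁻ z in K, ‖u z‖ₑ < ⊤ :=
        (hu.locallyIntegrable.integrableOn_compact_subset hKH hKc).2
      rw [hK, ← measurePreserving_pointAt.setLIntegral_comp_emb measurableEmbedding_pointAt,
        Measure.volume_eq_prod, ← Measure.prod_restrict] at hui
      have hsub : Ioo (1 / 2 : ℝ) 1 ⊆ Ioi 0 := fun t ht => lt_trans (by norm_num) ht.1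
      have hae : ∀ᵐ t ∂volume.restrict (Ioo (1 / 2 : ℝ) 1),
          ∫⁻ x in B, ‖v x‖ₑ ≤ (∫⁻ x in Metric.closedBall 0 R, ‖u (pointAt x t)‖ₑ) +
            ∫⁻ x in B, verticalVariation Du x 1 := by
        filter_upwards [ae_restrict_of_ae_restrict_of_subset hsub hswap,
          ae_restrict_mem measurableSet_Ioo] with t ht htI
        calc ∫⁻ x in B, ‖v x‖ₑ
            ≤ ∫⁻ x in B, (‖u (pointAt x t)‖ₑ + verticalVariation Du x 1) := by
              refine lintegral_mono_ae (ae_restrict_of_ae ?_)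
              filter_upwards [ht] with x hx
              have e : v x = u (pointAt x t) - (u (pointAt x t) - v x) := by ring
              rw [e]
              exact enorm_sub_le.trans (add_le_add_right
                (hx.trans (verticalVariation_mono htI.2.le)) _)
          _ = (∫⁻ x in B, ‖u (pointAt x t)‖ₑ) + ∫⁻ x in B, verticalVariation Du x 1 :=
              lintegral_add_right _ (mGt 1)
          _ ≤ _ := by
              gcongr
              exact Metric.ball_subset_closedBall
      have h2 := lintegral_mono_ae hae
      rw [lintegral_const, lintegral_add_right _ measurable_const, lintegral_const] at h2
      have h3 : ∫⁻ t in Ioo (1 / 2 : ℝ) 1, ∫⁻ x in Metric.closedBall 0 R,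
          ‖u (pointAt x t)‖ₑ < ⊤ := by
        refine lt_of_le_of_lt ?_ hui
        rw [lintegral_prod_symm' (fun q => ‖u (pointAt q.1 q.2)‖ₑ)
          (hum.comp_measurable continuous_pointAt.measurable).enorm]
        exact lintegral_mono_set Ioo_subset_Icc_self
      have h4 : (volume.restrict (Ioo (1 / 2 : ℝ) 1)) univ ≠ 0 := by
        simp
        norm_num
      have h5 : (∫⁻ x in B, ‖v x‖ₑ) * (volume.restrict (Ioo (1 / 2 : ℝ) 1)) univ < ⊤ := by
        refine lt_of_le_of_lt h2 (ENNReal.add_lt_top.2 ⟨h3, ENNReal.mul_lt_top (hG R) ?_⟩)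
        simp
      exact ENNReal.lt_top_of_mul_ne_top_left h5.ne h4
    intro x
    exact ⟨Metric.ball 0 (‖x‖ + 1), Metric.isOpen_ball.mem_nhds (by simp), key _⟩
  · set B := Metric.ball (0 : EuclideanSpace ℝ (Fin n)) R with hB
    -- Dominated by the variation up to height `1`; this bounds the mean in the definition of the
    -- trace.
    have hlim : Tendsto (fun ε => ∫⁻ x in B, verticalVariation Du x ε) (𝓝[>] 0) (𝓝 0) := by
      have h0 := tendsto_lintegral_filter_of_dominated_convergence (μ := volume.restrict B)
        (l := 𝓝[>] (0 : ℝ)) (F := fun ε x => verticalVariation Du x ε) (f := fun _ => 0)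
        (fun x => verticalVariation Du x 1) (Eventually.of_forall mGt) ?_ (hG R).ne ?_
      · simpa using h0
      · filter_upwards [Ioo_mem_nhdsGT (one_pos : (0 : ℝ) < 1)] with ε hε
        exact Eventually.of_forall fun x => verticalVariation_mono hε.2.le
      · filter_upwards [hfinR R] with x hx
        exact tendsto_verticalVariation hx
    refine tendsto_of_tendsto_of_tendsto_of_le_of_le' tendsto_const_nhds hlim
      (Eventually.of_forall fun _ => zero_le) ?_
    filter_upwards [self_mem_nhdsWithin] with ε hε
    have hε0 : (0 : ℝ) < ε := hε
    have h1 : ∫⁻ t in Ioo 0 ε, ∫⁻ x in B, ENNReal.ofReal |u (pointAt x t) - v x| ≤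
        ∫⁻ t in Ioo 0 ε, ∫⁻ x in B, verticalVariation Du x ε := by
      refine lintegral_mono_ae ?_
      filter_upwards [ae_restrict_of_ae_restrict_of_subset (Ioo_subset_Ioi_self) hswap,
        ae_restrict_mem measurableSet_Ioo] with t ht htI
      refine lintegral_mono_ae (ae_restrict_of_ae ?_)
      filter_upwards [ht] with x hx
      rw [← Real.norm_eq_abs, ofReal_norm]
      exact hx.trans (verticalVariation_mono htI.2.le)
    refine (mul_le_mul_right h1 _).trans (le_of_eq ?_)
    rw [lintegral_const, Measure.restrict_apply_univ, Real.volume_Ioo, sub_zero, mul_comm,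
      mul_assoc, ENNReal.mul_inv_cancel (by simpa using hε0) ENNReal.ofReal_ne_top, mul_one]

end trace

theorem setLIntegral_Ioo_comp_mul_right (f : ℝ → ℝ≥0∞) {b : ℝ} (hb : 0 < b) (M : ℝ) :
    ∫⁻ t in Ioo (0 : ℝ) M, f (t * b) =
      ENNReal.ofReal b⁻¹ * ∫⁻ t in Ioo (0 : ℝ) (M * b), f t := by
  have h := setLIntegral_Ioi_comp_mul_right ((Ioo 0 (M * b)).indicator f) hb
  rw [setLIntegral_indicator measurableSet_Ioo, inter_eq_left.2 Ioo_subset_Ioi_self] at h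
  rw [← h, ← lintegral_indicator measurableSet_Ioo, ← lintegral_indicator measurableSet_Ioi]
  refine lintegral_congr fun t => ?_
  have h1 : t < M ↔ t * b < M * b := (mul_lt_mul_iff_left₀ hb).symm
  by_cases ht : 0 < t
  · have ht' : 0 < t * b := mul_pos ht hb
    by_cases hM : t < M
    · rw [indicator_of_mem (show t ∈ Ioo 0 M from ⟨ht, hM⟩), indicator_of_mem (mem_Ioi.2 ht),
        indicator_of_mem (show t * b ∈ Ioo 0 (M * b) from ⟨ht', h1.1 hM⟩)]
    · rw [indicator_of_notMem (fun h => hM h.2), indicator_of_mem (mem_Ioi.2 ht),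
        indicator_of_notMem (fun h => hM (h1.2 h.2))]
  · rw [indicator_of_notMem (fun h => ht h.1),
      indicator_of_notMem (show t ∉ Ioi 0 from ht)]

theorem lintegral_rpow_le_measure_univ_mul {α : Type*} [MeasurableSpace α] {ν : Measure α}
    {F : α → ℝ≥0∞} (hF : AEMeasurable F ν) {p : ℝ} (hp : 1 < p) :
    (∫⁻ r, F r ∂ν) ^ p ≤ ν univ ^ (p - 1) * ∫⁻ r, F r ^ p ∂ν := by
  have hpq := Real.HolderConjugate.conjExponent hp
  have h := ENNReal.lintegral_mul_le_Lp_mul_Lq ν hpq hF (aemeasurable_const (b := (1 : ℝ≥0∞)))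
  simp only [Pi.mul_apply, mul_one, ENNReal.one_rpow, lintegral_const, one_mul] at h
  have h2 := ENNReal.rpow_le_rpow h hpq.nonneg
  rw [ENNReal.mul_rpow_of_nonneg _ _ hpq.nonneg, ← ENNReal.rpow_mul, ← ENNReal.rpow_mul,
    one_div_mul_cancel hpq.pos.ne', ENNReal.rpow_one] at h2
  have e : 1 / Real.conjExponent p * p = p - 1 := by
    have : p - 1 ≠ 0 := by linarith
    rw [Real.conjExponent]
    field_simp
  rwa [e, mul_comm] at h2

/-- Hölder against the constant `1` for the measure of density `m`. -/
theorem lintegral_mul_rpow_le {α : Type*} [MeasurableSpace α] {μ : Measure α}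
    {m F : α → ℝ≥0∞} (hm : Measurable m) (hF : Measurable F) {p : ℝ} (hp : 1 < p) :
    (∫⁻ r, m r * F r ∂μ) ^ p ≤ (∫⁻ r, m r ∂μ) ^ (p - 1) * ∫⁻ r, m r * F r ^ p ∂μ := by
  have h := lintegral_rpow_le_measure_univ_mul (ν := μ.withDensity m) hF.aemeasurable hp
  rwa [lintegral_withDensity_eq_lintegral_mul _ hm hF,
    lintegral_withDensity_eq_lintegral_mul _ hm (hF.pow_const p),
    withDensity_apply _ MeasurableSet.univ, Measure.restrict_univ] at h

/-! ### Curves starting on the boundary -/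

section boundary
variable {n : ℕ} {u : EuclideanSpace ℝ (Fin (n + 1)) → ℝ}
  {Du : EuclideanSpace ℝ (Fin (n + 1)) → EuclideanSpace ℝ (Fin (n + 1))}
  {v : EuclideanSpace ℝ (Fin n) → ℝ}

/-- The trace is attained along vertical lines, whereas the points here lie on oblique rays.
Shifting the horizontal variable by `t • a k` turns the obliqueness into a small translation of `v`,
which is harmless in `L¹`. -/
theorem IsTrace.tendsto_lintegral_ray (hv : IsTrace u v) (hum : StronglyMeasurable u)
    (hvm : Measurable v) {M : ℝ} (hM : 0 < M) {a : ℕ → EuclideanSpace ℝ (Fin n)} {b : ℕ → ℝ}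
    (ha : Tendsto a atTop (𝓝 0)) (hb0 : ∀ k, 0 < b k) (hb : Tendsto b atTop (𝓝 0)) :
    Tendsto (fun k => ∫⁻ t in Ioo 0 M, ∫⁻ x in Metric.ball (0 : EuclideanSpace ℝ (Fin n)) M,
      ‖u (pointAt (x + t • a k) (t * b k)) - v x‖ₑ) atTop (𝓝 0) := by
  -- Radii: points start in the ball of radius `M`, a shift of length below `M` puts them in `2 M`,
  -- and the translates of points of `2 M` stay in `3 M`.
  set w := (Metric.ball (0 : EuclideanSpace ℝ (Fin n)) (3 * M)).indicator v with hw
  have hwm : Measurable w := hvm.indicator measurableSet_ball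
  have hwi : Integrable w := by
    rw [hw, integrable_indicator_iff measurableSet_ball]
    exact (hv.locallyIntegrable.integrableOn_isCompact (isCompact_closedBall _ _)).mono_set
      Metric.ball_subset_closedBall
  have mU : Measurable fun q : EuclideanSpace ℝ (Fin n) × ℝ => ‖u (pointAt q.1 q.2) - v q.1‖ₑ :=
    ((hum.measurable.comp continuous_pointAt.measurable).sub (hvm.comp measurable_fst)).enorm
  set F₁ : ℕ → ℝ≥0∞ := fun k => ENNReal.ofReal M * ((ENNReal.ofReal (M * b k))⁻¹ *
    ∫⁻ t in Ioo 0 (M * b k), ∫⁻ x in Metric.ball (0 : EuclideanSpace ℝ (Fin n)) (2 * M),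
      ENNReal.ofReal |u (pointAt x t) - v x|) with hF₁
  set F₂ : ℕ → ℝ≥0∞ := fun k => ∫⁻ t in Ioo 0 M, ∫⁻ x, ‖w (x - t • a k) - w x‖ₑ with hF₂
  have lim₁ : Tendsto F₁ atTop (𝓝 0) := by
    have h1 : Tendsto (fun k => M * b k) atTop (𝓝[>] 0) := by
      refine tendsto_nhdsWithin_iff.2 ⟨?_, Eventually.of_forall fun k => mul_pos hM (hb0 k)⟩
      simpa using hb.const_mul M
    have h2 := ENNReal.Tendsto.const_mul (a := ENNReal.ofReal M)
      ((hv.tendsto_mean (2 * M) (by positivity)).comp h1) (Or.inr ENNReal.ofReal_ne_top)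
    simpa using h2
  have lim₂ : Tendsto F₂ atTop (𝓝 0) := by
    rw [ENNReal.tendsto_nhds_zero]
    intro ε hε
    have hMne : ENNReal.ofReal M ≠ 0 := by simpa using hM
    obtain ⟨δ, hδ, h⟩ := exists_lintegral_translate_sub_le hwi
      (ENNReal.div_pos hε.ne' (ENNReal.ofReal_ne_top (r := M))).ne'
    have h1 : ∀ᶠ k in atTop, M * ‖a k‖ < δ := by
      have : Tendsto (fun k => M * ‖a k‖) atTop (𝓝 0) := by
        simpa using ha.norm.const_mul M
      exact this.eventually (gt_mem_nhds hδ)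
    filter_upwards [h1] with k hk
    calc F₂ k ≤ ∫⁻ _ in Ioo 0 M, ε / ENNReal.ofReal M := by
          refine setLIntegral_mono' measurableSet_Ioo fun t ht => h _ (lt_of_le_of_lt ?_ hk)
          rw [norm_smul, Real.norm_of_nonneg ht.1.le]
          exact mul_le_mul_of_nonneg_right ht.2.le (norm_nonneg _)
      _ ≤ ε := by
          rw [setLIntegral_const, Real.volume_Ioo, sub_zero]
          exact ENNReal.div_mul_cancel hMne ENNReal.ofReal_ne_top |>.le
  have lim := lim₁.add lim₂
  rw [add_zero] at lim
  refine tendsto_of_tendsto_of_tendsto_of_le_of_le' tendsto_const_nhds lim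
    (Eventually.of_forall fun _ => zero_le) ?_
  have hsmall : ∀ᶠ k in atTop, ‖a k‖ < 1 := by
    have := ha.norm
    rw [norm_zero] at this
    exact this.eventually (gt_mem_nhds one_pos)
  filter_upwards [hsmall] with k hk
  have step : ∀ t ∈ Ioo 0 M, ∫⁻ x in Metric.ball (0 : EuclideanSpace ℝ (Fin n)) M,
      ‖u (pointAt (x + t • a k) (t * b k)) - v x‖ₑ ≤
      (∫⁻ x in Metric.ball (0 : EuclideanSpace ℝ (Fin n)) (2 * M),
        ‖u (pointAt x (t * b k)) - v x‖ₑ) + ∫⁻ x, ‖w (x - t • a k) - w x‖ₑ := by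
    intro t ht
    have hsh : ‖t • a k‖ < M := by
      rw [norm_smul, Real.norm_of_nonneg ht.1.le]
      nlinarith [ht.1, ht.2, norm_nonneg (a k)]
    calc _ ≤ ∫⁻ x, (Metric.ball (0 : EuclideanSpace ℝ (Fin n)) (2 * M)).indicator
          (fun y => ‖u (pointAt y (t * b k)) - v (y - t • a k)‖ₑ) (x + t • a k) := by
          rw [← lintegral_indicator measurableSet_ball]
          refine lintegral_mono fun x => ?_
          by_cases hx : x ∈ Metric.ball (0 : EuclideanSpace ℝ (Fin n)) M
          · rw [indicator_of_mem hx, indicator_of_mem, add_sub_cancel_right]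
            rw [mem_ball_zero_iff] at hx ⊢
            exact (norm_add_le _ _).trans_lt (by linarith)
          · rw [indicator_of_notMem hx]
            exact zero_le
      _ = ∫⁻ y in Metric.ball (0 : EuclideanSpace ℝ (Fin n)) (2 * M),
          ‖u (pointAt y (t * b k)) - v (y - t • a k)‖ₑ := by
          rw [lintegral_add_right_eq_self (fun x => (Metric.ball
            (0 : EuclideanSpace ℝ (Fin n)) (2 * M)).indicator
            (fun y => ‖u (pointAt y (t * b k)) - v (y - t • a k)‖ₑ) x),
            lintegral_indicator measurableSet_ball]
      _ ≤ ∫⁻ y in Metric.ball (0 : EuclideanSpace ℝ (Fin n)) (2 * M),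
          (‖u (pointAt y (t * b k)) - v y‖ₑ + ‖w (y - t • a k) - w y‖ₑ) := by
          refine setLIntegral_mono' measurableSet_ball fun y hy => ?_
          rw [mem_ball_zero_iff] at hy
          rw [hw, indicator_of_mem, indicator_of_mem]
          · have e : u (pointAt y (t * b k)) - v (y - t • a k) =
                (u (pointAt y (t * b k)) - v y) - (v (y - t • a k) - v y) := by ring
            rw [e]
            exact enorm_sub_le
          · rw [mem_ball_zero_iff]
            linarith
          · rw [mem_ball_zero_iff]
            exact (norm_sub_le _ _).trans_lt (by linarith)
      _ = (∫⁻ x in Metric.ball (0 : EuclideanSpace ℝ (Fin n)) (2 * M),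
          ‖u (pointAt x (t * b k)) - v x‖ₑ) + ∫⁻ x in Metric.ball
            (0 : EuclideanSpace ℝ (Fin n)) (2 * M), ‖w (x - t • a k) - w x‖ₑ :=
          lintegral_add_left (mU.comp measurable_prodMk_right) _
      _ ≤ _ := by
          gcongr
          exact Measure.restrict_le_self
  calc _ ≤ ∫⁻ t in Ioo 0 M, ((∫⁻ x in Metric.ball (0 : EuclideanSpace ℝ (Fin n)) (2 * M),
        ‖u (pointAt x (t * b k)) - v x‖ₑ) + ∫⁻ x, ‖w (x - t • a k) - w x‖ₑ) :=
        setLIntegral_mono' measurableSet_Ioo step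
    _ = (∫⁻ t in Ioo 0 M, ∫⁻ x in Metric.ball (0 : EuclideanSpace ℝ (Fin n)) (2 * M),
        ‖u (pointAt x (t * b k)) - v x‖ₑ) + F₂ k := by
        refine lintegral_add_right _ ?_
        refine Measurable.lintegral_prod_right' (f := fun y : ℝ × EuclideanSpace ℝ (Fin n) =>
          ‖w (y.2 - y.1 • a k) - w y.2‖ₑ) ?_
        exact ((hwm.comp (by fun_prop)).sub (hwm.comp measurable_snd)).enorm
    _ ≤ F₁ k + F₂ k := by
        gcongr
        rw [setLIntegral_Ioo_comp_mul_right (fun τ =>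
          ∫⁻ x in Metric.ball (0 : EuclideanSpace ℝ (Fin n)) (2 * M),
            ‖u (pointAt x τ) - v x‖ₑ) (hb0 k), hF₁]
        simp only
        rw [← mul_assoc, ENNReal.ofReal_mul hM.le, ENNReal.mul_inv (Or.inr ENNReal.ofReal_ne_top)
          (Or.inl ENNReal.ofReal_ne_top), ← mul_assoc, ENNReal.mul_inv_cancel
          (by simpa using hM) ENNReal.ofReal_ne_top, one_mul, ENNReal.ofReal_inv_of_pos (hb0 k)]
        simp only [← Real.norm_eq_abs, ofReal_norm]
        exact le_rfl

/-- The curve estimate is applied from `Γ (r k)` to `Γ R` with `r k → 0`. The remaining differences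
at the starting points tend to `0` in `L¹` on boxes, and the excess `A - B` does not depend on `k`.
-/
theorem IsTrace.ae_enorm_sub_le (hv : IsTrace u v) (hu : IsWeakGradient u Du)
    (hum : StronglyMeasurable u) (hDum : StronglyMeasurable Du) (hvm : Measurable v)
    {Γ Γ' : ℝ → EuclideanSpace ℝ (Fin (n + 1))} (hΓ : ∀ r, HasDerivAt Γ (Γ' r) r)
    (hΓ' : Continuous Γ') (hΓ0 : Γ 0 = 0) {R : ℝ} (hR : 0 < R)
    (hpos : ∀ r ∈ Ioc 0 R, 0 < Γ r (Fin.last n)) :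
    ∀ᵐ q ∂halfMeasure n,
      ‖u (pointAt q.1 0 + q.2 • Γ R) - v q.1‖ₑ ≤
        ∫⁻ r in Ioc 0 R, ‖Du (pointAt q.1 0 + q.2 • Γ r)‖ₑ * ENNReal.ofReal (q.2 * ‖Γ' r‖) := by
  have hΓc : Continuous Γ := continuous_iff_continuousAt.2 fun r => (hΓ r).continuousAt
  have hP : Continuous fun y : (EuclideanSpace ℝ (Fin n) × ℝ) × ℝ =>
      pointAt y.1.1 0 + y.1.2 • Γ y.2 := by
    have : Continuous fun y : (EuclideanSpace ℝ (Fin n) × ℝ) × ℝ => pointAt y.1.1 0 :=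
      continuous_pointAt.comp (by fun_prop : Continuous fun y :
        (EuclideanSpace ℝ (Fin n) × ℝ) × ℝ => (y.1.1, (0 : ℝ)))
    fun_prop
  have hPr : ∀ r, Continuous fun q : EuclideanSpace ℝ (Fin n) × ℝ =>
      pointAt q.1 0 + q.2 • Γ r := fun r =>
    hP.comp (by fun_prop : Continuous fun q : EuclideanSpace ℝ (Fin n) × ℝ => (q, r))
  set A : EuclideanSpace ℝ (Fin n) × ℝ → ℝ≥0∞ := fun q =>
    ‖u (pointAt q.1 0 + q.2 • Γ R) - v q.1‖ₑ with hA
  set B : EuclideanSpace ℝ (Fin n) × ℝ → ℝ≥0∞ := fun q =>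
    ∫⁻ r in Ioc 0 R, ‖Du (pointAt q.1 0 + q.2 • Γ r)‖ₑ * ENNReal.ofReal (q.2 * ‖Γ' r‖) with hB
  have mA : Measurable A :=
    ((hum.measurable.comp (hPr R).measurable).sub (hvm.comp measurable_fst)).enorm
  have mB : Measurable B := by
    have m1 : Measurable fun y : (EuclideanSpace ℝ (Fin n) × ℝ) × ℝ =>
        ENNReal.ofReal (y.1.2 * ‖Γ' y.2‖) := by
      refine ENNReal.measurable_ofReal.comp (Continuous.measurable ?_)
      fun_prop
    have m2 : Measurable fun y : (EuclideanSpace ℝ (Fin n) × ℝ) × ℝ =>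
        ‖Du (pointAt y.1.1 0 + y.1.2 • Γ y.2)‖ₑ := (hDum.comp_measurable hP.measurable).enorm
    exact (m2.mul m1).lintegral_prod_right'
  set r : ℕ → ℝ := fun k => R * (1 / ((k : ℝ) + 1)) with hr
  have hrpos : ∀ k, 0 < r k := fun k => by positivity
  have hrle : ∀ k, r k ≤ R := fun k => by
    have : 1 / ((k : ℝ) + 1) ≤ 1 := by
      rw [div_le_one (by positivity)]
      linarith [k.cast_nonneg (α := ℝ)]
    exact mul_le_of_le_one_right hR.le this
  have hr0 : Tendsto r atTop (𝓝 0) := by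
    have := (tendsto_one_div_add_atTop_nhds_zero_nat (𝕜 := ℝ)).const_mul R
    rwa [mul_zero] at this
  have hγ0 : Tendsto (fun k => Γ (r k)) atTop (𝓝 0) := by
    have := (hΓc.tendsto 0).comp hr0
    rwa [hΓ0] at this
  choose a ha using fun k => exists_pointAt (Γ (r k))
  set b : ℕ → ℝ := fun k => Γ (r k) (Fin.last n) with hb
  have hb0 : ∀ k, 0 < b k := fun k => hpos _ ⟨hrpos k, hrle k⟩
  have hblim : Tendsto b atTop (𝓝 0) := by
    have hc : Continuous fun z : EuclideanSpace ℝ (Fin (n + 1)) => z (Fin.last n) := by fun_prop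
    exact (hc.tendsto 0).comp hγ0
  have halim : Tendsto a atTop (𝓝 0) := by
    refine squeeze_zero_norm (fun k => ?_) (by simpa using hγ0.norm)
    have := norm_pointAt_sq (a k) (b k)
    rw [← ha k] at this
    exact abs_le_of_sq_le_sq' (by nlinarith [sq_nonneg (b k)]) (norm_nonneg _) |>.2
  have hray : ∀ k, ∀ᵐ q ∂halfMeasure n,
      A q ≤ B q + ‖u (pointAt (q.1 + q.2 • a k) (q.2 * b k)) - v q.1‖ₑ := by
    intro k
    filter_upwards [hu.ae_enorm_sub_le hum hDum hΓ hΓ' (hrle k)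
      (fun r' hr' => hpos r' ⟨(hrpos k).trans_le hr'.1, hr'.2⟩)] with q hq
    have h1 : pointAt q.1 0 + q.2 • Γ (r k) = pointAt (q.1 + q.2 • a k) (q.2 * b k) := by
      rw [← pointAt_zero_add_smul, ← ha k]
    rw [← h1]
    have e : u (pointAt q.1 0 + q.2 • Γ R) - v q.1 = (u (pointAt q.1 0 + q.2 • Γ R) -
      u (pointAt q.1 0 + q.2 • Γ (r k))) + (u (pointAt q.1 0 + q.2 • Γ (r k)) - v q.1) := by ring
    simp only [hA]
    rw [e]
    refine (enorm_add_le _ _).trans (add_le_add_left (hq.trans ?_) _)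
    exact lintegral_mono_set (Ioc_subset_Ioc_left (hrpos k).le)
  have box : ∀ m : ℕ, ∀ᵐ q ∂halfMeasure n,
      q ∈ Metric.ball (0 : EuclideanSpace ℝ (Fin n)) (m + 1) ×ˢ Ioo (0 : ℝ) (m + 1) →
        A q ≤ B q := by
    intro m
    set Z := Metric.ball (0 : EuclideanSpace ℝ (Fin n)) (m + 1) ×ˢ Ioo (0 : ℝ) (m + 1) with hZ
    have hZm : MeasurableSet Z := measurableSet_ball.prod measurableSet_Ioo
    have hμ : (halfMeasure n).restrict Z =
        (volume.restrict (Metric.ball (0 : EuclideanSpace ℝ (Fin n)) (m + 1))).prod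
          (volume.restrict (Ioo (0 : ℝ) (m + 1))) := by
      rw [halfMeasure, hZ, ← Measure.prod_restrict, Measure.restrict_restrict measurableSet_Ioo,
        inter_eq_left.2 Ioo_subset_Ioi_self]
    have hzero : ∫⁻ q in Z, (A q - B q) ∂halfMeasure n = 0 := by
      refine le_antisymm (ge_of_tendsto' (hv.tendsto_lintegral_ray hum hvm
        (by positivity : (0 : ℝ) < m + 1) halim hb0 hblim) fun k => ?_) zero_le
      have mk : Measurable fun q : EuclideanSpace ℝ (Fin n) × ℝ =>
          ‖u (pointAt (q.1 + q.2 • a k) (q.2 * b k)) - v q.1‖ₑ :=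
        ((hum.measurable.comp (continuous_pointAt.measurable.comp (by fun_prop :
          Measurable fun q : EuclideanSpace ℝ (Fin n) × ℝ =>
            (q.1 + q.2 • a k, q.2 * b k)))).sub (hvm.comp measurable_fst)).enorm
      rw [← lintegral_prod_symm' (fun q : EuclideanSpace ℝ (Fin n) × ℝ =>
          ‖u (pointAt (q.1 + q.2 • a k) (q.2 * b k)) - v q.1‖ₑ) mk, ← hμ]
      refine lintegral_mono_ae (ae_restrict_of_ae ?_)
      filter_upwards [hray k] with q hq
      rw [tsub_le_iff_left]
      exact hq
    rw [lintegral_eq_zero_iff (f := fun q => A q - B q) (mA.sub mB)] at hzero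
    rw [Filter.EventuallyEq, ae_restrict_iff' hZm] at hzero
    filter_upwards [hzero] with q hq hqZ
    exact tsub_eq_zero_iff_le.1 (hq hqZ)
  filter_upwards [ae_all_iff.2 box, ae_halfMeasure_pos] with q hq hq0
  obtain ⟨m, hm⟩ := exists_nat_ge (max ‖q.1‖ q.2)
  refine hq m ⟨?_, hq0, ?_⟩
  · rw [mem_ball_zero_iff]
    linarith [(le_max_left _ _).trans hm]
  · linarith [(le_max_right _ _).trans hm]

/-- Jensen's inequality for the weighted length `m(r) dr`. Homogeneity makes the contribution of
each point of the curve equal to the full energy, whatever `r` (`hslice`), so only the weighted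
length of `Γ` remains. -/
theorem lintegral_rpow_sub_trace_le {s p : ℝ} (hp : 1 < p) (hv : IsTrace u v)
    (hu : IsWeakGradient u Du) (hum : StronglyMeasurable u) (hDum : StronglyMeasurable Du)
    (hvm : Measurable v) {Γ Γ' : ℝ → EuclideanSpace ℝ (Fin (n + 1))}
    (hΓ : ∀ r, HasDerivAt Γ (Γ' r) r) (hΓ' : Continuous Γ') (hΓ0 : Γ 0 = 0) {R : ℝ} (hR : 0 < R)
    (hpos : ∀ r ∈ Ioc 0 R, 0 < Γ r (Fin.last n)) :
    ∫⁻ q, ENNReal.ofReal (q.2 ^ (-1 - s * p)) *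
        ‖u (pointAt q.1 0 + q.2 • Γ R) - v q.1‖ₑ ^ p ∂halfMeasure n ≤
      (∫⁻ r in Ioc 0 R, ENNReal.ofReal (Γ r (Fin.last n) ^ (s - 1) * ‖Γ' r‖)) ^ p *
        weightedEnergy s p Du := by
  have hp0 : 0 < p := by linarith
  have hΓc : Continuous Γ := continuous_iff_continuousAt.2 fun r => (hΓ r).continuousAt
  have hΓl : Continuous fun r => Γ r (Fin.last n) := by fun_prop
  have hP : Continuous fun y : (EuclideanSpace ℝ (Fin n) × ℝ) × ℝ =>
      pointAt y.1.1 0 + y.1.2 • Γ y.2 := by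
    have : Continuous fun y : (EuclideanSpace ℝ (Fin n) × ℝ) × ℝ => pointAt y.1.1 0 :=
      continuous_pointAt.comp (by fun_prop : Continuous fun y :
        (EuclideanSpace ℝ (Fin n) × ℝ) × ℝ => (y.1.1, (0 : ℝ)))
    fun_prop
  obtain ⟨m, hm⟩ : ∃ m : ℝ → ℝ≥0∞,
      ∀ r, m r = ENNReal.ofReal (Γ r (Fin.last n) ^ (s - 1) * ‖Γ' r‖) := ⟨_, fun _ => rfl⟩
  obtain ⟨F, hF⟩ : ∃ F : (EuclideanSpace ℝ (Fin n) × ℝ) × ℝ → ℝ≥0∞, ∀ y, F y =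
      ‖Du (pointAt y.1.1 0 + y.1.2 • Γ y.2)‖ₑ *
        ENNReal.ofReal (y.1.2 * Γ y.2 (Fin.last n) ^ (1 - s)) := ⟨_, fun _ => rfl⟩
  obtain ⟨wt, hwt⟩ : ∃ wt : (EuclideanSpace ℝ (Fin n) × ℝ) → ℝ≥0∞, ∀ q, wt q =
      ENNReal.ofReal (q.2 ^ (-1 - s * p)) := ⟨_, fun _ => rfl⟩
  have hwtop : ∀ q, wt q ≠ ⊤ := fun q => by rw [hwt]; exact ENNReal.ofReal_ne_top
  have mm : Measurable m := by
    rw [funext hm]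
    exact ((hΓl.measurable.pow_const _).mul hΓ'.norm.measurable).ennreal_ofReal
  have mF : Measurable F := by
    rw [funext hF]
    refine Measurable.mul (hDum.comp_measurable hP.measurable).enorm
      (Measurable.ennreal_ofReal (Measurable.mul (by fun_prop) ?_))
    exact (hΓl.measurable.pow_const _).comp measurable_snd
  have mw : Measurable wt := by
    rw [funext hwt]
    exact (measurable_snd.pow_const _).ennreal_ofReal
  have mFq : ∀ q, Measurable fun r => F (q, r) := fun q =>
    mF.comp (measurable_prodMk_left (x := q))
  have hpath : ∀ᵐ q ∂halfMeasure n, ‖u (pointAt q.1 0 + q.2 • Γ R) - v q.1‖ₑ ≤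
      ∫⁻ r in Ioc 0 R, m r * F (q, r) := by
    filter_upwards [hv.ae_enorm_sub_le hu hum hDum hvm hΓ hΓ' hΓ0 hR hpos,
      ae_halfMeasure_pos] with q hq hq0
    refine hq.trans (le_of_eq (setLIntegral_congr_fun measurableSet_Ioc fun r hr => ?_))
    have hg := hpos r hr
    have hnn : 0 ≤ q.2 * Γ r (Fin.last n) ^ (1 - s) := by positivity
    have hc : Γ r (Fin.last n) ^ (1 - s) * Γ r (Fin.last n) ^ (s - 1) = 1 := by
      rw [← Real.rpow_add hg]
      simp
    have e : q.2 * ‖Γ' r‖ = q.2 * Γ r (Fin.last n) ^ (1 - s) *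
        (Γ r (Fin.last n) ^ (s - 1) * ‖Γ' r‖) := by
      linear_combination (-(q.2 * ‖Γ' r‖)) * hc
    simp only [hm, hF]
    rw [e, ENNReal.ofReal_mul hnn, ← mul_assoc, mul_comm]
  have hslice : ∀ r ∈ Ioc 0 R,
      ∫⁻ q, wt q * F (q, r) ^ p ∂halfMeasure n = weightedEnergy s p Du := by
    intro r hr
    have hg := hpos r hr
    have mh : Measurable fun z : EuclideanSpace ℝ (Fin (n + 1)) =>
        ENNReal.ofReal (‖Du z‖ ^ p / z (Fin.last n) ^ (1 - (1 - s) * p)) := by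
      have : Measurable fun z : EuclideanSpace ℝ (Fin (n + 1)) => z (Fin.last n) := by fun_prop
      exact ((hDum.norm.measurable.pow_const p).div (this.pow_const _)).ennreal_ofReal
    have hray := lintegral_halfMeasure_ray mh hg
    rw [← weightedEnergy] at hray
    -- The powers of `t` and `Γ_N` combine to the energy weight at height `t Γ_N`, up to one factor
    -- `Γ_N` that cancels the inverse Jacobian of `lintegral_halfMeasure_ray`.
    have h2 : ∫⁻ q, wt q * F (q, r) ^ p ∂halfMeasure n =
        ∫⁻ q, ENNReal.ofReal (Γ r (Fin.last n)) *
          ENNReal.ofReal (‖Du (pointAt q.1 0 + q.2 • Γ r)‖ ^ p /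
            (pointAt q.1 0 + q.2 • Γ r) (Fin.last n) ^ (1 - (1 - s) * p)) ∂halfMeasure n := by
      refine lintegral_congr_ae ?_
      filter_upwards [ae_halfMeasure_pos] with q hq
      have hlast : (pointAt q.1 0 + q.2 • Γ r) (Fin.last n) = q.2 * Γ r (Fin.last n) := by
        simp
      have hnn : 0 ≤ ‖Du (pointAt q.1 0 + q.2 • Γ r)‖ * (q.2 * Γ r (Fin.last n) ^ (1 - s)) := by
        positivity
      rw [hlast, hF, hwt, ← ofReal_norm, ← ENNReal.ofReal_mul (norm_nonneg _),
        ENNReal.ofReal_rpow_of_nonneg hnn hp0.le,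
        ← ENNReal.ofReal_mul (Real.rpow_nonneg hq.le _), ← ENNReal.ofReal_mul hg.le]
      congr 1
      have e1 : q.2 ^ (-1 - s * p) * q.2 ^ p = q.2 ^ (-(1 - (1 - s) * p)) := by
        rw [← Real.rpow_add hq]
        ring_nf
      have e2 : Γ r (Fin.last n) ^ ((1 - s) * p) =
          Γ r (Fin.last n) * Γ r (Fin.last n) ^ (-(1 - (1 - s) * p)) := by
        rw [mul_comm (Γ r (Fin.last n)), ← Real.rpow_add_one hg.ne']
        ring_nf
      rw [Real.mul_rpow (norm_nonneg _) (by positivity), Real.mul_rpow hq.le (by positivity),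
        Real.mul_rpow hq.le hg.le, ← Real.rpow_mul hg.le, div_eq_mul_inv, mul_inv,
        ← Real.rpow_neg hq.le, ← Real.rpow_neg hg.le, ← e1, e2]
      ring
    rw [h2, lintegral_const_mul' _ _ ENNReal.ofReal_ne_top, hray, ← mul_assoc,
      ← ENNReal.ofReal_mul hg.le, mul_inv_cancel₀ hg.ne', ENNReal.ofReal_one, one_mul]
  have mG : Measurable fun y : (EuclideanSpace ℝ (Fin n) × ℝ) × ℝ =>
      wt y.1 * (m y.2 * F y ^ p) :=
    (mw.comp measurable_fst).mul ((mm.comp measurable_snd).mul (mF.pow_const p))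
  have hJ : ∀ᵐ q ∂halfMeasure n, wt q * ‖u (pointAt q.1 0 + q.2 • Γ R) - v q.1‖ₑ ^ p ≤
      (∫⁻ r in Ioc 0 R, m r) ^ (p - 1) * ∫⁻ r in Ioc 0 R, wt q * (m r * F (q, r) ^ p) := by
    filter_upwards [hpath] with q hq
    rw [lintegral_const_mul' _ _ (hwtop q), mul_left_comm]
    refine mul_le_mul_right ?_ _
    exact (ENNReal.rpow_le_rpow hq hp0.le).trans (lintegral_mul_rpow_le mm (mFq q) hp)
  suffices h : ∫⁻ q, wt q * ‖u (pointAt q.1 0 + q.2 • Γ R) - v q.1‖ₑ ^ p ∂halfMeasure n ≤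
      (∫⁻ r in Ioc 0 R, m r) ^ p * weightedEnergy s p Du by
    simpa only [hwt, hm] using h
  refine (lintegral_mono_ae hJ).trans (le_of_eq ?_)
  rw [lintegral_const_mul _ mG.lintegral_prod_right',
    lintegral_lintegral_swap (f := fun q r => wt q * (m r * F (q, r) ^ p)) mG.aemeasurable]
  have h3 : ∫⁻ r in Ioc 0 R, ∫⁻ q, wt q * (m r * F (q, r) ^ p) ∂halfMeasure n =
      ∫⁻ r in Ioc 0 R, m r * weightedEnergy s p Du := by
    refine setLIntegral_congr_fun measurableSet_Ioc fun r hr => ?_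
    rw [← hslice r hr, ← lintegral_const_mul' _ _ (by rw [hm]; exact ENNReal.ofReal_ne_top)]
    exact lintegral_congr fun q => mul_left_comm _ _ _
  rw [h3, lintegral_mul_const _ mm, ← mul_assoc]
  congr 1
  nth_rw 2 [← ENNReal.rpow_one (∫⁻ r in Ioc 0 R, m r)]
  rw [← ENNReal.rpow_add_of_nonneg _ _ (by linarith) zero_le_one]
  congr 1
  ring

end boundary

/-! ### Circular arcs, and integration over the slopes -/

section arc
variable {n : ℕ} {u : EuclideanSpace ℝ (Fin (n + 1)) → ℝ}
  {Du : EuclideanSpace ℝ (Fin (n + 1)) → EuclideanSpace ℝ (Fin (n + 1))}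
  {v : EuclideanSpace ℝ (Fin n) → ℝ}

theorem norm_pointAt_one (η : EuclideanSpace ℝ (Fin n)) : ‖pointAt η 1‖ = (cosAt η)⁻¹ := by
  have h := norm_pointAt_sq η 1
  have h2 := cosAt_sq η
  rw [← sq_eq_sq₀ (norm_nonneg _) (inv_nonneg.2 (cosAt_pos η).le), h, inv_pow, h2, inv_inv]
  ring

theorem hasDerivAt_arc (c d r : ℝ) :
    HasDerivAt (fun r : ℝ => c * (r ^ 2 / (1 + r ^ 2))) (c * (2 * r / (1 + r ^ 2) ^ 2)) r ∧
    HasDerivAt (fun r : ℝ => d * (r / (1 + r ^ 2))) (d * ((1 - r ^ 2) / (1 + r ^ 2) ^ 2)) r := by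
  have hA : (1 + r ^ 2 : ℝ) ≠ 0 := by positivity
  have h1 : HasDerivAt (fun r : ℝ => r ^ 2) (2 * r) r := by simpa using hasDerivAt_pow 2 r
  have h2 : HasDerivAt (fun r : ℝ => 1 + r ^ 2) (2 * r) r := h1.const_add 1
  refine ⟨((h1.div h2 hA).const_mul c).congr_deriv ?_,
    (((hasDerivAt_id r).div h2 hA).const_mul d).congr_deriv ?_⟩
  · field_simp
    ring
  · simp only [id]
    field_simp
    ring

/-- The weighted difference quotients along the rays of slope `η` from the boundary, estimated by
integrating the gradient along arcs of circles centred on the boundary. -/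
theorem lintegral_rpow_sub_trace_slope_le {s p : ℝ} (hs0 : 0 < s) (hs1 : s ≤ 1) (hp : 1 < p)
    (hv : IsTrace u v) (hu : IsWeakGradient u Du) (hum : StronglyMeasurable u)
    (hDum : StronglyMeasurable Du) (hvm : Measurable v) {η : EuclideanSpace ℝ (Fin n)}
    (hη : η ≠ 0) :
    ∫⁻ q, ENNReal.ofReal (q.2 ^ (-1 - s * p)) *
        ‖u (pointAt (q.1 + q.2 • η) q.2) - v q.1‖ₑ ^ p ∂halfMeasure n ≤
      ENNReal.ofReal ((1 + ‖η‖ ^ 2) ^ (s / 2) * arcBound s (1 + ‖η‖ ^ 2)⁻¹ / s) ^ p *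
        weightedEnergy s p Du := by
  set R := ‖η‖ with hR'
  have hR : 0 < R := norm_pos_iff.2 hη
  -- Diameter of the circle with centre on the boundary through `0` and `(η, 1)`. The parameter `r`
  -- is the ratio of horizontal to vertical coordinate, so the arc ends at `r = R`.
  set D := (1 + R ^ 2) / R with hD'
  have hD : 0 < D := by positivity
  set c : ℝ → ℝ := fun r => D / R * (r ^ 2 / (1 + r ^ 2)) with hc
  set b : ℝ → ℝ := fun r => D * (r / (1 + r ^ 2)) with hb
  set c' : ℝ → ℝ := fun r => D / R * (2 * r / (1 + r ^ 2) ^ 2) with hc'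
  set b' : ℝ → ℝ := fun r => D * ((1 - r ^ 2) / (1 + r ^ 2) ^ 2) with hb'
  have hsplit : ∀ x y : ℝ, pointAt (x • η) y = x • pointAt η 0 + y • pointAt 0 1 := by
    intro x y
    rw [← pointAt_smul, ← pointAt_smul, ← pointAt_add]
    simp
  have hΓ : ∀ r, HasDerivAt (fun r => pointAt (c r • η) (b r)) (pointAt (c' r • η) (b' r)) r := by
    intro r
    simp only [hsplit]
    obtain ⟨h1, h2⟩ := hasDerivAt_arc (D / R) D r
    exact (h1.smul_const _).add (h2.smul_const _)
  have hden : ∀ r : ℝ, (1 + r ^ 2) ^ 2 ≠ 0 := fun r => by positivity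
  have hΓ' : Continuous fun r => pointAt (c' r • η) (b' r) := by
    simp only [hsplit]
    have h1 : Continuous c' :=
      continuous_const.mul (Continuous.div (by fun_prop) (by fun_prop) hden)
    have h2 : Continuous b' :=
      continuous_const.mul (Continuous.div (by fun_prop) (by fun_prop) hden)
    exact (h1.smul continuous_const).add (h2.smul continuous_const)
  have hspeed : ∀ r, ‖pointAt (c' r • η) (b' r)‖ = D / (1 + r ^ 2) := by
    intro r
    have h := norm_pointAt_sq (c' r • η) (b' r)
    rw [← sq_eq_sq₀ (norm_nonneg _) (by positivity), h, norm_smul, mul_pow, Real.norm_eq_abs,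
      sq_abs, ← hR', hc', hb']
    have : (1 + r ^ 2 : ℝ) ≠ 0 := by positivity
    field_simp
    ring
  have hΓ0 : pointAt (c 0 • η) (b 0) = 0 := by
    rw [hsplit]
    simp [hc, hb]
  have hpos : ∀ r ∈ Ioc 0 R, 0 < pointAt (c r • η) (b r) (Fin.last n) := by
    intro r hr
    have := hr.1
    rw [pointAt_last]
    positivity
  have hcR : c R = 1 := by
    simp only [hc, hD']
    field_simp
  have hbR : b R = 1 := by
    simp only [hb, hD']
    field_simp
  have key := lintegral_rpow_sub_trace_le (s := s) hp hv hu hum hDum hvm hΓ hΓ' hΓ0 hR hpos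
  simp only [hcR, hbR, one_smul, pointAt_zero_add_smul, mul_one, pointAt_last, hspeed] at key
  refine key.trans (mul_le_mul_left (ENNReal.rpow_le_rpow ?_ (by linarith)) _)
  have e : ∀ r ∈ Ioc 0 R, ENNReal.ofReal (b r ^ (s - 1) * (D / (1 + r ^ 2))) =
      ENNReal.ofReal (D ^ s) * ENNReal.ofReal (r ^ (s - 1) * (1 + r ^ 2) ^ (-s)) := by
    intro r hr
    have hr0 := hr.1
    have hA : (0 : ℝ) < 1 + r ^ 2 := by positivity
    rw [← ENNReal.ofReal_mul (by positivity)]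
    congr 1
    simp only [hb]
    rw [Real.mul_rpow hD.le (by positivity), Real.div_rpow hr0.le hA.le, Real.rpow_sub_one hD.ne',
      Real.rpow_sub_one hA.ne', Real.rpow_neg hA.le]
    field_simp
  rw [setLIntegral_congr_fun measurableSet_Ioc e, lintegral_const_mul' _ _ ENNReal.ofReal_ne_top,
    ← arcPrimitive_eq hs0 hR, ENNReal.ofReal_mul (by positivity)]
  exact mul_le_mul_right (lintegral_arc_le hs0 hs1 hR) _

theorem lintegral_comp_smul {g : EuclideanSpace ℝ (Fin n) → ℝ≥0∞} (hg : Measurable g) {t : ℝ}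
    (ht : 0 < t) : ENNReal.ofReal (t ^ n) * ∫⁻ η, g (t • η) = ∫⁻ y, g y := by
  have h := Measure.map_addHaar_smul (volume : Measure (EuclideanSpace ℝ (Fin n))) ht.ne'
  rw [← lintegral_map hg (measurable_const_smul t), h, lintegral_smul_measure, smul_eq_mul,
    ← mul_assoc, ← ENNReal.ofReal_mul (by positivity), finrank_euclideanSpace_fin,
    abs_of_pos (by positivity), mul_inv_cancel₀ (by positivity), ENNReal.ofReal_one, one_mul]

/-- Lower integrals over the half-space, in coordinates on the cone of rays from `(x, 0)`. -/
theorem setLIntegral_upperHalf_cone {f : EuclideanSpace ℝ (Fin (n + 1)) → ℝ≥0∞}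
    (hf : Measurable f) (x : EuclideanSpace ℝ (Fin n)) :
    ∫⁻ y in upperHalf n, f y =
      ∫⁻ t in Ioi (0 : ℝ), ∫⁻ η, ENNReal.ofReal (t ^ n) * f (pointAt (x + t • η) t) := by
  have hm : Measurable fun q : EuclideanSpace ℝ (Fin n) × ℝ => f (pointAt q.1 q.2) :=
    hf.comp continuous_pointAt.measurable
  rw [lintegral_upperHalf_eq, halfMeasure,
    lintegral_prod_symm' (fun q : EuclideanSpace ℝ (Fin n) × ℝ => f (pointAt q.1 q.2)) hm]
  refine setLIntegral_congr_fun measurableSet_Ioi fun t ht => ?_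
  have hmt : Measurable fun y => f (pointAt y t) := hm.comp measurable_prodMk_right
  simp only
  rw [lintegral_const_mul' _ _ ENNReal.ofReal_ne_top,
    lintegral_comp_smul (g := fun y => f (pointAt (x + y) t)) (hmt.comp (measurable_const_add x)) ht,
    lintegral_add_left_eq_self (fun y => f (pointAt y t)) x]

/-- The distance from `(x, 0)` to `(x + t η, t)` is `t / cosAt η`, and `n - (n + 1 + s p) = -1 - s
p` is the resulting power of `t`. -/
theorem conjunction_kernel_eq {s p : ℝ} (hp : 0 < p) (a : ℝ) (x η : EuclideanSpace ℝ (Fin n))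
    {t : ℝ} (ht : 0 < t) :
    ENNReal.ofReal (t ^ n) * ENNReal.ofReal (|a| ^ p /
        ‖pointAt x 0 - pointAt (x + t • η) t‖ ^ (((n + 1 : ℕ) : ℝ) + s * p)) =
      ENNReal.ofReal (cosAt η ^ (((n + 1 : ℕ) : ℝ) + s * p)) *
        (ENNReal.ofReal (t ^ (-1 - s * p)) * ‖a‖ₑ ^ p) := by
  have hc := cosAt_pos η
  have hnorm : ‖pointAt x 0 - pointAt (x + t • η) t‖ = t * (cosAt η)⁻¹ := by
    rw [← norm_pointAt_one, ← pointAt_sub]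
    have : pointAt (x - (x + t • η)) (0 - t) = -(t • pointAt η 1) := by
      rw [← pointAt_smul, ← neg_one_smul ℝ, ← pointAt_smul]
      simp
    rw [this, norm_neg, norm_smul, Real.norm_of_nonneg ht.le]
  rw [hnorm, ← ofReal_norm, Real.norm_eq_abs, ENNReal.ofReal_rpow_of_nonneg (abs_nonneg a) hp.le,
    ← ENNReal.ofReal_mul (by positivity), ← ENNReal.ofReal_mul (by positivity),
    ← ENNReal.ofReal_mul (by positivity)]
  congr 1
  rw [Real.mul_rpow ht.le (by positivity), Real.inv_rpow hc.le, div_eq_mul_inv, mul_inv, inv_inv,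
    ← Real.rpow_neg ht.le, ← Real.rpow_natCast]
  have e : t ^ (-1 - s * p) = t ^ (n : ℝ) * t ^ (-(((n + 1 : ℕ) : ℝ) + s * p)) := by
    rw [← Real.rpow_add ht]
    congr 1
    push_cast
    ring
  rw [e]
  ring

theorem conjunctionIntegral_eq {s p : ℝ} (hp : 0 < p) (hum : StronglyMeasurable u)
    (hvm : Measurable v) :
    conjunctionIntegral s p u v = ∫⁻ η : EuclideanSpace ℝ (Fin n),
      ENNReal.ofReal (cosAt η ^ (((n + 1 : ℕ) : ℝ) + s * p)) *
        ∫⁻ q, ENNReal.ofReal (q.2 ^ (-1 - s * p)) *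
          ‖u (pointAt (q.1 + q.2 • η) q.2) - v q.1‖ₑ ^ p ∂halfMeasure n := by
  obtain ⟨K, hK⟩ : ∃ K : (EuclideanSpace ℝ (Fin n) × ℝ) × EuclideanSpace ℝ (Fin n) → ℝ≥0∞,
      ∀ y, K y = ENNReal.ofReal (cosAt y.2 ^ (((n + 1 : ℕ) : ℝ) + s * p)) *
        (ENNReal.ofReal (y.1.2 ^ (-1 - s * p)) *
          ‖u (pointAt (y.1.1 + y.1.2 • y.2) y.1.2) - v y.1.1‖ₑ ^ p) := ⟨_, fun _ => rfl⟩
  have mK : Measurable K := by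
    rw [funext hK]
    refine Measurable.mul ?_ (Measurable.mul ?_ (Measurable.pow_const ?_ p))
    · exact ((measurable_cosAt.comp measurable_snd).pow_const _).ennreal_ofReal
    · exact ((measurable_snd.comp measurable_fst).pow_const _).ennreal_ofReal
    · exact ((hum.measurable.comp (continuous_pointAt.measurable.comp (by fun_prop :
        Measurable fun y : (EuclideanSpace ℝ (Fin n) × ℝ) × EuclideanSpace ℝ (Fin n) =>
          (y.1.1 + y.1.2 • y.2, y.1.2)))).sub
        (hvm.comp (measurable_fst.comp measurable_fst))).enorm
  have h1 : conjunctionIntegral s p u v =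
      ∫⁻ x : EuclideanSpace ℝ (Fin n), ∫⁻ t in Ioi (0 : ℝ), ∫⁻ η, K ((x, t), η) := by
    refine lintegral_congr fun x => ?_
    have mf : Measurable fun y => ENNReal.ofReal
        (|v x - u y| ^ p / ‖pointAt x 0 - y‖ ^ (((n + 1 : ℕ) : ℝ) + s * p)) := by
      refine Measurable.ennreal_ofReal (Measurable.div (Measurable.pow_const ?_ _)
        (Measurable.pow_const ?_ _))
      · exact (hum.measurable.const_sub (v x)).abs
      · exact Measurable.norm (measurable_id.const_sub _)
    rw [setLIntegral_upperHalf_cone mf x]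
    refine setLIntegral_congr_fun measurableSet_Ioi fun t ht => lintegral_congr fun η => ?_
    rw [conjunction_kernel_eq hp _ x η ht, hK, enorm_sub_rev]
  rw [h1, ← lintegral_prod (fun q => ∫⁻ η, K (q, η)) mK.lintegral_prod_right'.aemeasurable,
    ← halfMeasure, lintegral_lintegral_swap (f := fun q η => K (q, η)) mK.aemeasurable]
  refine lintegral_congr fun η => ?_
  simp only [hK]
  rw [lintegral_const_mul' _ _ ENNReal.ofReal_ne_top]

theorem conjunctionIntegral_le {s p : ℝ} (hn : 1 ≤ n) (hs0 : 0 < s) (hs1 : s ≤ 1) (hp : 1 < p)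
    (hv : IsTrace u v) (hu : IsWeakGradient u Du) (hum : StronglyMeasurable u)
    (hDum : StronglyMeasurable Du) (hvm : Measurable v) :
    conjunctionIntegral s p u v ≤
      ENNReal.ofReal (cosMoment n (s * p) * ((n + 1 : ℝ) / s) ^ p) * weightedEnergy s p Du := by
  have hp0 : 0 < p := by linarith
  have hsp : 0 < s ^ p := by positivity
  have : Nonempty (Fin n) := ⟨⟨0, hn⟩⟩
  rw [conjunctionIntegral_eq hp0 hum hvm]
  -- At slope `0` the circle degenerates to a vertical line; a point is negligible because `n ≥ 1`.
  have hne : ∀ᵐ η : EuclideanSpace ℝ (Fin n), η ≠ 0 := by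
    rw [ae_iff]
    simp
  calc _ ≤ ∫⁻ η : EuclideanSpace ℝ (Fin n), ENNReal.ofReal ((s ^ p)⁻¹) *
        ENNReal.ofReal (cosAt η ^ (n + 1 : ℕ) * arcBound s (cosAt η ^ 2) ^ p) *
          weightedEnergy s p Du := by
        refine lintegral_mono_ae ?_
        filter_upwards [hne] with η hη
        refine (mul_le_mul_right (lintegral_rpow_sub_trace_slope_le hs0 hs1 hp hv hu hum hDum hvm
          hη) _).trans (le_of_eq ?_)
        have hc := cosAt_pos η
        have hb : 0 ≤ arcBound s (cosAt η ^ 2) :=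
          zero_le_one.trans (one_le_arcBound hs0 hs1 (cosAt_sq_mem η))
        have h1 : (1 + ‖η‖ ^ 2) ^ (s / 2) = cosAt η ^ (-s) := by
          rw [cosAt_rpow]
          congr 1
          ring
        rw [h1, ← cosAt_sq, ENNReal.ofReal_rpow_of_nonneg (by positivity) hp0.le, ← mul_assoc,
          ← ENNReal.ofReal_mul (by positivity), ← ENNReal.ofReal_mul (by positivity)]
        congr 2
        rw [Real.div_rpow (by positivity) hs0.le, Real.mul_rpow (by positivity) hb,
          ← Real.rpow_mul hc.le, ← Real.rpow_natCast (cosAt η) (n + 1)]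
        -- The power `cosAt ^ (-s p)` from the arc length cancels the `s p` in the kernel and leaves
        -- the half-sphere density.
        have e : cosAt η ^ ((n + 1 : ℕ) : ℝ) =
            cosAt η ^ (((n + 1 : ℕ) : ℝ) + s * p) * cosAt η ^ (-s * p) := by
          rw [← Real.rpow_add hc]
          congr 1
          ring
        rw [e]
        field_simp
    _ = ENNReal.ofReal ((s ^ p)⁻¹) * (∫⁻ η : EuclideanSpace ℝ (Fin n),
          ENNReal.ofReal (cosAt η ^ (n + 1 : ℕ) * arcBound s (cosAt η ^ 2) ^ p)) *
            weightedEnergy s p Du := by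
        have m1 : Measurable fun η : EuclideanSpace ℝ (Fin n) =>
            ENNReal.ofReal (cosAt η ^ (n + 1 : ℕ) * arcBound s (cosAt η ^ 2) ^ p) :=
          ((measurable_cosAt.pow_const _).mul (((measurable_arcBound).comp
            (measurable_cosAt.pow_const 2)).pow_const p)).ennreal_ofReal
        rw [lintegral_mul_const _ (m1.const_mul _), lintegral_const_mul _ m1]
    _ ≤ ENNReal.ofReal ((s ^ p)⁻¹) * ENNReal.ofReal ((n + 1 : ℝ) ^ p * cosMoment n (s * p)) *
          weightedEnergy s p Du := by
        gcongr
        exact lintegral_arcBound_le hn hs0 hs1 hp.le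
    _ = _ := by
        rw [← ENNReal.ofReal_mul (by positivity), Real.div_rpow (by positivity) hs0.le]
        congr 2
        field_simp

end arc

/-! ### Independence of the representatives -/

section congruence
variable {n : ℕ} {u u₁ : EuclideanSpace ℝ (Fin (n + 1)) → ℝ}
  {Du Du₁ : EuclideanSpace ℝ (Fin (n + 1)) → EuclideanSpace ℝ (Fin (n + 1))}
  {v v₁ : EuclideanSpace ℝ (Fin n) → ℝ}

theorem locallyIntegrableOn_upperHalf_congr {F : Type*} [NormedAddCommGroup F]
    {f g : EuclideanSpace ℝ (Fin (n + 1)) → F} (hf : LocallyIntegrableOn f (upperHalf n) volume)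
    (h : f =ᵐ[volume.restrict (upperHalf n)] g) :
    LocallyIntegrableOn g (upperHalf n) volume := by
  rw [locallyIntegrableOn_iff isOpen_upperHalf.isLocallyClosed] at hf ⊢
  exact fun K hK hKc => (hf K hK hKc).congr (ae_restrict_of_ae_restrict_of_subset hK h)

theorem IsWeakGradient.congr (hu : IsWeakGradient u Du)
    (h : u =ᵐ[volume.restrict (upperHalf n)] u₁) (hD : Du =ᵐ[volume.restrict (upperHalf n)] Du₁) :
    IsWeakGradient u₁ Du₁ where
  locallyIntegrable := locallyIntegrableOn_upperHalf_congr hu.locallyIntegrable h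
  locallyIntegrable_grad := locallyIntegrableOn_upperHalf_congr hu.locallyIntegrable_grad hD
  integral_eq φ hφ hφc hφs i := by
    have h1 : ∫ z in upperHalf n, u₁ z * fderiv ℝ φ z (EuclideanSpace.single i 1) =
        ∫ z in upperHalf n, u z * fderiv ℝ φ z (EuclideanSpace.single i 1) := by
      refine integral_congr_ae ?_
      filter_upwards [h] with z hz
      rw [hz]
    have h2 : ∫ z in upperHalf n, Du₁ z i * φ z = ∫ z in upperHalf n, Du z i * φ z := by
      refine integral_congr_ae ?_
      filter_upwards [hD] with z hz
      rw [hz]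
    rw [h1, h2]
    exact hu.integral_eq φ hφ hφc hφs i

theorem weightedEnergy_congr (s p : ℝ) (hD : Du =ᵐ[volume.restrict (upperHalf n)] Du₁) :
    weightedEnergy s p Du = weightedEnergy s p Du₁ := by
  refine lintegral_congr_ae ?_
  filter_upwards [hD] with z hz
  rw [hz]

theorem conjunctionIntegral_congr (s p : ℝ) (h : u =ᵐ[volume.restrict (upperHalf n)] u₁)
    (hv : v =ᵐ[volume] v₁) : conjunctionIntegral s p u v = conjunctionIntegral s p u₁ v₁ := by
  refine lintegral_congr_ae ?_
  filter_upwards [hv] with x hx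
  refine lintegral_congr_ae ?_
  filter_upwards [h] with y hy
  rw [hx, hy]

theorem ae_ae_pointAt {P : EuclideanSpace ℝ (Fin (n + 1)) → Prop}
    (h : ∀ᵐ z ∂volume.restrict (upperHalf n), P z) :
    ∀ᵐ t ∂volume.restrict (Ioi (0 : ℝ)), ∀ᵐ x : EuclideanSpace ℝ (Fin n), P (pointAt x t) := by
  have h1 : ∀ᵐ q ∂halfMeasure n, P (pointAt q.1 q.2) := by
    rw [ae_restrict_iff' measurableSet_upperHalf] at h
    have h2 := measurePreserving_pointAt.quasiMeasurePreserving.ae h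
    have h3 := ae_restrict_of_ae (s := univ ×ˢ Ioi 0) h2
    rw [← halfMeasure_eq] at h3
    filter_upwards [h3, ae_halfMeasure_pos] with q hq hq0
    exact hq (pointAt_mem_upperHalf.2 hq0)
  exact Measure.ae_ae_of_ae_prod ((Measure.measurePreserving_swap
    (μ := volume.restrict (Ioi (0 : ℝ)))
    (ν := (volume : Measure (EuclideanSpace ℝ (Fin n))))).quasiMeasurePreserving.ae h1)

theorem IsTrace.congr (ht : IsTrace u v) (h : u =ᵐ[volume.restrict (upperHalf n)] u₁)
    (hv : v =ᵐ[volume] v₁) : IsTrace u₁ v₁ where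
  locallyIntegrable x := by
    obtain ⟨U, hU, hi⟩ := ht.locallyIntegrable x
    exact ⟨U, hU, hi.congr (ae_restrict_of_ae hv)⟩
  tendsto_mean R hR := by
    refine (ht.tendsto_mean R hR).congr fun ε => ?_
    congr 1
    refine lintegral_congr_ae ?_
    filter_upwards [ae_restrict_of_ae_restrict_of_subset Ioo_subset_Ioi_self (ae_ae_pointAt h)]
      with t ht
    refine lintegral_congr_ae (ae_restrict_of_ae ?_)
    filter_upwards [ht, hv] with x hx hx'
    rw [hx, hx']

end congruence

theorem theorem2p1 (N n : ℕ) (hN : 2 ≤ N) (hn : N = n + 1) (s p : ℝ) (hs0 : 0 < s) (hs1 : s < 1)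
    (hp : 1 < p) (u : EuclideanSpace ℝ (Fin (n + 1)) → ℝ)
    (Du : EuclideanSpace ℝ (Fin (n + 1)) → EuclideanSpace ℝ (Fin (n + 1)))
    (hu : IsWeakGradient u Du) (hE : weightedEnergy s p Du < ⊤) :
    (∃ v : EuclideanSpace ℝ (Fin n) → ℝ, IsTrace u v) ∧
    ∀ v : EuclideanSpace ℝ (Fin n) → ℝ, IsTrace u v →
      conjunctionIntegral s p u v ≤
        ENNReal.ofReal (Real.pi ^ (((N : ℝ) - 1) / 2) * Real.Gamma ((s * p + 1) / 2) /
            Real.Gamma (((N : ℝ) + s * p) / 2) * ((N : ℝ) / s) ^ p) *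
          weightedEnergy s p Du := by
  -- All the hypotheses and quantities depend only on almost everywhere classes, so the estimates
  -- are applied to measurable representatives.
  have hum := hu.locallyIntegrable.aestronglyMeasurable
  have hDum := hu.locallyIntegrable_grad.aestronglyMeasurable
  have hu₁ := hu.congr hum.ae_eq_mk hDum.ae_eq_mk
  have hE₁ := weightedEnergy_congr s p hDum.ae_eq_mk
  refine ⟨?_, fun v hv => ?_⟩
  · obtain ⟨v, hv⟩ := hu₁.exists_isTrace hs0 hp hum.stronglyMeasurable_mk
      hDum.stronglyMeasurable_mk (hE₁ ▸ hE)
    exact ⟨v, hv.congr hum.ae_eq_mk.symm (ae_eq_refl v)⟩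
  · have hvm := hv.locallyIntegrable.aestronglyMeasurable
    have hn1 : 1 ≤ n := by omega
    have h := conjunctionIntegral_le hn1 hs0 hs1.le hp (hv.congr hum.ae_eq_mk hvm.ae_eq_mk) hu₁
      hum.stronglyMeasurable_mk hDum.stronglyMeasurable_mk hvm.stronglyMeasurable_mk.measurable
    rw [← conjunctionIntegral_congr s p hum.ae_eq_mk hvm.ae_eq_mk, ← hE₁, cosMoment] at h
    have hNn : (N : ℝ) = n + 1 := by rw [hn]; push_cast; rfl
    rw [hNn, add_sub_cancel_right, add_comm (s * p) 1]
    exact h
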